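/- Let $K$ be a number field with absolute Galois group $G_K$, let $E$ be a number field that is Galois over $\mathbb{Q}$, let $p$ be a prime and put $E_p=E\otimes_{\mathbb Q}\mathbb{Q}_p$ with its $p$-adic topology. Let $\rho_p:G_K\to \mathrm{GL}_n(E_p)$ be a continuous representation, and for each embedding $\lambda:E\hookrightarrow\overline{\mathbb Q}_p$ let $\rho_\lambda:G_K\to \mathrm{GL}_n(\overline{\mathbb Q}_p)$ be the representation obtained from $\rho_p$ by extension of scalars along $\lambda\otimes\mathrm{id}:E_p\to\overline{\mathbb Q}_p$. Assume that $\rho_p$ is valid, that is: (1) there is a finite set $S$ of places of $K$ containing the archimedean places and the places above $p$ such that every $\rho_\lambda$ is unramified outside $S$ and, for every $v\notin S$, the characteristic polynomial of $\rho_p(\mathrm{Frob}_v)$ has coefficients in $E$; (2) no $\rho_\lambda$ is isomorphic to $\rho_\lambda\otimes\chi$ for a non-trivial continuous character $\chi:G_K\to\overline{\mathbb Q}_p^\times$, and, if $n>2$, no $\rho_\lambda$ is isomorphic to $\rho_\lambda^\vee\otimes\eta$ for a continuous character $\eta:G_K\to\overline{\mathbb Q}_p^\times$; (3) $\det\rho_p=1$;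 (4) for every $\lambda$, the $\overline{\mathbb Q}_p$-span in $M_n(\overline{\mathbb Q}_p)$ of the Lie algebra of the $p$-adic Lie group $\rho_\lambda(G_K)$ is $\mathfrak{sl}_n(\overline{\mathbb Q}_p)$. An inner-twist (respectively outer-twist) of $\rho_p$ is a pair $(\sigma,\chi)$ with $\sigma\in\mathrm{Aut}(E)$ and $\chi:G_K\to E_p^\times$ a continuous character such that ${}^\sigma\rho_p\cong\rho_p\otimes\chi$ (respectively ${}^\sigma\rho_p\cong\rho_p^\vee\otimes\chi$), where $\sigma$ acts on $E_p$ through $E$; an extra-twist is an inner- or an outer-twist. Let $\Gamma\subseteq\mathrm{Aut}(E)$ be the group of all $\sigma$ that occur in an extra-twist, let $F=E^\Gamma$, so that $\Gamma=\mathrm{Gal}(E/F)$, put $F_p=F\otimes_{\mathbb Q}\mathbb{Q}_p$, and let $G_L\subseteq G_K$ be the intersection of the kernels of the characters $\chi$ of all extra-twists $(\sigma,\chi)$. Then there is a map $f:\Gamma\to\mathrm{Aut}_{E_p}(\mathrm{SL}_n)$ such that for every $\sigma\in\Gamma$ one of the following holds for some $\alpha_\sigma\in \mathrm{GL}_n(E_p)$: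 either $\sigma$ occurs in an inner-twist, $\rho_p|_{G_L}=\alpha_\sigma\cdot{}^\sigma\rho_p|_{G_L}\cdot\alpha_\sigma^{-1}$ and $f_\sigma=\mathrm{ad}(\alpha_\sigma)$; or $\sigma$ occurs in an outer-twist, $\rho_p|_{G_L}=\alpha_\sigma\cdot{}^\sigma\rho_p^{-T}|_{G_L}\cdot\alpha_\sigma^{-1}$ and $f_\sigma=\mathrm{ad}(\alpha_\sigma)\circ(\cdot)^{-T}$. For every such $f$ let $H=(\mathrm{Res}^{E_p}_{F_p}\mathrm{SL}_n)^{tw_f(\Gamma)}$ be the algebraic group over $F_p$ with $$H(R)=\{g\in \mathrm{SL}_n(E_p\otimes_{F_p}R)\;:\; f_\sigma({}^\sigma g)=g\ \text{for all}\ \sigma\in\Gamma\}$$ for every $F_p$-algebra $R$. Then the $\mathbb{Q}_p$-Lie algebra of $\rho_p(G_L)$ and the Lie algebra of the algebraic group $H$ are equal as subsets of $M_n(E_p)$, and $\rho_p(G_L)$ is contained in $H(F_p)\subseteq \mathrm{SL}_n(E_p)$ and is open in $H(F_p)$. -/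

import Mathlib

open scoped TensorProduct Matrix MatrixGroups Topology NumberField
open Matrix

universe u v

noncomputable section

/-! ### Representations with values in `GL_n` -/

section Representations

variable {n : ℕ} {G : Type v} [Group G]

/-- The automorphism `g ↦ g^{-T}` of `GL_n(A)`. -/
def glInvTranspose (n : ℕ) (A : Type u) [CommRing A] : GL (Fin n) A →* GL (Fin n) A where
  toFun g := ⟨(↑(g⁻¹) : Matrix (Fin n) (Fin n) A)ᵀ, (g : Matrix (Fin n) (Fin n) A)ᵀ,
    by rw [← Matrix.transpose_mul, ← Units.val_mul]; simp,
    by rw [← Matrix.transpose_mul, ← Units.val_mul]; simp⟩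
  map_one' := by apply Units.ext; simp
  map_mul' g h := by
    apply Units.ext
    simp only [_root_.mul_inv_rev, Units.val_mul, Matrix.transpose_mul]

/-- The dual (contragredient) representation `g ↦ ρ(g)^{-T}`. -/
def dualRep {A : Type u} [CommRing A] (ρ : G →* GL (Fin n) A) : G →* GL (Fin n) A :=
  (glInvTranspose n A).comp ρ

/-- The twist `ρ ⊗ χ` of a representation by a character. -/
def twistRep {A : Type u} [CommRing A] (ρ : G →* GL (Fin n) A) (χ : G →* Aˣ) :
    G →* GL (Fin n) A where
  toFun g := Matrix.GeneralLinearGroup.scalar (Fin n) (χ g) * ρ g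
  map_one' := by simp
  map_mul' g h := by
    simp only [map_mul]
    rw [mul_assoc, mul_assoc, ← mul_assoc _ (ρ g) (ρ h), ← mul_assoc (ρ g) _ (ρ h),
      Matrix.GeneralLinearGroup.scalar_commute _ (ρ g)]

/-- The representation obtained by extending scalars along a ring homomorphism. -/
def mapRep {A B : Type*} [CommRing A] [CommRing B] (φ : A →+* B) (ρ : G →* GL (Fin n) A) :
    G →* GL (Fin n) B :=
  (Matrix.GeneralLinearGroup.map φ).comp ρ

/-- Isomorphism of representations on free modules with chosen bases. -/
def RepIso {A : Type u} [CommRing A] (r s : G →* GL (Fin n) A) : Prop :=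
  ∃ P : GL (Fin n) A, ∀ g, r g = P * s g * P⁻¹

/-- `r` is self-twist: `r ≃ r ⊗ χ` for a non-trivial continuous character `χ`. -/
def IsSelfTwist [TopologicalSpace G] {A : Type u} [CommRing A] [TopologicalSpace A]
    (r : G →* GL (Fin n) A) : Prop :=
  ∃ χ : G →ₜ* Aˣ, (∃ g, χ g ≠ 1) ∧ RepIso r (twistRep r χ.toMonoidHom)

/-- `r` is essentially self-dual: `r ≃ r^∨ ⊗ η` for a continuous character `η`. -/
def IsEssentiallySelfDual [TopologicalSpace G] {A : Type u} [CommRing A] [TopologicalSpace A]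
    (r : G →* GL (Fin n) A) : Prop :=
  ∃ η : G →ₜ* Aˣ, RepIso r (twistRep (dualRep r) η.toMonoidHom)

section Lemmas

variable {A B : Type u} [CommRing A] [CommRing B]

theorem glInvTranspose_invol (g : GL (Fin n) A) :
    glInvTranspose n A (glInvTranspose n A g) = g := by
  apply Units.ext
  change ((g : Matrix (Fin n) (Fin n) A)ᵀ)ᵀ = g
  simp

theorem glInvTranspose_scalar (c : Aˣ) :
    glInvTranspose n A (Matrix.GeneralLinearGroup.scalar (Fin n) c) =
      Matrix.GeneralLinearGroup.scalar (Fin n) c⁻¹ := by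
  apply Units.ext
  change (↑((Matrix.GeneralLinearGroup.scalar (Fin n) c)⁻¹) : Matrix (Fin n) (Fin n) A)ᵀ = _
  rw [← map_inv, Matrix.GeneralLinearGroup.coe_scalar, Matrix.scalar_apply,
    Matrix.diagonal_transpose]

theorem glInvTranspose_map (φ : A →+* B) (g : GL (Fin n) A) :
    glInvTranspose n B (Matrix.GeneralLinearGroup.map φ g) =
      Matrix.GeneralLinearGroup.map φ (glInvTranspose n A g) := by
  apply Units.ext
  change (↑((Matrix.GeneralLinearGroup.map φ g)⁻¹) : Matrix (Fin n) (Fin n) B)ᵀ = _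
  rw [← map_inv]
  rfl

theorem dualRep_dualRep (r : G →* GL (Fin n) A) : dualRep (dualRep r) = r :=
  MonoidHom.ext fun g => glInvTranspose_invol (r g)

theorem dualRep_twistRep (r : G →* GL (Fin n) A) (χ : G →* Aˣ) :
    dualRep (twistRep r χ) = twistRep (dualRep r) χ⁻¹ := by
  ext1 g
  change glInvTranspose n A (_ * _) = _ * _
  rw [map_mul, glInvTranspose_scalar]
  rfl

theorem dualRep_mapRep (φ : A →+* B) (r : G →* GL (Fin n) A) :
    dualRep (mapRep φ r) = mapRep φ (dualRep r) :=
  MonoidHom.ext fun g => glInvTranspose_map φ (r g)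

theorem mapRep_twistRep (φ : A →+* B) (r : G →* GL (Fin n) A) (χ : G →* Aˣ) :
    mapRep φ (twistRep r χ) = twistRep (mapRep φ r) ((Units.map (φ : A →* B)).comp χ) := by
  ext1 g
  change Matrix.GeneralLinearGroup.map φ (_ * _) = _ * _
  rw [map_mul, Matrix.GeneralLinearGroup.map_scalar]
  rfl

theorem twistRep_twistRep (r : G →* GL (Fin n) A) (χ η : G →* Aˣ) :
    twistRep (twistRep r χ) η = twistRep r (χ * η) := by
  ext1 g
  change _ * (_ * _) = Matrix.GeneralLinearGroup.scalar (Fin n) (χ g * η g) * _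
  rw [mul_comm (χ g), map_mul, mul_assoc]

theorem twistRep_one (r : G →* GL (Fin n) A) : twistRep r 1 = r := by
  ext1 g
  change Matrix.GeneralLinearGroup.scalar (Fin n) 1 * r g = r g
  rw [map_one, one_mul]

namespace RepIso

variable {r s t : G →* GL (Fin n) A}

theorem refl (r : G →* GL (Fin n) A) : RepIso r r := ⟨1, by simp⟩

theorem symm (h : RepIso r s) : RepIso s r := by
  obtain ⟨P, hP⟩ := h
  exact ⟨P⁻¹, fun g => by rw [hP g]; group⟩

theorem trans (h : RepIso r s) (h' : RepIso s t) : RepIso r t := by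
  obtain ⟨P, hP⟩ := h
  obtain ⟨Q, hQ⟩ := h'
  exact ⟨P * Q, fun g => by rw [hP g, hQ g]; group⟩

theorem map (φ : A →+* B) (h : RepIso r s) : RepIso (mapRep φ r) (mapRep φ s) := by
  obtain ⟨P, hP⟩ := h
  refine ⟨Matrix.GeneralLinearGroup.map φ P, fun g => ?_⟩
  change Matrix.GeneralLinearGroup.map φ (r g) = _ * Matrix.GeneralLinearGroup.map φ (s g) * _
  rw [hP g, map_mul, map_mul, map_inv]

theorem dual (h : RepIso r s) : RepIso (dualRep r) (dualRep s) := by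
  obtain ⟨P, hP⟩ := h
  refine ⟨glInvTranspose n A P, fun g => ?_⟩
  change glInvTranspose n A (r g) = _ * glInvTranspose n A (s g) * _
  rw [hP g, map_mul, map_mul, map_inv]

theorem twist (χ : G →* Aˣ) (h : RepIso r s) : RepIso (twistRep r χ) (twistRep s χ) := by
  obtain ⟨P, hP⟩ := h
  refine ⟨P, fun g => ?_⟩
  change _ * r g = P * (_ * s g) * P⁻¹
  rw [hP g, ← mul_assoc P, ← Matrix.GeneralLinearGroup.scalar_commute]
  group

end RepIso

end Lemmas

end Representations

/-! ### The algebra `E_p = E ⊗ ℚ_p` -/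

section Local

variable (p : ℕ) [Fact p.Prime]

/-- `E_p = ℚ_p ⊗_ℚ E`. -/
abbrev Loc (E : Type u) [Field E] [CharZero E] : Type u := ℚ_[p] ⊗[ℚ] E

/-- The `p`-adic topology of `E_p`, i.e. its canonical topology as a `ℚ_p`-module. -/
instance locTopology (E : Type u) [Field E] [CharZero E] : TopologicalSpace (Loc p E) :=
  moduleTopology ℚ_[p] (Loc p E)

instance locIsModuleTopology (E : Type u) [Field E] [CharZero E] :
    IsModuleTopology ℚ_[p] (Loc p E) := ⟨rfl⟩

instance locIsTopologicalRing (E : Type u) [Field E] [NumberField E] :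
    IsTopologicalRing (Loc p E) :=
  IsModuleTopology.isTopologicalRing ℚ_[p] (Loc p E)

/-- The map `F_p → E_p` induced by a field homomorphism `F → E`. -/
def locMap {F E : Type u} [Field F] [CharZero F] [Field E] [CharZero E] (φ : F →+* E) :
    Loc p F →ₐ[ℚ_[p]] Loc p E :=
  Algebra.TensorProduct.map (AlgHom.id ℚ_[p] ℚ_[p]) φ.toRatAlgHom

/-- The map `E_p → ℚ̄_p` induced by an embedding `λ : E → ℚ̄_p`. -/
def locEmb {E : Type u} [Field E] [CharZero E] (l : E →+* PadicAlgCl p) :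
    Loc p E →ₐ[ℚ_[p]] PadicAlgCl p :=
  Algebra.TensorProduct.lift (Algebra.ofId ℚ_[p] (PadicAlgCl p)) l.toRatAlgHom
    (fun _ _ => Commute.all _ _)

/-- The Lie algebra over `ℚ_p` of a (compact, hence `p`-adic Lie) subgroup `S` of `GL_n(A)`, as a
subset of `M_n(A)`: the matrices `X` with `exp(tX) ∈ S` for all sufficiently small `t ∈ ℚ_p`. -/
def padicLie {n : ℕ} {A : Type u} [CommRing A] [TopologicalSpace A] [IsTopologicalRing A]
    [Algebra ℚ_[p] A] (S : Subgroup (GL (Fin n) A)) : Set (Matrix (Fin n) (Fin n) A) :=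
  {X | ∀ᶠ t in 𝓝 (0 : ℚ_[p]), ∃ g ∈ S,
    (g : Matrix (Fin n) (Fin n) A) = NormedSpace.exp (t • X)}

end Local

/-! ### Automorphisms of the group scheme `SL_n` and twisted forms -/

/-- An automorphism of the group scheme `SL_n` over `A`, given on points. -/
structure SLAut (n : ℕ) (A : Type u) [CommRing A] where
  app : ∀ (R : Type u) [CommRing R] [Algebra A R],
    SpecialLinearGroup (Fin n) R ≃* SpecialLinearGroup (Fin n) R
  naturality : ∀ (R S : Type u) [CommRing R] [CommRing S] [Algebra A R] [Algebra A S]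
    (φ : R →ₐ[A] S) (g : SpecialLinearGroup (Fin n) R),
    SpecialLinearGroup.map (φ : R →+* S) (app R g) =
      app S (SpecialLinearGroup.map (φ : R →+* S) g)

namespace SLAut

variable {n : ℕ} {A : Type u} [CommRing A]

/-- Conjugation of `SL_n(R)` by an element of `GL_n(R)`. -/
def conjSL {R : Type u} [CommRing R] (a : GL (Fin n) R) :
    SpecialLinearGroup (Fin n) R ≃* SpecialLinearGroup (Fin n) R where
  toFun g := ⟨(a : Matrix (Fin n) (Fin n) R) * g * (↑a⁻¹ : Matrix (Fin n) (Fin n) R), by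
    rw [Matrix.det_units_conj]; exact g.2⟩
  invFun g := ⟨(↑a⁻¹ : Matrix (Fin n) (Fin n) R) * g * (a : Matrix (Fin n) (Fin n) R), by
    rw [Matrix.det_units_conj']; exact g.2⟩
  left_inv g := by
    apply Subtype.ext
    simp [mul_assoc]
  right_inv g := by
    apply Subtype.ext
    simp [mul_assoc]
  map_mul' g h := by
    apply Subtype.ext
    change _ * (_ * _) * _ = (_ * _ * _) * (_ * _ * _)
    simp [mul_assoc]

/-- The automorphism `ad(α)` of `SL_n` over `A`, for `α ∈ GL_n(A)`. -/
def ad (a : GL (Fin n) A) : SLAut n A where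
  app R _ _ := conjSL (Matrix.GeneralLinearGroup.map (algebraMap A R) a)
  naturality R S _ _ _ _ φ g := by
    have key : Matrix.GeneralLinearGroup.map (φ : R →+* S)
        (Matrix.GeneralLinearGroup.map (algebraMap A R) a) =
        Matrix.GeneralLinearGroup.map (algebraMap A S) a := by
      rw [← φ.comp_algebraMap, Matrix.GeneralLinearGroup.map_comp]
      rfl
    rw [← key]
    apply Subtype.ext
    change (φ : R →+* S).mapMatrix (_ * _ * _) = _ * _ * _
    rw [map_mul, map_mul]
    rfl

/-- The automorphism `g ↦ g^{-T}` of `SL_n(R)`. -/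
def invTransposeSL (R : Type u) [CommRing R] :
    SpecialLinearGroup (Fin n) R ≃* SpecialLinearGroup (Fin n) R where
  toFun g := g⁻¹.transpose
  invFun g := g⁻¹.transpose
  left_inv g := by
    apply Subtype.ext
    change ((g⁻¹).1ᵀ.adjugate)ᵀ = g.1
    rw [Matrix.adjugate_transpose, Matrix.transpose_transpose]
    exact congrArg Subtype.val (inv_inv g)
  right_inv g := by
    apply Subtype.ext
    change ((g⁻¹).1ᵀ.adjugate)ᵀ = g.1
    rw [Matrix.adjugate_transpose, Matrix.transpose_transpose]
    exact congrArg Subtype.val (inv_inv g)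
  map_mul' g h := by
    apply Subtype.ext
    change ((g * h)⁻¹ : SpecialLinearGroup (Fin n) R).1ᵀ = (g⁻¹).1ᵀ * (h⁻¹).1ᵀ
    rw [_root_.mul_inv_rev, ← Matrix.transpose_mul]
    rfl

/-- The automorphism `g ↦ g^{-T}` of `SL_n` over `A`. -/
def invTranspose (n : ℕ) (A : Type u) [CommRing A] : SLAut n A where
  app R _ _ := invTransposeSL R
  naturality R S _ _ _ _ φ g := by
    change _ = ((SpecialLinearGroup.map (φ : R →+* S) g)⁻¹).transpose
    rw [← map_inv]
    rfl

/-- The composition `a ∘ b` of automorphisms of `SL_n`. -/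
def comp (a b : SLAut n A) : SLAut n A where
  app R _ _ := (b.app R).trans (a.app R)
  naturality R S _ _ _ _ φ g := by
    simp [a.naturality, b.naturality]

end SLAut

section TwistedForm

variable (p : ℕ) [Fact p.Prime] {n : ℕ} {F E : Type u} [Field F] [CharZero F] [Field E] [CharZero E]
  [Algebra F E]

/-- `E_p` as an algebra over `F_p`. -/
abbrev locAlgebra (F E : Type u) [Field F] [CharZero F] [Field E] [CharZero E] [Algebra F E] :
    Algebra (Loc p F) (Loc p E) :=
  (locMap p (algebraMap F E)).toRingHom.toAlgebra

attribute [local instance] locAlgebra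

/-- The action of `σ ∈ Gal(E/F)` on `E_p`, as an automorphism over `F_p`. -/
def locGal (σ : E ≃ₐ[F] E) : Loc p E →ₐ[Loc p F] Loc p E where
  toRingHom := (locMap p (σ : E →+* E)).toRingHom
  commutes' x := by
    induction x using TensorProduct.induction_on with
    | zero => simp
    | add x y hx hy =>
      rw [map_add]
      exact (map_add (locMap p (σ : E →+* E)) _ _).trans (congrArg₂ (· + ·) hx hy)
    | tmul a b =>
      change locMap p (σ : E →+* E) (locMap p (algebraMap F E) (a ⊗ₜ b)) =
        locMap p (algebraMap F E) (a ⊗ₜ b)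
      simp [locMap]

/-- The action of `σ ∈ Gal(E/F)` on `E_p ⊗_{F_p} R` through the first factor. -/
def resGal (σ : E ≃ₐ[F] E) (R : Type u) [CommRing R] [Algebra (Loc p F) R] :
    Loc p E ⊗[Loc p F] R →ₐ[Loc p F] Loc p E ⊗[Loc p F] R :=
  Algebra.TensorProduct.map (locGal p σ) (AlgHom.id (Loc p F) R)

/-- The `R`-points of `H = (Res^{E_p}_{F_p} SL_n)^{tw_f(Γ)}`, `Γ = Gal(E/F)`: the elements `g` of
`SL_n(E_p ⊗_{F_p} R)` with `f_σ(σ g) = g` for all `σ ∈ Γ`. -/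
def twistedForm (f : (E ≃ₐ[F] E) → SLAut n (Loc p E)) (R : Type u) [CommRing R]
    [Algebra (Loc p F) R] : Subgroup (SpecialLinearGroup (Fin n) (Loc p E ⊗[Loc p F] R)) where
  carrier := {g | ∀ σ : E ≃ₐ[F] E, (f σ).app (Loc p E ⊗[Loc p F] R)
    (SpecialLinearGroup.map (resGal p σ R : Loc p E ⊗[Loc p F] R →+* Loc p E ⊗[Loc p F] R) g) = g}
  mul_mem' {a b} ha hb σ := by rw [map_mul, map_mul, ha σ, hb σ]
  one_mem' σ := by rw [map_one, map_one]
  inv_mem' {a} ha σ := by rw [map_inv, map_inv, ha σ]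

/-- `H(F_p)` as a subgroup of `GL_n(E_p)`, through `E_p ⊗_{F_p} F_p = E_p` and
`SL_n(E_p) ⊆ GL_n(E_p)`. -/
def twistedFormPoints (f : (E ≃ₐ[F] E) → SLAut n (Loc p E)) : Subgroup (GL (Fin n) (Loc p E)) :=
  ((twistedForm p f (Loc p F)).comap (SpecialLinearGroup.map
    (Algebra.TensorProduct.includeLeftRingHom : Loc p E →+* Loc p E ⊗[Loc p F] Loc p F))).map
    SpecialLinearGroup.toGL

/-- The Lie algebra of the algebraic group `H`, as a subset of `M_n(E_p)`: the kernel of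
`H(F_p[ε]) → H(F_p)`, whose elements are written as `1 + εX`. -/
def twistedFormLie (f : (E ≃ₐ[F] E) → SLAut n (Loc p E)) :
    Set (Matrix (Fin n) (Fin n) (Loc p E)) :=
  {X | ∃ g ∈ twistedForm p f (DualNumber (Loc p F)),
    (g : Matrix (Fin n) (Fin n) (Loc p E ⊗[Loc p F] DualNumber (Loc p F))) =
      1 + X.map (fun x => x ⊗ₜ[Loc p F] (DualNumber.eps : DualNumber (Loc p F)))}

end TwistedForm

/-! ### Galois representations with coefficients in `E_p`, and their extra-twists -/

section Galois

attribute [local instance] LieRing.ofAssociativeRing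

variable (K : Type v) [Field K]

/-- The absolute Galois group of `K`, with the Krull topology. -/
abbrev AbsGal : Type v := AlgebraicClosure K ≃ₐ[K] AlgebraicClosure K

/-- The integral closure of `𝓞 K` in the algebraic closure of `K`. -/
abbrev IntBar : Type v := integralClosure (𝓞 K) (AlgebraicClosure K)

variable {K} {n : ℕ} {p : ℕ} [Fact p.Prime] {E : Type u} [Field E] [NumberField E]

/-- A representation of `G_K` is unramified at `v` if it is trivial on the inertia group of every
prime above `v`. -/
def IsUnramifiedRep {A : Type u} [CommRing A] (r : AbsGal K →* GL (Fin n) A)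
    (v : IsDedekindDomain.HeightOneSpectrum (𝓞 K)) : Prop :=
  ∀ P : Ideal (IntBar K), P.IsPrime → P.under (𝓞 K) = v.asIdeal →
    ∀ g ∈ P.inertia (AbsGal K), r g = 1

/-- `ρ_λ`, for an embedding `λ : E → ℚ̄_p`. -/
def repAt (ρ : AbsGal K →* GL (Fin n) (Loc p E)) (l : E →+* PadicAlgCl p) :
    AbsGal K →* GL (Fin n) (PadicAlgCl p) :=
  mapRep (locEmb p l : Loc p E →+* PadicAlgCl p) ρ

/-- Valid Galois representations `ρ_p : G_K → GL_n(E_p)`. -/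
structure IsValid (ρ : AbsGal K →ₜ* GL (Fin n) (Loc p E)) : Prop where
  /-- There is a finite set `S` of places containing those above `p`, such that outside `S` every
  `ρ_λ` is unramified and the characteristic polynomials of Frobenius have coefficients in `E`. -/
  exists_places : ∃ S : Finset (IsDedekindDomain.HeightOneSpectrum (𝓞 K)),
    (∀ v : IsDedekindDomain.HeightOneSpectrum (𝓞 K), (p : 𝓞 K) ∈ v.asIdeal → v ∈ S) ∧
    (∀ v ∉ S, ∀ l : E →+* PadicAlgCl p, IsUnramifiedRep (repAt ρ.toMonoidHom l) v) ∧
    (∀ v ∉ S, ∀ P : Ideal (IntBar K), P.IsPrime → P.under (𝓞 K) = v.asIdeal →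
      ∀ φ : AbsGal K, IsArithFrobAt (𝓞 K) φ P →
        ∃ h : Polynomial E, (ρ φ : Matrix (Fin n) (Fin n) (Loc p E)).charpoly =
          h.map (Algebra.TensorProduct.includeRight : E →ₐ[ℚ] Loc p E).toRingHom)
  not_selfTwist : ∀ l : E →+* PadicAlgCl p, ¬ IsSelfTwist (repAt ρ.toMonoidHom l)
  not_essentiallySelfDual : 2 < n →
    ∀ l : E →+* PadicAlgCl p, ¬ IsEssentiallySelfDual (repAt ρ.toMonoidHom l)
  det_eq_one : ∀ g, (ρ g : Matrix (Fin n) (Fin n) (Loc p E)).det = 1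
  /-- The `ℚ̄_p`-Lie algebra of `ρ_λ(G_K)` is `sl_n(ℚ̄_p)`. -/
  span_lie_eq_sl : ∀ l : E →+* PadicAlgCl p,
    Submodule.span (PadicAlgCl p) (padicLie p (repAt ρ.toMonoidHom l).range) =
      (LieAlgebra.SpecialLinear.sl (Fin n) (PadicAlgCl p)).toSubmodule

/-- The conjugate `^σρ` by `σ ∈ Aut(E)`. -/
def conjRep (σ : E ≃ₐ[ℚ] E) (ρ : AbsGal K →* GL (Fin n) (Loc p E)) :
    AbsGal K →* GL (Fin n) (Loc p E) :=
  mapRep (locMap p (σ : E →+* E) : Loc p E →+* Loc p E) ρ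

/-- `(σ, χ)` is an inner-twist of `ρ`: `^σρ ≃ ρ ⊗ χ`. -/
def IsInnerTwist (ρ : AbsGal K →* GL (Fin n) (Loc p E)) (σ : E ≃ₐ[ℚ] E)
    (χ : AbsGal K →ₜ* (Loc p E)ˣ) : Prop :=
  RepIso (conjRep σ ρ) (twistRep ρ χ.toMonoidHom)

/-- `(σ, χ)` is an outer-twist of `ρ`: `^σρ ≃ ρ^∨ ⊗ χ`. -/
def IsOuterTwist (ρ : AbsGal K →* GL (Fin n) (Loc p E)) (σ : E ≃ₐ[ℚ] E)
    (χ : AbsGal K →ₜ* (Loc p E)ˣ) : Prop :=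
  RepIso (conjRep σ ρ) (twistRep (dualRep ρ) χ.toMonoidHom)

/-- `(σ, χ)` is an extra-twist of `ρ`. -/
def IsExtraTwist (ρ : AbsGal K →* GL (Fin n) (Loc p E)) (σ : E ≃ₐ[ℚ] E)
    (χ : AbsGal K →ₜ* (Loc p E)ˣ) : Prop :=
  IsInnerTwist ρ σ χ ∨ IsOuterTwist ρ σ χ

theorem conjRep_one (ρ : AbsGal K →* GL (Fin n) (Loc p E)) : conjRep 1 ρ = ρ := by
  have h : (locMap p ((1 : E ≃ₐ[ℚ] E) : E →+* E) : Loc p E →+* Loc p E) = RingHom.id _ := by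
    have : locMap p ((1 : E ≃ₐ[ℚ] E) : E →+* E) = AlgHom.id ℚ_[p] (Loc p E) := by
      ext; simp [locMap]
    rw [this]; rfl
  rw [conjRep, h]
  rfl

theorem conjRep_mul (σ τ : E ≃ₐ[ℚ] E) (ρ : AbsGal K →* GL (Fin n) (Loc p E)) :
    conjRep (σ * τ) ρ = conjRep σ (conjRep τ ρ) := by
  have h : (locMap p ((σ * τ : E ≃ₐ[ℚ] E) : E →+* E) : Loc p E →+* Loc p E) =
      (locMap p (σ : E →+* E) : Loc p E →+* Loc p E).comp
        (locMap p (τ : E →+* E) : Loc p E →+* Loc p E) := by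
    have : locMap p ((σ * τ : E ≃ₐ[ℚ] E) : E →+* E) =
        (locMap p (σ : E →+* E)).comp (locMap p (τ : E →+* E)) := by
      ext; simp [locMap]
    rw [this]; rfl
  rw [conjRep, h]
  rfl

/-- The conjugate `^σχ` of a character by `σ ∈ Aut(E)`. -/
def conjChar (σ : E ≃ₐ[ℚ] E) (χ : AbsGal K →ₜ* (Loc p E)ˣ) : AbsGal K →ₜ* (Loc p E)ˣ where
  toMonoidHom := (Units.map ((locMap p (σ : E →+* E) : Loc p E →+* Loc p E) :
    Loc p E →* Loc p E)).comp χ.toMonoidHom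
  continuous_toFun := (Continuous.units_map _ (IsModuleTopology.continuous_of_linearMap
    (locMap p (σ : E →+* E)).toLinearMap)).comp χ.continuous_toFun

theorem conjRep_twistRep (σ : E ≃ₐ[ℚ] E) (ρ : AbsGal K →* GL (Fin n) (Loc p E))
    (χ : AbsGal K →ₜ* (Loc p E)ˣ) : conjRep σ (twistRep ρ χ.toMonoidHom) =
      twistRep (conjRep σ ρ) (conjChar σ χ).toMonoidHom :=
  mapRep_twistRep _ _ _

theorem conjRep_dualRep (σ : E ≃ₐ[ℚ] E) (ρ : AbsGal K →* GL (Fin n) (Loc p E)) :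
    conjRep σ (dualRep ρ) = dualRep (conjRep σ ρ) :=
  (dualRep_mapRep _ _).symm

/-- The group `Γ ⊆ Aut(E)` of extra-twists of `ρ`. -/
def extraTwists (ρ : AbsGal K →* GL (Fin n) (Loc p E)) : Subgroup (E ≃ₐ[ℚ] E) where
  carrier := {σ | ∃ χ, IsExtraTwist ρ σ χ}
  one_mem' := ⟨1, Or.inl (by
    have h : (1 : AbsGal K →ₜ* (Loc p E)ˣ).toMonoidHom = 1 := rfl
    rw [IsInnerTwist, conjRep_one, h, twistRep_one]
    exact RepIso.refl ρ)⟩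
  mul_mem' := by
    rintro σ τ ⟨χ, hχ⟩ ⟨η, hη⟩
    have hi (hη : IsInnerTwist ρ τ η) : RepIso (conjRep (σ * τ) ρ)
        (twistRep (conjRep σ ρ) (conjChar σ η).toMonoidHom) := by
      rw [conjRep_mul, ← conjRep_twistRep]
      exact hη.map _
    have ho (hη : IsOuterTwist ρ τ η) : RepIso (conjRep (σ * τ) ρ)
        (twistRep (dualRep (conjRep σ ρ)) (conjChar σ η).toMonoidHom) := by
      rw [conjRep_mul, ← conjRep_dualRep, ← conjRep_twistRep]
      exact hη.map _
    rcases hχ with hχ | hχ <;> rcases hη with hη | hη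
    · refine ⟨χ * conjChar σ η, Or.inl ((hi hη).trans ?_)⟩
      have := RepIso.twist (conjChar σ η).toMonoidHom hχ
      rwa [twistRep_twistRep] at this
    · refine ⟨χ⁻¹ * conjChar σ η, Or.inr ((ho hη).trans ?_)⟩
      have := RepIso.twist (conjChar σ η).toMonoidHom hχ.dual
      rwa [dualRep_twistRep, twistRep_twistRep] at this
    · refine ⟨χ * conjChar σ η, Or.inr ((hi hη).trans ?_)⟩
      have := RepIso.twist (conjChar σ η).toMonoidHom hχ
      rwa [twistRep_twistRep] at this
    · refine ⟨χ⁻¹ * conjChar σ η, Or.inl ((ho hη).trans ?_)⟩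
      have := RepIso.twist (conjChar σ η).toMonoidHom hχ.dual
      rwa [dualRep_twistRep, twistRep_twistRep, dualRep_dualRep] at this
  inv_mem' := by
    rintro σ ⟨χ, hχ⟩
    have h1 : conjRep σ⁻¹ (conjRep σ ρ) = ρ := by
      rw [← conjRep_mul, inv_mul_cancel, conjRep_one]
    have cancel (r : AbsGal K →* GL (Fin n) (Loc p E)) (θ : AbsGal K →ₜ* (Loc p E)ˣ) :
        twistRep (twistRep r θ.toMonoidHom) (θ⁻¹).toMonoidHom = r := by
      have : θ.toMonoidHom * (θ⁻¹).toMonoidHom = 1 := by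
        ext1 g; exact mul_inv_cancel (θ g)
      rw [twistRep_twistRep, this, twistRep_one]
    rcases hχ with hχ | hχ
    · refine ⟨(conjChar σ⁻¹ χ)⁻¹, Or.inl ?_⟩
      have h2 : RepIso ρ (twistRep (conjRep σ⁻¹ ρ) (conjChar σ⁻¹ χ).toMonoidHom) := by
        have := hχ.map (locMap p ((σ⁻¹ : E ≃ₐ[ℚ] E) : E →+* E) : Loc p E →+* Loc p E)
        change RepIso (conjRep σ⁻¹ _) (conjRep σ⁻¹ _) at this
        rwa [h1, conjRep_twistRep] at this
      have h3 := (h2.twist ((conjChar σ⁻¹ χ)⁻¹).toMonoidHom).symm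
      rwa [cancel] at h3
    · refine ⟨conjChar σ⁻¹ χ, Or.inr ?_⟩
      have h2 : RepIso ρ (twistRep (dualRep (conjRep σ⁻¹ ρ)) (conjChar σ⁻¹ χ).toMonoidHom) := by
        have := hχ.map (locMap p ((σ⁻¹ : E ≃ₐ[ℚ] E) : E →+* E) : Loc p E →+* Loc p E)
        change RepIso (conjRep σ⁻¹ _) (conjRep σ⁻¹ _) at this
        rwa [h1, conjRep_twistRep, conjRep_dualRep] at this
      have h3 := h2.dual
      rw [dualRep_twistRep, dualRep_dualRep] at h3
      have h4 := (h3.twist (conjChar σ⁻¹ χ).toMonoidHom).symm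
      have h5 : (conjChar σ⁻¹ χ).toMonoidHom⁻¹ * (conjChar σ⁻¹ χ).toMonoidHom = 1 := by
        ext1 g; exact inv_mul_cancel (conjChar σ⁻¹ χ g)
      rwa [twistRep_twistRep, h5, twistRep_one] at h4

/-- `F = E^Γ`. -/
abbrev twistField (ρ : AbsGal K →* GL (Fin n) (Loc p E)) : IntermediateField ℚ E :=
  IntermediateField.fixedField (extraTwists ρ)

/-- `G_L = ⋂ ker χ`, over all extra-twists `(σ, χ)` of `ρ`. -/
def twistKernel (ρ : AbsGal K →* GL (Fin n) (Loc p E)) : Subgroup (AbsGal K) :=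
  ⨅ (σ : E ≃ₐ[ℚ] E) (χ : AbsGal K →ₜ* (Loc p E)ˣ) (_ : IsExtraTwist ρ σ χ), χ.toMonoidHom.ker

/-- `f : Γ = Gal(E/F) → Aut_{E_p}(SL_n)` is the map defined by the extra-twists of `ρ`:
`f_σ = ad(α_σ)` with `ρ|_{G_L} = α_σ ^σρ|_{G_L} α_σ⁻¹` if `σ` is an inner-twist, and
`f_σ = ad(α_σ) ∘ (·)^{-T}` with `ρ|_{G_L} = α_σ ^σρ^{-T}|_{G_L} α_σ⁻¹` if `σ` is an outer-twist. -/
def IsTwistCocycle (ρ : AbsGal K →* GL (Fin n) (Loc p E))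
    (f : (E ≃ₐ[twistField ρ] E) → SLAut n (Loc p E)) : Prop :=
  ∀ σ : E ≃ₐ[twistField ρ] E,
    ((∃ χ, IsInnerTwist ρ (σ.restrictScalars ℚ) χ) ∧
      ∃ a : GL (Fin n) (Loc p E), f σ = SLAut.ad a ∧
        ∀ g ∈ twistKernel ρ, ρ g = a * conjRep (σ.restrictScalars ℚ) ρ g * a⁻¹) ∨
    ((∃ χ, IsOuterTwist ρ (σ.restrictScalars ℚ) χ) ∧
      ∃ a : GL (Fin n) (Loc p E), f σ = (SLAut.ad a).comp (SLAut.invTranspose n (Loc p E)) ∧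
        ∀ g ∈ twistKernel ρ, ρ g = a * dualRep (conjRep (σ.restrictScalars ℚ) ρ) g * a⁻¹)

end Galois

end

/-! After extension of scalars from `ℚ_p` to `ℚ̄_p`, `M_n(E_p)` becomes the product of copies of
`M_n(ℚ̄_p)` indexed by the embeddings `λ` of `E`. Let `𝔪` (`lieSpan`) be the span of the Lie algebra
of `ρ(G_L)` in this product. The group `G_L` is open, because there are finitely many extra-twists
and their characters have finite order (`IsValid.isOpen_twistKernel`). An open subgroup has the same
Lie algebra, so the hypothesis on the `ρ_λ` makes `𝔪` a Lie subalgebra of a product of copies of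
`sl_n` that surjects on each factor.

Since `sl_n` is perfect and simple, the Goursat-Ribet argument applies. Such an `𝔪` is determined by
its projections to pairs of factors (`mem_of_forall_pair`), and each of these is everything or the
graph of an automorphism of `sl_n` (`surjective_or_graph`). An automorphism is `x ↦ PxP⁻¹` or `x ↦
-PxᵀP⁻¹` (`exists_conj_or_conj_transpose`). If the pair `(λ, λ')` is a graph, then `ρ_λ` has the
same adjoint action as a conjugate of `ρ_λ'` or of its dual, so they differ by a character `χ`
(`IsValid.exists_eq_twistRep`). As `E/ℚ` is Galois, `λ = λ' ∘ σ`. Comparing traces of Frobenius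
elements shows that `χ` has values in `λ'(E)` and that the isomorphism already exists over `E_p`, so
`σ` is an extra-twist (`IsFullRep.exists_repIso_conjRep`).

An element `X` of the Lie algebra of `H` satisfies, for each extra-twist, the same linear relation
between its components as the elements of `𝔪`. Hence its components at every pair of embeddings come
from `𝔪`, so `X` lies in `𝔪`, and by linear algebra in the Lie algebra of `ρ(G_L)`
(`IsValid.mem_padicLie`). The opposite inclusion is the differential of `ρ(G_L) ⊆ H(F_p)`. For
openness, an element of `H(F_p)` close to `1` is `exp X` with `X` small in the common Lie algebra,
and small elements of that Lie algebra exponentiate into the compact group `ρ(G_L)`.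

The traces are known only at Frobenius elements, so a density statement is needed. Frobenius's
theorem is enough in place of Chebotarev's: a closed set stable under powers and containing almost
all Frobenius elements is the whole of `G_K` (`mem_of_isClosed_of_frobenius`). It follows from the
existence of inert primes in cyclic extensions, which in turn follows from the simple pole at `1` of
the Dedekind zeta functions of the intermediate fields. -/

/-! ### Euler products and prime ideals of degree one -/

section EulerProduct

open IsDedekindDomain UniqueFactorizationMonoid

variable {R : Type*} [CommRing R] [IsDedekindDomain R]

theorem injective_prod_asIdeal_pow (T : Finset (HeightOneSpectrum R)) :
    Function.Injective (fun κ : T → ℕ => ∏ i : T, i.1.asIdeal ^ κ i) := by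
  classical
  have key : ∀ κ : T → ℕ, normalizedFactors (∏ i : T, i.1.asIdeal ^ κ i) =
      ∑ i : T, κ i • {i.1.asIdeal} := by
    intro κ
    have h : ∏ i : T, i.1.asIdeal ^ κ i =
        (∑ i : T, κ i • ({i.1.asIdeal} : Multiset (Ideal R))).prod := by
      rw [Multiset.prod_sum]
      simp [Multiset.prod_nsmul]
    rw [h]
    apply normalizedFactors_prod_of_prime
    intro I hI
    rw [Multiset.mem_sum] at hI
    obtain ⟨i, -, hi⟩ := hI
    have := Multiset.mem_of_mem_nsmul hi
    rw [Multiset.mem_singleton] at this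
    rw [this]
    exact i.1.prime
  intro κ κ' h
  simp only at h
  have h2 : (∑ i : T, κ i • ({i.1.asIdeal} : Multiset (Ideal R))) =
      ∑ i : T, κ' i • ({i.1.asIdeal} : Multiset (Ideal R)) := by
    rw [← key, ← key, h]
  ext j
  have h3 := congrArg (Multiset.count j.1.asIdeal) h2
  simp only [Multiset.count_sum', Multiset.count_nsmul, Multiset.count_singleton] at h3
  have h4 : ∀ i : T, (j.1.asIdeal = i.1.asIdeal) ↔ j = i := fun i =>
    ⟨fun h => Subtype.ext (HeightOneSpectrum.ext h), fun h => by rw [h]⟩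
  simpa [h4] using h3

theorem exists_eq_prod_asIdeal_pow (T : Finset (HeightOneSpectrum R)) {I : Ideal R} (hI : I ≠ ⊥)
    (hT : ∀ v : HeightOneSpectrum R, v.maxPowDividing I ≠ 1 → v ∈ T) :
    ∃ κ : T → ℕ, I = ∏ i : T, i.1.asIdeal ^ κ i := by
  classical
  refine ⟨fun i => (Associates.mk i.1.asIdeal).count (Associates.mk I).factors, ?_⟩
  have h := Ideal.finprod_heightOneSpectrum_factorization (R := R) hI
  rw [finprod_eq_prod_of_mulSupport_subset (s := T) _ (fun v hv => by simpa using hT v hv)] at h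
  refine h.symm.trans ?_
  rw [← Finset.prod_coe_sort]
  rfl

variable (x : Ideal R →* ℝ)

/-- Expanding the product of truncated geometric series gives a sum over exponent vectors. Distinct
vectors give distinct ideals, so this is a partial sum of the right-hand side; the truncation then
tends to infinity. -/
theorem prod_one_sub_inv_le_tsum (hx0 : ∀ I, 0 ≤ x I)
    (hx1 : ∀ v : HeightOneSpectrum R, x v.asIdeal < 1)
    (hs : Summable fun I : {I : Ideal R // I ≠ ⊥} => x I) (T : Finset (HeightOneSpectrum R)) :
    ∏ v ∈ T, (1 - x v.asIdeal)⁻¹ ≤ ∑' I : {I : Ideal R // I ≠ ⊥}, x I := by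
  classical
  have h1 : ∀ r : ℕ, ∏ v ∈ T, ∑ k ∈ Finset.range r, x v.asIdeal ^ k ≤
      ∑' I : {I : Ideal R // I ≠ ⊥}, x I := by
    intro r
    rw [← Finset.prod_coe_sort, Finset.prod_univ_sum]
    let e : (T → ℕ) → {I : Ideal R // I ≠ ⊥} := fun κ =>
      ⟨∏ i : T, i.1.asIdeal ^ κ i, Finset.prod_ne_zero_iff.2 fun i _ => pow_ne_zero _ i.1.ne_bot⟩
    have he : Function.Injective e := fun κ κ' h =>
      injective_prod_asIdeal_pow T (congrArg Subtype.val h)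
    calc _ = ∑ κ ∈ Fintype.piFinset fun _ : T => Finset.range r, x (e κ) := by
          refine Finset.sum_congr rfl fun κ _ => ?_
          simp [e, map_prod]
      _ = ∑ I ∈ (Fintype.piFinset fun _ : T => Finset.range r).image e, x I := by
          rw [Finset.sum_image he.injOn]
      _ ≤ _ := hs.sum_le_tsum _ fun I _ => hx0 I
  refine le_of_tendsto' (x := Filter.atTop) ?_ h1
  refine tendsto_finsetProd _ fun v _ => ?_
  exact (hasSum_geometric_of_lt_one (hx0 _) (hx1 v)).tendsto_sum_nat

theorem exists_sum_le_prod_one_sub_inv (hx0 : ∀ I, 0 ≤ x I)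
    (hx1 : ∀ v : HeightOneSpectrum R, x v.asIdeal < 1)
    (F : Finset {I : Ideal R // I ≠ ⊥}) :
    ∃ T : Finset (HeightOneSpectrum R), ∑ I ∈ F, x I ≤ ∏ v ∈ T, (1 - x v.asIdeal)⁻¹ := by
  classical
  let T : Finset (HeightOneSpectrum R) := F.biUnion fun I =>
    (Ideal.hasFiniteMulSupport (R := R) I.2).toFinset
  refine ⟨T, ?_⟩
  have h1 : ∀ I : {I : Ideal R // I ≠ ⊥}, ∃ κ : T → ℕ, I ∈ F → I.1 = ∏ i : T, i.1.asIdeal ^ κ i := by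
    intro I
    by_cases hI : I ∈ F
    · obtain ⟨κ, hκ⟩ := exists_eq_prod_asIdeal_pow T I.2 fun v hv =>
        Finset.mem_biUnion.2 ⟨I, hI, (Set.Finite.mem_toFinset _).2 hv⟩
      exact ⟨κ, fun _ => hκ⟩
    · exact ⟨0, fun h => absurd h hI⟩
  choose κ hκ using h1
  -- A bound exceeding every exponent that occurs, so that each ideal of `F` appears when the
  -- product of the series truncated at `r` is expanded.
  let r : ℕ := F.sup (fun I => Finset.univ.sup (κ I)) + 1
  have hr : ∀ I ∈ F, ∀ i, κ I i < r := fun I hI i =>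
    Nat.lt_succ_of_le ((Finset.le_sup (f := κ I) (Finset.mem_univ i)).trans
      (Finset.le_sup (f := fun I => Finset.univ.sup (κ I)) hI))
  have hinj : Set.InjOn κ F := fun I hI J hJ h => Subtype.ext (by rw [hκ I hI, hκ J hJ, h])
  calc ∑ I ∈ F, x I = ∑ I ∈ F, ∏ i : T, x i.1.asIdeal ^ κ I i := by
        refine Finset.sum_congr rfl fun I hI => ?_
        conv_lhs => rw [hκ I hI]
        simp [map_prod]
    _ = ∑ c ∈ F.image κ, ∏ i : T, x i.1.asIdeal ^ c i := by
        rw [Finset.sum_image hinj]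
    _ ≤ ∑ c ∈ Fintype.piFinset fun _ : T => Finset.range r, ∏ i : T, x i.1.asIdeal ^ c i := by
        refine Finset.sum_le_sum_of_subset_of_nonneg ?_ fun c _ _ =>
          Finset.prod_nonneg fun i _ => pow_nonneg (hx0 _) _
        intro c hc
        obtain ⟨I, hI, rfl⟩ := Finset.mem_image.1 hc
        exact Fintype.mem_piFinset.2 fun i => Finset.mem_range.2 (hr I hI i)
    _ = ∏ i : T, ∑ k ∈ Finset.range r, x i.1.asIdeal ^ k := by rw [Finset.prod_univ_sum]
    _ = ∏ v ∈ T, ∑ k ∈ Finset.range r, x v.asIdeal ^ k :=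
        Finset.prod_coe_sort T fun v => ∑ k ∈ Finset.range r, x v.asIdeal ^ k
    _ ≤ _ := by
        refine Finset.prod_le_prod (fun v _ => Finset.sum_nonneg fun k _ => pow_nonneg (hx0 _) _)
          fun v _ => ?_
        have := hasSum_geometric_of_lt_one (hx0 _) (hx1 v)
        exact sum_le_hasSum _ (fun k _ => pow_nonneg (hx0 _) _) this

omit [IsDedekindDomain R] in
theorem summable_asIdeal (hs : Summable fun I : {I : Ideal R // I ≠ ⊥} => x I) :
    Summable fun v : HeightOneSpectrum R => x v.asIdeal :=
  hs.comp_injective (i := fun v : HeightOneSpectrum R => (⟨v.asIdeal, v.ne_bot⟩ :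
    {I : Ideal R // I ≠ ⊥})) fun _ _ h => HeightOneSpectrum.ext (Subtype.mk.inj h)

theorem one_le_tsum_ideal (hx0 : ∀ I, 0 ≤ x I)
    (hs : Summable fun I : {I : Ideal R // I ≠ ⊥} => x I) :
    1 ≤ ∑' I : {I : Ideal R // I ≠ ⊥}, x I := by
  have := hs.le_tsum ⟨1, one_ne_zero⟩ fun I _ => hx0 I
  rwa [map_one] at this

theorem tsum_asIdeal_le_log (hx0 : ∀ I, 0 ≤ x I)
    (hx1 : ∀ v : HeightOneSpectrum R, x v.asIdeal < 1)
    (hs : Summable fun I : {I : Ideal R // I ≠ ⊥} => x I) :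
    ∑' v : HeightOneSpectrum R, x v.asIdeal ≤ Real.log (∑' I : {I : Ideal R // I ≠ ⊥}, x I) := by
  refine Real.tsum_le_of_sum_le (fun v => hx0 _) fun T => ?_
  have h1 : ∀ v : HeightOneSpectrum R, 0 < (1 - x v.asIdeal)⁻¹ := fun v =>
    inv_pos.2 (by linarith [hx1 v])
  calc ∑ v ∈ T, x v.asIdeal ≤ ∑ v ∈ T, Real.log (1 - x v.asIdeal)⁻¹ := by
        refine Finset.sum_le_sum fun v _ => ?_
        rw [Real.log_inv]
        linarith [Real.log_le_sub_one_of_pos (x := 1 - x v.asIdeal) (by linarith [hx1 v])]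
    _ = Real.log (∏ v ∈ T, (1 - x v.asIdeal)⁻¹) := by
        rw [Real.log_prod fun v _ => (h1 v).ne']
    _ ≤ _ := Real.log_le_log (Finset.prod_pos fun v _ => h1 v)
        (prod_one_sub_inv_le_tsum x hx0 hx1 hs T)

/-- This rests on `-log(1 - x) ≤ x/(1 - x) ≤ x + 2x²`, whose second inequality amounts to `x²(1 -
2x) ≥ 0` and so needs `x ≤ 1/2`. -/
theorem log_le_tsum_asIdeal (hx0 : ∀ I, 0 ≤ x I)
    (hx1 : ∀ v : HeightOneSpectrum R, x v.asIdeal ≤ 1 / 2)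
    (hs : Summable fun I : {I : Ideal R // I ≠ ⊥} => x I) :
    Real.log (∑' I : {I : Ideal R // I ≠ ⊥}, x I) ≤
      ∑' v : HeightOneSpectrum R, x v.asIdeal + 2 * ∑' v : HeightOneSpectrum R, x v.asIdeal ^ 2 := by
  have hs1 := summable_asIdeal x hs
  have hs2 : Summable fun v : HeightOneSpectrum R => x v.asIdeal ^ 2 := by
    refine Summable.of_nonneg_of_le (fun v => sq_nonneg _) (fun v => ?_) hs1
    nlinarith [hx0 v.asIdeal, hx1 v]
  have h1 : ∀ v : HeightOneSpectrum R, 0 < (1 - x v.asIdeal)⁻¹ := fun v =>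
    inv_pos.2 (by linarith [hx1 v])
  have hZ := one_le_tsum_ideal x hx0 hs
  rw [Real.log_le_iff_le_exp (by linarith)]
  refine Real.tsum_le_of_sum_le (fun v => hx0 _) fun F => ?_
  obtain ⟨T, hT⟩ := exists_sum_le_prod_one_sub_inv x hx0 (fun v => by linarith [hx1 v]) F
  refine hT.trans ?_
  rw [← Real.log_le_iff_le_exp (Finset.prod_pos fun v _ => h1 v),
    Real.log_prod fun v _ => (h1 v).ne']
  calc ∑ v ∈ T, Real.log (1 - x v.asIdeal)⁻¹ ≤ ∑ v ∈ T, (x v.asIdeal + 2 * x v.asIdeal ^ 2) := by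
        refine Finset.sum_le_sum fun v _ => ?_
        have h2 := Real.log_le_sub_one_of_pos (h1 v)
        refine h2.trans ?_
        have h3 : 0 < 1 - x v.asIdeal := by linarith [hx1 v]
        rw [sub_le_iff_le_add, inv_le_iff_one_le_mul₀ h3]
        nlinarith [mul_nonneg (sq_nonneg (x v.asIdeal)) (by linarith [hx1 v] :
          (0:ℝ) ≤ 1 - 2 * x v.asIdeal)]
    _ = ∑ v ∈ T, x v.asIdeal + 2 * ∑ v ∈ T, x v.asIdeal ^ 2 := by
        rw [Finset.sum_add_distrib, Finset.mul_sum]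
    _ ≤ _ := by
        gcongr
        · exact hs1.sum_le_tsum _ fun v _ => hx0 _
        · exact hs2.sum_le_tsum _ fun v _ => sq_nonneg _

end EulerProduct

/-! ### Primes of degree one and the pole of the Dedekind zeta function -/

section DegreeOne

open IsDedekindDomain Filter

variable (N : Type*) [Field N] [NumberField N]

/-- The completely multiplicative function `I ↦ N(I)^{-s}`. -/
noncomputable def idealNormPow (s : ℝ) : Ideal (𝓞 N) →* ℝ where
  toFun I := (Ideal.absNorm I : ℝ) ^ (-s)
  map_one' := by simp
  map_mul' I J := by
    rw [map_mul, Nat.cast_mul, Real.mul_rpow (Nat.cast_nonneg _) (Nat.cast_nonneg _)]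

theorem idealNormPow_apply (s : ℝ) (I : Ideal (𝓞 N)) :
    idealNormPow N s I = (Ideal.absNorm I : ℝ) ^ (-s) := rfl

theorem idealNormPow_nonneg (s : ℝ) (I : Ideal (𝓞 N)) : 0 ≤ idealNormPow N s I :=
  Real.rpow_nonneg (Nat.cast_nonneg _) _

variable {N} in
theorem two_le_absNorm_asIdeal (P : HeightOneSpectrum (𝓞 N)) : 2 ≤ Ideal.absNorm P.asIdeal := by
  have h0 : Ideal.absNorm P.asIdeal ≠ 0 := by
    rw [Ne, Ideal.absNorm_eq_zero_iff]; exact P.ne_bot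
  have h1 : Ideal.absNorm P.asIdeal ≠ 1 := by
    rw [Ne, Ideal.absNorm_eq_one_iff]; exact P.isPrime.ne_top
  omega

theorem idealNormPow_asIdeal_le {s : ℝ} (hs : 1 ≤ s) (P : HeightOneSpectrum (𝓞 N)) :
    idealNormPow N s P.asIdeal ≤ 1 / 2 := by
  have h2 : (2 : ℝ) ≤ Ideal.absNorm P.asIdeal := by exact_mod_cast two_le_absNorm_asIdeal P
  rw [idealNormPow_apply]
  calc (Ideal.absNorm P.asIdeal : ℝ) ^ (-s) ≤ (Ideal.absNorm P.asIdeal : ℝ) ^ (-1 : ℝ) :=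
        Real.rpow_le_rpow_of_exponent_le (by linarith) (by linarith)
    _ ≤ 1 / 2 := by
        rw [Real.rpow_neg_one, one_div]
        exact inv_anti₀ (by norm_num) h2

theorem idealNormPow_anti {s t : ℝ} (hst : s ≤ t) {I : Ideal (𝓞 N)} (hI : I ≠ ⊥) :
    idealNormPow N t I ≤ idealNormPow N s I := by
  have h0 : Ideal.absNorm I ≠ 0 := by rwa [Ne, Ideal.absNorm_eq_zero_iff]
  have h2 : (1 : ℝ) ≤ Ideal.absNorm I := by exact_mod_cast Nat.one_le_iff_ne_zero.2 h0
  exact Real.rpow_le_rpow_of_exponent_le h2 (by linarith)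

/-- The ideals are grouped by norm. The fibres are finite and all terms are nonnegative, so the
double sum may be reordered. -/
theorem hasSum_idealNormPow {s : ℝ}
    (hs : LSeriesSummable (fun n ↦ Nat.card {I : Ideal (𝓞 N) // Ideal.absNorm I = n}) (s : ℂ)) :
    HasSum (fun I : {I : Ideal (𝓞 N) // I ≠ ⊥} => idealNormPow N s I)
      (NumberField.dedekindZeta N s).re := by
  have hterm : ∀ n : ℕ, LSeries.term
      (fun n ↦ (Nat.card {I : Ideal (𝓞 N) // Ideal.absNorm I = n} : ℂ)) (s : ℂ) n =
      ((if n = 0 then 0 else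
        Nat.card {I : Ideal (𝓞 N) // Ideal.absNorm I = n} * (n : ℝ) ^ (-s) : ℝ) : ℂ) := by
    intro n
    rw [LSeries.term_def]
    split_ifs with h
    · simp
    · push_cast
      rw [div_eq_mul_inv, Complex.ofReal_cpow (Nat.cast_nonneg n), Complex.ofReal_neg,
        Complex.cpow_neg]
      simp
  have hsum : HasSum (fun n : ℕ => (if n = 0 then 0 else
        Nat.card {I : Ideal (𝓞 N) // Ideal.absNorm I = n} * (n : ℝ) ^ (-s) : ℝ))
      (NumberField.dedekindZeta N s).re := by
    have h := hs.hasSum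
    have h' := Complex.reCLM.hasSum h
    refine (h'.congr_fun ?_ : _)
    intro n
    simp [hterm]
  let e := Equiv.sigmaFiberEquiv fun I : {I : Ideal (𝓞 N) // I ≠ ⊥} => Ideal.absNorm I.1
  rw [← e.hasSum_iff]
  have hfin : ∀ n : ℕ, Finite {I : {I : Ideal (𝓞 N) // I ≠ ⊥} // Ideal.absNorm I.1 = n} := by
    intro n
    have := (Ideal.finite_setOfPred_absNorm_eq (S := 𝓞 N) n).to_subtype
    refine Finite.of_injective (fun I => (⟨I.1.1, I.2⟩ : {I : Ideal (𝓞 N) | Ideal.absNorm I = n}))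
      fun I J h => Subtype.ext (Subtype.ext (Subtype.mk.inj h))
  have hfib : ∀ n : ℕ, HasSum
      (fun I : {I : {I : Ideal (𝓞 N) // I ≠ ⊥} // Ideal.absNorm I.1 = n} =>
        idealNormPow N s I.1.1)
      (if n = 0 then 0 else
        Nat.card {I : Ideal (𝓞 N) // Ideal.absNorm I = n} * (n : ℝ) ^ (-s) : ℝ) := by
    intro n
    have := Fintype.ofFinite {I : {I : Ideal (𝓞 N) // I ≠ ⊥} // Ideal.absNorm I.1 = n}
    convert hasSum_fintype _ using 1
    have h1 : ∀ I : {I : {I : Ideal (𝓞 N) // I ≠ ⊥} // Ideal.absNorm I.1 = n},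
        idealNormPow N s I.1.1 = (n : ℝ) ^ (-s) := fun I => by
      rw [idealNormPow_apply, I.2]
    rw [Finset.sum_congr rfl fun I _ => h1 I, Finset.sum_const, Finset.card_univ, nsmul_eq_mul]
    split_ifs with h
    · subst h
      have : IsEmpty {I : {I : Ideal (𝓞 N) // I ≠ ⊥} // Ideal.absNorm I.1 = 0} :=
        ⟨fun I => I.1.2 (Ideal.absNorm_eq_zero_iff.1 I.2)⟩
      simp
    · rw [← Nat.card_eq_fintype_card]
      congr 2
      refine Nat.card_congr
        { toFun := fun I => ⟨⟨I.1, fun h0 => h (by rw [← I.2, h0, Ideal.absNorm_bot])⟩, I.2⟩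
          invFun := fun I => ⟨I.1.1, I.2⟩
          left_inv := fun I => rfl
          right_inv := fun I => rfl }
  have hsig : Summable ((fun I : {I : Ideal (𝓞 N) // I ≠ ⊥} => idealNormPow N s I) ∘ e) := by
    refine (summable_sigma_of_nonneg
      (f := (fun I : {I : Ideal (𝓞 N) // I ≠ ⊥} => idealNormPow N s I) ∘ e)
      fun I => idealNormPow_nonneg N s _).2 ?_
    refine ⟨fun n => (hfib n).summable, ?_⟩
    refine hsum.summable.congr fun n => ?_
    exact (hfib n).tsum_eq.symm
  have := hsig.hasSum.sigma hfib
  rw [← this.unique hsum]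
  exact hsig.hasSum

theorem eventually_hasSum_idealNormPow : ∀ᶠ s in 𝓝[>] (1 : ℝ),
    HasSum (fun I : {I : Ideal (𝓞 N) // I ≠ ⊥} => idealNormPow N s I)
      (NumberField.dedekindZeta N s).re := by
  have h := NumberField.tendsto_sub_one_mul_dedekindZeta_nhdsGT N
  have h2 := h.eventually_ne (b₂ := 0)
    (by exact_mod_cast NumberField.dedekindZeta_residue_ne_zero N)
  filter_upwards [h2] with s hs
  apply hasSum_idealNormPow
  by_contra hns
  apply hs
  -- A divergent series has the default sum `0`, which is incompatible with `(s - 1)ζ(s)` being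
  -- close to the nonzero residue. The residue formula thus yields convergence near `1`.
  have : NumberField.dedekindZeta N s = 0 := tsum_eq_zero_of_not_summable hns
  rw [this, mul_zero]

theorem exists_summable_idealNormPow : ∃ s : ℝ, 1 < s ∧ s < 2 ∧
    Summable (fun I : {I : Ideal (𝓞 N) // I ≠ ⊥} => idealNormPow N s I) := by
  have h1 : ∀ᶠ s in 𝓝[>] (1 : ℝ), s ∈ Set.Ioo (1 : ℝ) 2 := Ioo_mem_nhdsGT (by norm_num)
  obtain ⟨s, hs, hs'⟩ := ((eventually_hasSum_idealNormPow N).and h1).exists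
  exact ⟨s, hs'.1, hs'.2, hs.summable⟩

theorem exists_log_tsum_idealNormPow_bound : ∃ C : ℝ, ∀ᶠ s in 𝓝[>] (1 : ℝ),
    |Real.log (∑' I : {I : Ideal (𝓞 N) // I ≠ ⊥}, idealNormPow N s I) - Real.log (1 / (s - 1))| ≤
      C := by
  have h := (Complex.continuous_re.tendsto _).comp
    (NumberField.tendsto_sub_one_mul_dedekindZeta_nhdsGT N)
  simp only [Complex.ofReal_re] at h
  have hpos := NumberField.dedekindZeta_residue_pos N
  have h2 := ((Real.continuousAt_log hpos.ne').tendsto.comp h)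
  refine ⟨|Real.log (NumberField.dedekindZeta_residue N)| + 1, ?_⟩
  filter_upwards [eventually_hasSum_idealNormPow N,
    h2.abs.eventually_lt_const (lt_add_one _), self_mem_nhdsWithin] with s hs hs2 hs3
  rw [hs.tsum_eq]
  have hs4 : 0 < s - 1 := sub_pos.2 hs3
  have h1 := one_le_tsum_ideal _ (idealNormPow_nonneg N s) hs.summable
  rw [hs.tsum_eq] at h1
  rw [one_div, Real.log_inv, sub_neg_eq_add, add_comm,
    ← Real.log_mul hs4.ne' (by linarith)]
  refine le_of_eq_of_le ?_ hs2.le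
  simp only [Function.comp_apply]
  congr 2
  rw [← Complex.ofReal_one, ← Complex.ofReal_sub, Complex.re_ofReal_mul]

/-- The norm of a prime is a power of its residue characteristic, so `minFac` reads off that
characteristic, and at most `[N : ℚ]` primes lie over a given rational prime. -/
theorem card_filter_minFac_le (F : Finset (HeightOneSpectrum (𝓞 N))) (p : ℕ) :
    (F.filter fun P => (Ideal.absNorm P.asIdeal).minFac = p).card ≤ Module.finrank ℚ N := by
  classical
  rcases (F.filter fun P => (Ideal.absNorm P.asIdeal).minFac = p).eq_empty_or_nonempty with h | h
  · rw [h]; simp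
  obtain ⟨P, hP⟩ := h
  have hp : p.Prime := by
    rw [← (Finset.mem_filter.1 hP).2]
    exact Nat.minFac_prime (by have := two_le_absNorm_asIdeal P; omega)
  have hprime : ∀ P : HeightOneSpectrum (𝓞 N), (Ideal.absNorm P.asIdeal).minFac = p →
      (p : 𝓞 N) ∈ P.asIdeal := by
    intro P hP
    obtain ⟨q, k, hk, -, hq, hqk⟩ := Ideal.exists_prime_and_absNorm_eq_pow P.asIdeal
    have : p = q := by rw [← hP, hqk, hq.pow_minFac hk.ne']
    have h2 := Ideal.absNorm_mem P.asIdeal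
    rw [hqk, ← this] at h2
    push_cast at h2
    exact P.isPrime.mem_of_pow_mem _ h2
  have : Fact p.Prime := ⟨hp⟩
  have hmax : (Ideal.span {(p : ℤ)}).IsMaximal := Int.ideal_span_isMaximal_of_prime p
  have h0 : (Ideal.span {(p : ℤ)}) ≠ ⊥ := by
    rw [Ne, Ideal.span_singleton_eq_bot]; exact_mod_cast hp.ne_zero
  have hlies : ∀ P : HeightOneSpectrum (𝓞 N), (Ideal.absNorm P.asIdeal).minFac = p →
      P.asIdeal ∈ (Ideal.span {(p : ℤ)}).primesOver (𝓞 N) := by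
    intro P hP
    refine ⟨P.isPrime, ⟨hmax.eq_of_le ?_ ?_⟩⟩
    · exact (P.isPrime.comap (algebraMap ℤ (𝓞 N))).ne_top
    · rw [Ideal.span_singleton_le_iff_mem, Ideal.mem_comap]
      simpa using hprime P hP
  have : Fintype ((Ideal.span {(p : ℤ)}).primesOver (𝓞 N)) :=
    (Algebra.QuasiFinite.finite_primesOver _).fintype
  have hsum := Ideal.sum_ramification_inertia_eq_finrank (Ideal.span {(p : ℤ)}) (𝓞 N)
  rw [← NumberField.RingOfIntegers.rank N, ← hsum]
  calc _ ≤ Fintype.card ((Ideal.span {(p : ℤ)}).primesOver (𝓞 N)) := by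
        rw [← Fintype.card_coe]
        refine Fintype.card_le_of_injective
          (fun P => ⟨P.1.asIdeal, hlies P.1 (Finset.mem_filter.1 P.2).2⟩) fun P Q h => ?_
        exact Subtype.ext (HeightOneSpectrum.ext (Subtype.mk.inj h))
    _ = ∑ q : (Ideal.span {(p : ℤ)}).primesOver (𝓞 N), 1 := by simp
    _ ≤ _ := Finset.sum_le_sum fun q _ => by
        have := q.2.1
        exact Nat.succ_le_of_lt (Nat.mul_pos (Ideal.ramificationIdx_pos _ _)
          (Ideal.inertiaDeg_pos _ _))

/-- This series dominates the contribution of the primes of residue degree at least two, whose norm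
is at least the square of the residue characteristic. -/
theorem summable_inv_sq_minFac_absNorm :
    Summable fun P : HeightOneSpectrum (𝓞 N) => (((Ideal.absNorm P.asIdeal).minFac : ℝ) ^ 2)⁻¹ := by
  classical
  have hs : Summable fun n : ℕ => ((n : ℝ) ^ 2)⁻¹ := Real.summable_nat_pow_inv.2 one_lt_two
  refine summable_of_sum_le (c := Module.finrank ℚ N * ∑' n : ℕ, ((n : ℝ) ^ 2)⁻¹)
    (fun P => by positivity) fun F => ?_
  rw [Finset.sum_comp (fun n : ℕ => ((n : ℝ) ^ 2)⁻¹)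
    fun P : HeightOneSpectrum (𝓞 N) => (Ideal.absNorm P.asIdeal).minFac]
  calc _ ≤ ∑ p ∈ F.image (fun P => (Ideal.absNorm P.asIdeal).minFac),
        (Module.finrank ℚ N : ℝ) * ((p : ℝ) ^ 2)⁻¹ := by
        refine Finset.sum_le_sum fun p _ => ?_
        rw [nsmul_eq_mul]
        gcongr
        exact_mod_cast card_filter_minFac_le N F p
    _ = Module.finrank ℚ N * ∑ p ∈ F.image (fun P => (Ideal.absNorm P.asIdeal).minFac),
        ((p : ℝ) ^ 2)⁻¹ := by rw [Finset.mul_sum]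
    _ ≤ _ := by
        gcongr
        exact hs.sum_le_tsum _ fun n _ => by positivity

/-- The sum of `N(P)^{-s}` over the primes of absolute degree one. -/
noncomputable def degreeOneSum (s : ℝ) : ℝ :=
  ∑' P : HeightOneSpectrum (𝓞 N),
    if (Ideal.absNorm P.asIdeal).Prime then idealNormPow N s P.asIdeal else 0

/-- By the Euler product, `log ζ(s)` is `∑ N(P)^{-s}` up to a multiple of `∑ N(P)^{-2s}`. The latter
sum and the part from primes of degree at least two are bounded by convergent series that do not
depend on `s`. -/
theorem exists_degreeOneSum_bound : ∃ C : ℝ, ∀ᶠ s in 𝓝[>] (1 : ℝ),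
    (Summable fun P : HeightOneSpectrum (𝓞 N) => idealNormPow N s P.asIdeal) ∧
      |degreeOneSum N s - Real.log (1 / (s - 1))| ≤ C := by
  obtain ⟨C, hC⟩ := exists_log_tsum_idealNormPow_bound N
  obtain ⟨t, ht1, ht2, ht⟩ := exists_summable_idealNormPow N
  have hsm := summable_inv_sq_minFac_absNorm N
  have hts := summable_asIdeal _ ht
  refine ⟨C + 2 * ∑' P : HeightOneSpectrum (𝓞 N), idealNormPow N t P.asIdeal +
    ∑' P : HeightOneSpectrum (𝓞 N), (((Ideal.absNorm P.asIdeal).minFac : ℝ) ^ 2)⁻¹, ?_⟩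
  filter_upwards [hC, eventually_hasSum_idealNormPow N, self_mem_nhdsWithin] with s hs1 hs2 hs3
  have hs3 : 1 < s := hs3
  have hsum := summable_asIdeal _ hs2.summable
  refine ⟨hsum, ?_⟩
  have hup := log_le_tsum_asIdeal _ (idealNormPow_nonneg N s)
    (idealNormPow_asIdeal_le N hs3.le) hs2.summable
  have hlo := tsum_asIdeal_le_log _ (idealNormPow_nonneg N s)
    (fun P => (idealNormPow_asIdeal_le N hs3.le P).trans_lt (by norm_num)) hs2.summable
  have hsq : ∀ P : HeightOneSpectrum (𝓞 N),
      idealNormPow N s P.asIdeal ^ 2 ≤ idealNormPow N t P.asIdeal := by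
    intro P
    -- Here `t < 2 < 2s`; this is why an exponent of convergence below `2` was chosen.
    refine le_trans (le_of_eq ?_) (idealNormPow_anti N (t := s * 2) (by linarith) P.ne_bot)
    rw [idealNormPow_apply, idealNormPow_apply, ← Real.rpow_natCast, ← Real.rpow_mul
      (Nat.cast_nonneg _)]
    congr 1
    push_cast
    ring
  have hsq' : ∑' P : HeightOneSpectrum (𝓞 N), idealNormPow N s P.asIdeal ^ 2 ≤
      ∑' P : HeightOneSpectrum (𝓞 N), idealNormPow N t P.asIdeal :=
    Summable.tsum_le_tsum hsq (Summable.of_nonneg_of_le (fun _ => sq_nonneg _) hsq hts) hts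
  have hdeg : ∀ P : HeightOneSpectrum (𝓞 N), idealNormPow N s P.asIdeal ≤
      (if (Ideal.absNorm P.asIdeal).Prime then idealNormPow N s P.asIdeal else 0) +
      (((Ideal.absNorm P.asIdeal).minFac : ℝ) ^ 2)⁻¹ := by
    intro P
    split_ifs with h
    · have : (0 : ℝ) ≤ (((Ideal.absNorm P.asIdeal).minFac : ℝ) ^ 2)⁻¹ := by positivity
      linarith
    · obtain ⟨q, k, hk, -, hq, hqk⟩ := Ideal.exists_prime_and_absNorm_eq_pow P.asIdeal
      have hk2 : 2 ≤ k := by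
        by_contra hk2
        have : k = 1 := by omega
        rw [this, pow_one] at hqk
        exact h (hqk ▸ hq)
      have hq1 : (1 : ℝ) ≤ q := by exact_mod_cast hq.one_le
      have hle : (q : ℝ) ^ 2 ≤ (q : ℝ) ^ k := pow_le_pow_right₀ hq1 hk2
      rw [zero_add]
      refine (idealNormPow_anti N hs3.le P.ne_bot).trans ?_
      rw [idealNormPow_apply, hqk, hq.pow_minFac hk.ne', Real.rpow_neg_one]
      push_cast
      exact inv_anti₀ (by positivity) hle
  have hif : ∀ P : HeightOneSpectrum (𝓞 N),
      (if (Ideal.absNorm P.asIdeal).Prime then idealNormPow N s P.asIdeal else 0) ≤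
        idealNormPow N s P.asIdeal := fun P => by
    split_ifs
    · exact le_rfl
    · exact idealNormPow_nonneg N s _
  have hif0 : ∀ P : HeightOneSpectrum (𝓞 N), (0 : ℝ) ≤
      (if (Ideal.absNorm P.asIdeal).Prime then idealNormPow N s P.asIdeal else 0) := fun P => by
    split_ifs
    · exact idealNormPow_nonneg N s _
    · exact le_rfl
  have hifs := Summable.of_nonneg_of_le hif0 hif hsum
  have hA : degreeOneSum N s ≤ ∑' P : HeightOneSpectrum (𝓞 N), idealNormPow N s P.asIdeal :=
    Summable.tsum_le_tsum hif hifs hsum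
  have hB : ∑' P : HeightOneSpectrum (𝓞 N), idealNormPow N s P.asIdeal ≤ degreeOneSum N s +
      ∑' P : HeightOneSpectrum (𝓞 N), (((Ideal.absNorm P.asIdeal).minFac : ℝ) ^ 2)⁻¹ := by
    rw [degreeOneSum, ← Summable.tsum_add hifs hsm]
    exact Summable.tsum_le_tsum hdeg hsum (hifs.add hsm)
  have hn1 : 0 ≤ ∑' P : HeightOneSpectrum (𝓞 N), idealNormPow N t P.asIdeal :=
    tsum_nonneg fun P => idealNormPow_nonneg N t _
  have hn2 : 0 ≤ ∑' P : HeightOneSpectrum (𝓞 N),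
      (((Ideal.absNorm P.asIdeal).minFac : ℝ) ^ 2)⁻¹ := tsum_nonneg fun P => by positivity
  rw [abs_le] at hs1 ⊢
  constructor <;> linarith

end DegreeOne

/-! ### Decomposition groups, inertia degrees and numbers of primes -/

section LocalCount

open IsDedekindDomain Filter MulAction
open scoped Pointwise

set_option linter.unusedSectionVars false

variable {N M : Type*} [Field N] [NumberField N] [Field M] [NumberField M] [Algebra N M]
  [IsGalois N M]

/-- Each `σ ≠ 1` moves some integer `x`, and `σ` can lie in the inertia group at `w` only if `w`
divides the nonzero element `σx - x`. -/
theorem finite_inertia_ne_bot :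
    {w : HeightOneSpectrum (𝓞 M) | w.asIdeal.inertia Gal(M/N) ≠ ⊥}.Finite := by
  have h1 : ∀ σ : Gal(M/N), σ ≠ 1 → ∃ x : 𝓞 M, σ • x - x ≠ 0 := by
    intro σ hσ
    by_contra! h
    apply hσ
    have := IsGaloisGroup.faithful (G := Gal(M/N)) (A := 𝓞 N) (B := 𝓞 M)
    refine FaithfulSMul.eq_of_smul_eq_smul (α := 𝓞 M) fun x => ?_
    rw [one_smul, ← sub_eq_zero, h x]
  have h2 : ∀ x : 𝓞 M, x ≠ 0 → {w : HeightOneSpectrum (𝓞 M) | x ∈ w.asIdeal}.Finite := by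
    intro x hx
    refine (Ideal.finite_factors (R := 𝓞 M) (I := Ideal.span {x}) (by simpa using hx)).subset ?_
    intro w hw
    exact (Ideal.dvd_span_singleton).2 hw
  choose! x hx using h1
  refine (Set.Finite.biUnion (Set.toFinite {σ : Gal(M/N) | σ ≠ 1})
    fun σ hσ => h2 (σ • x σ - x σ) (hx σ hσ)).subset ?_
  intro w hw
  obtain ⟨σ, hσ1⟩ := Subgroup.ne_bot_iff_exists_ne_one.1 hw
  have hσ := σ.2
  refine Set.mem_biUnion (x := σ.1) ?_ ?_
  · exact fun h => hσ1 (Subtype.ext h)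
  · exact hσ (x σ.1)

theorem finite_quotient_asIdeal (u : HeightOneSpectrum (𝓞 N)) : Finite (𝓞 N ⧸ u.asIdeal) := by
  rw [← Ideal.absNorm_ne_zero_iff, Ne, Ideal.absNorm_eq_zero_iff]
  exact u.ne_bot

/-- The decomposition group has order `ef`, with `e = 1` here. The group `G` is left general so that
the lemma applies both to `Gal(M/N)` and to a subgroup `D` acting over its fixed field. -/
theorem card_stabilizer_eq_inertiaDeg (G : Type*) [Group G] [Finite G] [MulSemiringAction G M]
    [IsGaloisGroup G N M] (u : HeightOneSpectrum (𝓞 N)) (w : Ideal (𝓞 M)) [w.IsPrime]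
    [w.LiesOver u.asIdeal] (hw : w.inertia G = ⊥) :
    Nat.card (stabilizer G w) = w.inertiaDeg (𝓞 N) := by
  have := u.isMaximal
  have := finite_quotient_asIdeal u
  have : Finite u.asIdeal.ResidueField :=
    Finite.of_surjective _ (Ideal.bijective_algebraMap_quotient_residueField u.asIdeal).surjective
  rw [Ideal.card_stabilizer_eq_card_inertia_mul_finrank u.asIdeal w, hw, Subgroup.card_bot, one_mul]

theorem ncard_primesOver_mul_card_stabilizer (G : Type*) [Group G] [Finite G]
    [MulSemiringAction G M]
    [IsGaloisGroup G N M] (u : HeightOneSpectrum (𝓞 N)) (w : Ideal (𝓞 M)) [w.IsPrime]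
    [w.LiesOver u.asIdeal] :
    (u.asIdeal.primesOver (𝓞 M)).ncard * Nat.card (stabilizer G w) = Nat.card G := by
  rw [← Algebra.IsInvariant.orbit_eq_primesOver (𝓞 N) (𝓞 M) G u.asIdeal w]
  simpa using Nat.card_congr (MulAction.orbitProdStabilizerEquivGroup G w)

theorem card_stabilizer_of_injective {G' G X : Type*} [Group G'] [Group G] [MulAction G X]
    {_ : MulAction G' X} (φ : G' →* G) (hφ : Function.Injective φ)
    (h : ∀ g (x : X), g • x = φ g • x) (w : X) :
    Nat.card (stabilizer G' w) = Nat.card (stabilizer G w ⊓ φ.range : Subgroup G) := by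
  refine Nat.card_congr (Equiv.ofBijective
    (fun g => ⟨φ g.1, (h g.1 w).symm.trans g.2, g.1, rfl⟩) ⟨?_, ?_⟩)
  · intro g g' hg
    exact Subtype.ext (hφ (Subtype.mk.inj hg))
  · rintro ⟨_, hg, g, rfl⟩
    exact ⟨⟨g, by rw [mem_stabilizer_iff, h]; exact hg⟩, rfl⟩

variable (D : Subgroup Gal(M/N))

/-- The prime of a subfield below a prime. -/
def primeBelow {L : Type*} [Field L] [NumberField L] [Algebra N L]
    (Q : HeightOneSpectrum (𝓞 L)) : HeightOneSpectrum (𝓞 N) :=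
  ⟨Q.asIdeal.under (𝓞 N), inferInstance, by
    have := Q.isMaximal
    exact Ideal.IsIntegral.comap_ne_bot _ Q.ne_bot⟩

instance liesOver_primeBelow {L : Type*} [Field L] [NumberField L] [Algebra N L]
    (Q : HeightOneSpectrum (𝓞 L)) : Q.asIdeal.LiesOver (primeBelow (N := N) Q).asIdeal := ⟨rfl⟩

theorem inertia_subgroup_eq_bot {w : Ideal (𝓞 M)} (hw : w.inertia Gal(M/N) = ⊥) :
    w.inertia D = ⊥ := by
  rw [eq_bot_iff]
  intro g hg
  have : g.1 ∈ w.inertia Gal(M/N) := hg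
  rw [hw] at this
  exact Subtype.ext (Subgroup.mem_bot.1 this)

/-- The fixed field of a subgroup. -/
abbrev subgroupField : IntermediateField N M := FixedPoints.intermediateField D

theorem inertiaDeg_mul_card_stabilizer (Q : HeightOneSpectrum (𝓞 (subgroupField D)))
    (w : Ideal (𝓞 M)) [w.IsPrime] [w.LiesOver Q.asIdeal] (hw : w.inertia Gal(M/N) = ⊥) :
    Q.asIdeal.inertiaDeg (𝓞 N) * Nat.card (stabilizer Gal(M/N) w ⊓ D : Subgroup Gal(M/N)) =
      Nat.card (stabilizer Gal(M/N) w) := by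
  have : w.LiesOver (primeBelow (N := N) Q).asIdeal := Ideal.LiesOver.trans w Q.asIdeal _
  rw [card_stabilizer_eq_inertiaDeg Gal(M/N) (primeBelow (N := N) Q) w hw,
    Ideal.inertiaDeg_tower Q.asIdeal w,
    ← card_stabilizer_eq_inertiaDeg D Q w (inertia_subgroup_eq_bot D hw),
    card_stabilizer_of_injective D.subtype D.subtype_injective (fun _ _ => rfl), D.range_subtype]

theorem inertiaDeg_eq_one_iff (Q : HeightOneSpectrum (𝓞 (subgroupField D)))
    (w : Ideal (𝓞 M)) [w.IsPrime] [w.LiesOver Q.asIdeal] (hw : w.inertia Gal(M/N) = ⊥) :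
    Q.asIdeal.inertiaDeg (𝓞 N) = 1 ↔ stabilizer Gal(M/N) w ≤ D := by
  have h := inertiaDeg_mul_card_stabilizer D Q w hw
  constructor
  · intro h1
    rw [h1, one_mul] at h
    rw [← inf_eq_left]
    exact Subgroup.eq_of_le_of_card_ge inf_le_left h.ge
  · intro h1
    rw [inf_eq_left.2 h1] at h
    exact Nat.eq_of_mul_eq_mul_right Nat.card_pos (by rw [h, one_mul])

/-- The number of primes of `M` over a prime is the group order divided by that of the decomposition
group. The latter is the same for `Gal(M/N)` and for `D`, so the quotient of the two counts is the
index. -/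
theorem ncard_primesOver_subgroupField [D.Normal] (Q : HeightOneSpectrum (𝓞 (subgroupField D)))
    (w : Ideal (𝓞 M)) [w.IsPrime] [w.LiesOver Q.asIdeal]
    (hwD : stabilizer Gal(M/N) w ≤ D) :
    ((primeBelow (N := N) Q).asIdeal.primesOver (𝓞 (subgroupField D))).ncard = D.index := by
  have hlo : w.LiesOver (primeBelow (N := N) Q).asIdeal := Ideal.LiesOver.trans w Q.asIdeal _
  have hQ : Q.asIdeal.LiesOver (primeBelow (N := N) Q).asIdeal := ⟨rfl⟩
  have : IsGalois N (subgroupField D) := IsGalois.of_fixedField_normal_subgroup D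
  have h1 := ncard_primesOver_mul_card_stabilizer Gal(M/N) (primeBelow (N := N) Q) w
  have h2 := ncard_primesOver_mul_card_stabilizer D Q w
  have h3 := Ideal.ncard_primesOver_mul_ncard_primesOver (p := (primeBelow (N := N) Q).asIdeal)
    Q.asIdeal Gal(subgroupField D/N) (𝓞 M) Gal(M/N)
  rw [card_stabilizer_of_injective D.subtype D.subtype_injective (fun _ _ => rfl),
    D.range_subtype, inf_eq_left.2 hwD] at h2
  rw [← h3, mul_assoc, h2] at h1
  rw [← D.index_mul_card] at h1
  exact Nat.eq_of_mul_eq_mul_right Nat.card_pos h1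

end LocalCount

/-! ### Densities of decomposition groups in abelian extensions -/

section AbelianDensity

open IsDedekindDomain Filter MulAction Asymptotics
open scoped Pointwise

set_option linter.unusedSectionVars false

variable {N M : Type*} [Field N] [NumberField N] [Field M] [NumberField M] [Algebra N M]

theorem exists_primeBelow_eq (u : HeightOneSpectrum (𝓞 N)) :
    ∃ w : HeightOneSpectrum (𝓞 M), primeBelow w = u := by
  obtain ⟨w, hw, hlo⟩ := Ideal.exists_maximal_ideal_liesOver_of_isIntegral (S := 𝓞 M)
    u.asIdeal
  have h0 : w ≠ ⊥ := fun h => u.ne_bot (by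
    rw [hlo.over, h]
    exact Ideal.comap_bot_of_injective _ (FaithfulSMul.algebraMap_injective (𝓞 N) (𝓞 M)))
  exact ⟨⟨w, hw.isPrime, h0⟩, HeightOneSpectrum.ext hlo.over.symm⟩

variable (M) in
/-- A chosen prime above `u`. -/
noncomputable def primeAbove (u : HeightOneSpectrum (𝓞 N)) : HeightOneSpectrum (𝓞 M) :=
  (exists_primeBelow_eq u).choose

theorem primeBelow_primeAbove (u : HeightOneSpectrum (𝓞 N)) : primeBelow (primeAbove M u) = u :=
  (exists_primeBelow_eq u).choose_spec

variable [IsGalois N M]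

/-- The decomposition group of a chosen prime above `u`. -/
noncomputable def decompAt (M : Type*) [Field M] [NumberField M] [Algebra N M] [IsGalois N M]
    (u : HeightOneSpectrum (𝓞 N)) : Subgroup Gal(M/N) :=
  stabilizer Gal(M/N) (primeAbove M u).asIdeal

theorem exists_smul_primeAbove (w : HeightOneSpectrum (𝓞 M)) :
    ∃ g : Gal(M/N), w.asIdeal = g • (primeAbove M (primeBelow (N := N) w)).asIdeal := by
  refine Algebra.IsInvariant.exists_smul_of_under_eq (𝓞 N) (𝓞 M) Gal(M/N) _ _ ?_
  exact congrArg HeightOneSpectrum.asIdeal (primeBelow_primeAbove (M := M) (primeBelow (N := N) w))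

/-- The decomposition groups of the primes over `u` are conjugate, hence equal in an abelian group.
-/
theorem stabilizer_eq_decompAt (hcomm : ∀ a b : Gal(M/N), a * b = b * a)
    (w : HeightOneSpectrum (𝓞 M)) :
    stabilizer Gal(M/N) w.asIdeal = decompAt M (primeBelow (N := N) w) := by
  obtain ⟨g, hg⟩ := exists_smul_primeAbove (N := N) w
  rw [hg, decompAt]
  ext x
  rw [mem_stabilizer_iff, mem_stabilizer_iff, ← mul_smul, hcomm x g, mul_smul, smul_left_cancel_iff]

variable (N M) in
/-- The primes of `N` below a prime with non-trivial inertia group. -/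
def ramifiedPrimes : Set (HeightOneSpectrum (𝓞 N)) :=
  primeBelow '' {w : HeightOneSpectrum (𝓞 M) | w.asIdeal.inertia Gal(M/N) ≠ ⊥}

theorem finite_ramifiedPrimes : (ramifiedPrimes N M).Finite :=
  finite_inertia_ne_bot.image _

open Classical in
/-- The sum of `N(u)^{-s}` over the primes `u ∉ B` of absolute degree one with a given property. -/
noncomputable def primeSum (B : Set (HeightOneSpectrum (𝓞 N)))
    (c : HeightOneSpectrum (𝓞 N) → Prop) (s : ℝ) : ℝ :=
  ∑' u : HeightOneSpectrum (𝓞 N),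
    if u ∉ B ∧ (Ideal.absNorm u.asIdeal).Prime ∧ c u then idealNormPow N s u.asIdeal else 0

theorem finite_primeBelow_fiber {L : Type*} [Field L] [NumberField L] [Algebra N L]
    (u : HeightOneSpectrum (𝓞 N)) :
    Finite {Q : HeightOneSpectrum (𝓞 L) // primeBelow Q = u} := by
  have : Finite (u.asIdeal.primesOver (𝓞 L)) := Algebra.QuasiFinite.finite_primesOver _
  refine Finite.of_injective
    (fun Q => (⟨Q.1.asIdeal, Q.1.isPrime, ⟨(congrArg HeightOneSpectrum.asIdeal Q.2).symm⟩⟩ : u.asIdeal.primesOver (𝓞 L)))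
    fun Q Q' h => Subtype.ext (HeightOneSpectrum.ext (Subtype.mk.inj h))

theorem card_primeBelow_fiber {L : Type*} [Field L] [NumberField L] [Algebra N L]
    (u : HeightOneSpectrum (𝓞 N)) :
    Nat.card {Q : HeightOneSpectrum (𝓞 L) // primeBelow Q = u} =
      (u.asIdeal.primesOver (𝓞 L)).ncard := by
  rw [← Nat.card_coe_set_eq]
  refine Nat.card_congr
    { toFun := fun Q => ⟨Q.1.asIdeal, Q.1.isPrime, ⟨(congrArg HeightOneSpectrum.asIdeal Q.2).symm⟩⟩
      invFun := fun Q => ⟨⟨Q.1, Q.2.1, fun h => u.ne_bot ?_⟩, HeightOneSpectrum.ext Q.2.2.over.symm⟩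
      left_inv := fun Q => rfl
      right_inv := fun Q => rfl }
  rw [Q.2.2.over, h]
  exact Ideal.comap_bot_of_injective _ (FaithfulSMul.algebraMap_injective (𝓞 N) (𝓞 L))

theorem absNorm_primeBelow_pow {L : Type*} [Field L] [NumberField L] [Algebra N L]
    (Q : HeightOneSpectrum (𝓞 L)) :
    Ideal.absNorm (primeBelow (N := N) Q).asIdeal ^ Q.asIdeal.inertiaDeg (𝓞 N) =
      Ideal.absNorm Q.asIdeal :=
  Ideal.absNorm_pow_inertiaDeg _ _

theorem prime_absNorm_iff {L : Type*} [Field L] [NumberField L] [Algebra N L]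
    (Q : HeightOneSpectrum (𝓞 L)) :
    (Ideal.absNorm Q.asIdeal).Prime ↔ (Ideal.absNorm (primeBelow (N := N) Q).asIdeal).Prime ∧
      Q.asIdeal.inertiaDeg (𝓞 N) = 1 := by
  rw [← absNorm_primeBelow_pow (N := N) Q]
  constructor
  · intro h
    have h1 := h.eq_one_of_pow
    refine ⟨?_, h1⟩
    rwa [h1, pow_one] at h
  · rintro ⟨h, h1⟩
    rwa [h1, pow_one]

variable (hcomm : ∀ a b : Gal(M/N), a * b = b * a) (D : Subgroup Gal(M/N))

include hcomm in
theorem inertiaDeg_eq_one_iff_decompAt_le (Q : HeightOneSpectrum (𝓞 (subgroupField D)))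
    (hQ : primeBelow (N := N) Q ∉ ramifiedPrimes N M) :
    Q.asIdeal.inertiaDeg (𝓞 N) = 1 ↔ decompAt M (primeBelow (N := N) Q) ≤ D := by
  obtain ⟨w, hw⟩ := exists_primeBelow_eq (M := M) Q
  have hlo : w.asIdeal.LiesOver Q.asIdeal := ⟨by rw [← hw]; rfl⟩
  have hb : primeBelow (N := N) w = primeBelow Q := by
    have : w.asIdeal.LiesOver (primeBelow (N := N) Q).asIdeal := Ideal.LiesOver.trans _ Q.asIdeal _
    exact HeightOneSpectrum.ext this.over.symm
  have hin : w.asIdeal.inertia Gal(M/N) = ⊥ := by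
    by_contra h
    exact hQ ⟨w, h, hb⟩
  rw [inertiaDeg_eq_one_iff D Q w.asIdeal hin, stabilizer_eq_decompAt hcomm, hb]

include hcomm in
theorem card_primeBelow_fiber_subgroupField (u : HeightOneSpectrum (𝓞 N))
    (hD : decompAt M u ≤ D) :
    Nat.card {Q : HeightOneSpectrum (𝓞 (subgroupField D)) // primeBelow Q = u} = D.index := by
  have : D.Normal := ⟨fun a ha b => by rw [hcomm b a, mul_inv_cancel_right]; exact ha⟩
  obtain ⟨Q, rfl⟩ := exists_primeBelow_eq (M := subgroupField D) u
  obtain ⟨w, hw⟩ := exists_primeBelow_eq (M := M) Q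
  have hlo : w.asIdeal.LiesOver Q.asIdeal := ⟨by rw [← hw]; rfl⟩
  have hb : primeBelow (N := N) w = primeBelow Q := by
    have : w.asIdeal.LiesOver (primeBelow (N := N) Q).asIdeal := Ideal.LiesOver.trans _ Q.asIdeal _
    exact HeightOneSpectrum.ext this.over.symm
  rw [card_primeBelow_fiber]
  exact ncard_primesOver_subgroupField D Q w.asIdeal
    (by rw [stabilizer_eq_decompAt hcomm, hb]; exact hD)

include hcomm in
open Classical in
-- Let `u ∉ B` have prime norm. If the decomposition group lies in `D`, there are `[Gal(M/N) : D]`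
-- primes of the fixed field over `u`, all of prime norm `N(u)`; otherwise none of the primes over
-- `u` has prime norm.
theorem hasSum_primeSum_subgroupField {B : Set (HeightOneSpectrum (𝓞 N))}
    (hB : ramifiedPrimes N M ⊆ B) {s : ℝ}
    (hs : Summable fun Q : HeightOneSpectrum (𝓞 (subgroupField D)) =>
      idealNormPow (subgroupField D) s Q.asIdeal) :
    HasSum (fun Q : HeightOneSpectrum (𝓞 (subgroupField D)) =>
      if primeBelow (N := N) Q ∉ B ∧ (Ideal.absNorm Q.asIdeal).Prime then
        idealNormPow (subgroupField D) s Q.asIdeal else 0)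
      (D.index * primeSum B (fun u => decompAt M u ≤ D) s) := by
  set F : HeightOneSpectrum (𝓞 (subgroupField D)) → ℝ := fun Q =>
      if primeBelow (N := N) Q ∉ B ∧ (Ideal.absNorm Q.asIdeal).Prime then
        idealNormPow (subgroupField D) s Q.asIdeal else 0 with hF
  have hFs : Summable F := by
    refine Summable.of_nonneg_of_le (fun Q => ?_) (fun Q => ?_) hs
    · simp only [hF]; split_ifs
      exacts [idealNormPow_nonneg _ _ _, le_rfl]
    · simp only [hF]; split_ifs
      exacts [le_rfl, idealNormPow_nonneg _ _ _]
  let e := Equiv.sigmaFiberEquiv fun Q : HeightOneSpectrum (𝓞 (subgroupField D)) =>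
    primeBelow (N := N) Q
  have hfib : ∀ u : HeightOneSpectrum (𝓞 N), HasSum
      (fun Q : {Q : HeightOneSpectrum (𝓞 (subgroupField D)) // primeBelow Q = u} => F Q.1)
      (D.index * if u ∉ B ∧ (Ideal.absNorm u.asIdeal).Prime ∧ decompAt M u ≤ D then
        idealNormPow N s u.asIdeal else 0) := by
    intro u
    have := finite_primeBelow_fiber (L := subgroupField D) u
    have := Fintype.ofFinite {Q : HeightOneSpectrum (𝓞 (subgroupField D)) // primeBelow Q = u}
    have hval : ∀ Q : {Q : HeightOneSpectrum (𝓞 (subgroupField D)) // primeBelow Q = u},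
        F Q.1 = if u ∉ B ∧ (Ideal.absNorm u.asIdeal).Prime ∧ decompAt M u ≤ D then
        idealNormPow N s u.asIdeal else 0 := by
      rintro ⟨Q, rfl⟩
      simp only [hF]
      by_cases hb : primeBelow (N := N) Q ∈ B
      · simp [hb]
      have h1 := inertiaDeg_eq_one_iff_decompAt_le hcomm D Q fun h => hb (hB h)
      have h2 := prime_absNorm_iff (N := N) Q
      rw [h1] at h2
      simp only [hb, not_false_eq_true, true_and, h2]
      split_ifs with h
      · rw [idealNormPow_apply, idealNormPow_apply, ← absNorm_primeBelow_pow (N := N) Q,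
          h1.2 h.2, pow_one]
      · rfl
    convert hasSum_fintype _ using 1
    rw [Finset.sum_congr rfl fun Q _ => hval Q, Finset.sum_const, nsmul_eq_mul, Finset.card_univ,
      ← Nat.card_eq_fintype_card]
    split_ifs with h
    · rw [card_primeBelow_fiber_subgroupField hcomm D u h.2.2]
    · simp
  have hsig : HasSum (F ∘ e) (∑' Q, F Q) := e.hasSum_iff.2 hFs.hasSum
  have h3 := hsig.sigma hfib
  have h4 : ∑' Q, F Q = D.index * primeSum B (fun u => decompAt M u ≤ D) s := by
    rw [primeSum, ← tsum_mul_left]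
    exact h3.tsum_eq.symm
  rw [← h4]
  exact hFs.hasSum

include hcomm in
-- This is the estimate for primes of degree one in the fixed field of `D`, divided by the index of
-- `D`. The finitely many primes over `B` contribute at most `1` each.
theorem primeSum_isBigO {B : Set (HeightOneSpectrum (𝓞 N))} (hBf : B.Finite)
    (hB : ramifiedPrimes N M ⊆ B) :
    (fun s : ℝ => primeSum B (fun u => decompAt M u ≤ D) s -
      (Nat.card D / Nat.card Gal(M/N) : ℝ) * Real.log (1 / (s - 1))) =O[𝓝[>] 1]
      (fun _ => (1 : ℝ)) := by
  classical
  obtain ⟨C, hC⟩ := exists_degreeOneSum_bound (subgroupField D)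
  have hfin : Finite {Q : HeightOneSpectrum (𝓞 (subgroupField D)) // primeBelow (N := N) Q ∈ B} := by
    have : Finite B := hBf
    have : ∀ u : B, Finite {Q : HeightOneSpectrum (𝓞 (subgroupField D)) // primeBelow Q = u.1} :=
      fun u => finite_primeBelow_fiber u.1
    refine Finite.of_injective (β := Σ u : B,
      {Q : HeightOneSpectrum (𝓞 (subgroupField D)) // primeBelow Q = u.1})
      (fun Q => ⟨⟨_, Q.2⟩, ⟨Q.1, rfl⟩⟩) fun Q Q' h => ?_
    have := congrArg (fun x : Σ u : B,
      {Q : HeightOneSpectrum (𝓞 (subgroupField D)) // primeBelow Q = u.1} => x.2.1) h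
    exact Subtype.ext this
  have hfin' : {Q : HeightOneSpectrum (𝓞 (subgroupField D)) | primeBelow (N := N) Q ∈ B}.Finite :=
    hfin
  have hidx : (0 : ℝ) < D.index := by exact_mod_cast Nat.pos_of_ne_zero Subgroup.FiniteIndex.index_ne_zero
  have hcard : (Nat.card D / Nat.card Gal(M/N) : ℝ) = (D.index : ℝ)⁻¹ := by
    rw [← D.index_mul_card]
    have : (Nat.card D : ℝ) ≠ 0 := by exact_mod_cast Nat.card_pos.ne'
    push_cast
    field_simp
  rw [hcard]
  refine IsBigO.of_bound ((D.index : ℝ)⁻¹ * (C + hfin'.toFinset.card)) ?_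
  filter_upwards [hC, self_mem_nhdsWithin] with s hs hs1
  have hs1 : 1 < s := hs1
  have h1 := hasSum_primeSum_subgroupField hcomm D hB hs.1
  have h2 : HasSum (fun Q : HeightOneSpectrum (𝓞 (subgroupField D)) =>
      if primeBelow (N := N) Q ∈ B ∧ (Ideal.absNorm Q.asIdeal).Prime then
        idealNormPow (subgroupField D) s Q.asIdeal else 0)
      (∑ Q ∈ hfin'.toFinset, if primeBelow (N := N) Q ∈ B ∧ (Ideal.absNorm Q.asIdeal).Prime then
        idealNormPow (subgroupField D) s Q.asIdeal else 0) := by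
    refine hasSum_sum_of_ne_finset_zero fun Q hQ => ?_
    rw [if_neg]
    rintro ⟨h, -⟩
    exact hQ (by simpa using h)
  have h3 := (h1.add h2).tsum_eq
  have h4 : degreeOneSum (subgroupField D) s = _ := (tsum_congr fun Q => ?_).trans h3
  swap
  · by_cases hb : primeBelow (N := N) Q ∈ B <;> simp [hb]
  set T := ∑ Q ∈ hfin'.toFinset, if primeBelow (N := N) Q ∈ B ∧ (Ideal.absNorm Q.asIdeal).Prime then
        idealNormPow (subgroupField D) s Q.asIdeal else 0 with hT
  have hT0 : 0 ≤ T := Finset.sum_nonneg fun Q _ => by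
    split_ifs
    exacts [idealNormPow_nonneg _ _ _, le_rfl]
  have hT1 : T ≤ hfin'.toFinset.card := by
    rw [hT]
    refine (Finset.sum_le_card_nsmul _ _ 1 fun Q _ => ?_).trans (by simp)
    split_ifs
    · exact (idealNormPow_asIdeal_le _ hs1.le Q).trans (by norm_num)
    · norm_num
  have h5 := hs.2
  rw [h4, abs_le] at h5
  rw [norm_one, mul_one, Real.norm_eq_abs]
  have h6 : primeSum B (fun u => decompAt M u ≤ D) s - (D.index : ℝ)⁻¹ * Real.log (1 / (s - 1)) =
      (D.index : ℝ)⁻¹ * (D.index * primeSum B (fun u => decompAt M u ≤ D) s -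
        Real.log (1 / (s - 1))) := by
    field_simp
  rw [h6, abs_mul, abs_of_pos (inv_pos.2 hidx)]
  gcongr
  rw [abs_le]
  constructor <;> linarith

end AbelianDensity

/-! ### Inert primes in cyclic extensions -/

section Inert

open IsDedekindDomain Filter MulAction Asymptotics
open scoped Pointwise

variable {N M : Type*} [Field N] [NumberField N] [Field M] [NumberField M] [Algebra N M]
  [IsGalois N M]

theorem card_eq_sum_card_zpowers_eq {G : Type*} [Group G] [Finite G] [Fintype (Subgroup G)]
    (D : Subgroup G) [DecidablePred (· ≤ D)] :
    Nat.card D = ∑ D' ∈ Finset.univ.filter (· ≤ D),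
      Nat.card {g : G // Subgroup.zpowers g = D'} := by
  classical
  have := Fintype.ofFinite G
  have h1 : Nat.card D = (Finset.univ.filter fun g : G => g ∈ D).card := by
    rw [Nat.card_eq_fintype_card, Fintype.card_subtype]
  rw [h1, Finset.card_eq_sum_card_fiberwise (f := fun g : G => Subgroup.zpowers g)
    (t := Finset.univ.filter (· ≤ D)) (fun g hg => by
      simpa [Subgroup.zpowers_le] using hg)]
  refine Finset.sum_congr rfl fun D' hD' => ?_
  rw [Nat.card_eq_fintype_card, Fintype.card_subtype, Finset.filter_filter]
  congr 1
  ext g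
  simp only [Finset.mem_filter, Finset.mem_univ, true_and, and_iff_right_iff_imp]
  rintro rfl
  exact Subgroup.zpowers_le.1 (Finset.mem_filter.1 hD').2

theorem primeSum_le_eq_sum {B : Set (HeightOneSpectrum (𝓞 N))} [Fintype (Subgroup Gal(M/N))]
    (D : Subgroup Gal(M/N)) [DecidablePred (· ≤ D)] {s : ℝ}
    (hs : Summable fun u : HeightOneSpectrum (𝓞 N) => idealNormPow N s u.asIdeal) :
    primeSum B (fun u => decompAt M u ≤ D) s =
      ∑ D' ∈ Finset.univ.filter (· ≤ D), primeSum B (fun u => decompAt M u = D') s := by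
  classical
  simp only [primeSum]
  rw [← Summable.tsum_finsetSum]
  · refine tsum_congr fun u => ?_
    by_cases h : u ∉ B ∧ (Ideal.absNorm u.asIdeal).Prime
    · by_cases h2 : decompAt M u ≤ D
      · rw [if_pos ⟨h.1, h.2, h2⟩, Finset.sum_eq_single (decompAt M u)]
        · rw [if_pos ⟨h.1, h.2, rfl⟩]
        · intro D' _ hD'
          rw [if_neg]
          exact fun h' => hD' h'.2.2.symm
        · intro h'
          exact absurd (by simpa using h2) h'
      · rw [if_neg fun h' => h2 h'.2.2, Finset.sum_eq_zero]
        intro D' hD'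
        rw [if_neg]
        rintro ⟨-, -, rfl⟩
        exact h2 (Finset.mem_filter.1 hD').2
    · rw [if_neg fun h' => h ⟨h'.1, h'.2.1⟩, Finset.sum_eq_zero]
      intro D' _
      exact if_neg fun h' => h ⟨h'.1, h'.2.1⟩
  · intro D' _
    refine Summable.of_nonneg_of_le (fun u => ?_) (fun u => ?_) hs
    · split_ifs
      exacts [idealNormPow_nonneg _ _ _, le_rfl]
    · split_ifs
      exacts [le_rfl, idealNormPow_nonneg _ _ _]

/-- Möbius inversion over the lattice of subgroups, carried out as an induction: both the prime sums
and the numbers of generators, summed over `D' ≤ D`, give the quantities compared in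
`primeSum_isBigO`. -/
theorem primeSum_decompAt_eq_isBigO (hcomm : ∀ a b : Gal(M/N), a * b = b * a)
    {B : Set (HeightOneSpectrum (𝓞 N))} (hBf : B.Finite)
    (hB : ramifiedPrimes N M ⊆ B) (D : Subgroup Gal(M/N)) :
    (fun s : ℝ => primeSum B (fun u => decompAt M u = D) s -
      (Nat.card {g : Gal(M/N) // Subgroup.zpowers g = D} / Nat.card Gal(M/N) : ℝ) *
        Real.log (1 / (s - 1))) =O[𝓝[>] 1] (fun _ => (1 : ℝ)) := by
  classical
  have := Fintype.ofFinite (Subgroup Gal(M/N))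
  induction D using WellFoundedLT.induction with
  | _ D ih =>
  obtain ⟨C, hC⟩ := exists_degreeOneSum_bound N
  have hins : Finset.univ.filter (fun D' : Subgroup Gal(M/N) => D' ≤ D) =
      insert D (Finset.univ.filter (fun D' : Subgroup Gal(M/N) => D' < D)) := by
    ext D'
    simp [le_iff_eq_or_lt]
  have hnot : D ∉ Finset.univ.filter (fun D' : Subgroup Gal(M/N) => D' < D) := by simp
  have h1 := primeSum_isBigO hcomm D hBf hB
  have h2 : (fun s : ℝ => ∑ D' ∈ Finset.univ.filter (fun D' : Subgroup Gal(M/N) => D' < D),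
      (primeSum B (fun u => decompAt M u = D') s -
      (Nat.card {g : Gal(M/N) // Subgroup.zpowers g = D'} / Nat.card Gal(M/N) : ℝ) *
        Real.log (1 / (s - 1)))) =O[𝓝[>] 1] (fun _ => (1 : ℝ)) :=
    IsBigO.fun_sum fun D' hD' => ih D' (Finset.mem_filter.1 hD').2
  refine (h1.sub h2).congr' ?_ EventuallyEq.rfl
  filter_upwards [hC] with s hs
  rw [primeSum_le_eq_sum D hs.1, card_eq_sum_card_zpowers_eq D, hins, Finset.sum_insert hnot,
    Finset.sum_insert hnot, Finset.sum_sub_distrib, ← Finset.sum_mul, ← Finset.sum_div]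
  push_cast
  ring

/-- In a cyclic extension there is an unramified inert prime of degree one outside any finite
set. -/
theorem exists_inert_prime [IsCyclic Gal(M/N)] {T : Set (HeightOneSpectrum (𝓞 N))}
    (hT : T.Finite) : ∃ w : HeightOneSpectrum (𝓞 M), primeBelow w ∉ T ∧
      (Ideal.absNorm (primeBelow (N := N) w).asIdeal).Prime ∧
      stabilizer Gal(M/N) w.asIdeal = ⊤ := by
  by_contra! hno
  have hcomm : ∀ a b : Gal(M/N), a * b = b * a := by
    let _ := IsCyclic.commGroup (α := Gal(M/N))
    exact fun a b => mul_comm a b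
  have h := primeSum_decompAt_eq_isBigO hcomm (hT.union finite_ramifiedPrimes)
    (Set.subset_union_right (s := T)) (⊤ : Subgroup Gal(M/N))
  have h0 : ∀ s : ℝ, primeSum (T ∪ ramifiedPrimes N M) (fun u => decompAt M u = ⊤) s = 0 := by
    intro s
    rw [primeSum]
    refine (tsum_congr fun u => if_neg ?_).trans tsum_zero
    rintro ⟨h1, h2, h3⟩
    refine hno (primeAbove M u) ?_ ?_ h3
    · rw [primeBelow_primeAbove]
      exact fun h => h1 (Or.inl h)
    · rwa [primeBelow_primeAbove]
  obtain ⟨g, hg⟩ := IsCyclic.exists_generator (α := Gal(M/N))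
  have hne : Nonempty {g : Gal(M/N) // Subgroup.zpowers g = ⊤} :=
    ⟨g, (Subgroup.eq_top_iff' _).2 hg⟩
  -- The density of inert primes, positive because a cyclic group has a generator. Without such
  -- primes the sum would vanish identically, while the main term `c log(1/(s - 1))` is unbounded.
  set c : ℝ := Nat.card {g : Gal(M/N) // Subgroup.zpowers g = ⊤} / Nat.card Gal(M/N) with hc
  have hcpos : 0 < c := by
    have h1 : 0 < Nat.card {g : Gal(M/N) // Subgroup.zpowers g = ⊤} := Nat.card_pos
    have h2 : 0 < Nat.card Gal(M/N) := Nat.card_pos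
    rw [hc]
    positivity
  have hlog : Tendsto (fun s : ℝ => Real.log (1 / (s - 1))) (𝓝[>] 1) atTop := by
    refine Real.tendsto_log_atTop.comp ?_
    simp only [one_div]
    refine tendsto_inv_nhdsGT_zero.comp ?_
    refine tendsto_nhdsWithin_iff.2 ⟨?_, ?_⟩
    · refine tendsto_nhdsWithin_of_tendsto_nhds ?_
      have : Continuous fun s : ℝ => s - 1 := by fun_prop
      simpa using this.tendsto 1
    · filter_upwards [self_mem_nhdsWithin] with s hs
      exact sub_pos.2 (Set.mem_Ioi.1 hs)
  obtain ⟨C, hC⟩ := h.bound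
  have h4 := (hlog.const_mul_atTop hcpos).eventually_gt_atTop C
  obtain ⟨s, hs1, hs2⟩ := (hC.and h4).exists
  rw [h0, zero_sub, norm_neg, norm_one, mul_one, Real.norm_eq_abs] at hs1
  exact absurd (hs1.trans_lt hs2) (not_lt.2 (le_abs_self _))

end Inert

/-! ### Frobenius's density theorem for `G_K` -/

section FrobeniusDensity

open IsDedekindDomain Filter MulAction
open scoped Pointwise

variable {K : Type*} [Field K] [NumberField K]

theorem isInvariant_intBar : Algebra.IsInvariant (𝓞 K) (IntBar K) (AbsGal K) := by
  refine ⟨fun x hx => ?_⟩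
  have h1 : ∀ g : AbsGal K, g (x : AlgebraicClosure K) = x := fun g =>
    congrArg Subtype.val (hx g)
  obtain ⟨a, ha⟩ := (InfiniteGalois.mem_range_algebraMap_iff_fixed (k := K) _).2 h1
  have h2 : IsIntegral (𝓞 K) a := by
    rw [← isIntegral_algebraMap_iff (algebraMap K (AlgebraicClosure K)).injective, ha]
    exact x.2
  obtain ⟨b, hb⟩ := (IsIntegrallyClosed.isIntegral_iff (K := K)).1 h2
  refine ⟨b, Subtype.ext ?_⟩
  rw [← ha, ← hb]
  rfl

theorem exists_isArithFrobAt_absGal (P : Ideal (IntBar K)) [P.IsPrime] (v : HeightOneSpectrum (𝓞 K))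
    (hP : P.under (𝓞 K) = v.asIdeal) : ∃ φ : AbsGal K, IsArithFrobAt (𝓞 K) φ P := by
  -- For the discrete topology the action of `G_K` on the integral elements is continuous, so the
  -- decomposition group of this profinite group surjects onto the automorphisms of the residue
  -- extension. A Frobenius element is a lift of the `q`-power map.
  let _ : TopologicalSpace (IntBar K) := ⊥
  have : DiscreteTopology (IntBar K) := ⟨rfl⟩
  have : ContinuousSMul (AbsGal K) (IntBar K) := by
    rw [continuousSMul_iff_stabilizer_isOpen]
    intro x
    convert stabilizer_isOpen_of_isIntegral (K := K) (x : AlgebraicClosure K) using 1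
    ext g
    simp only [SetLike.mem_coe, mem_stabilizer_iff]
    exact Subtype.ext_iff
  have := isInvariant_intBar (K := K)
  have hlo : P.LiesOver v.asIdeal := ⟨hP.symm⟩
  have : P.IsMaximal := Ideal.IsMaximal.of_liesOver_isMaximal P v.asIdeal
  let _ : Field (𝓞 K ⧸ v.asIdeal) := Ideal.Quotient.field _
  let _ : Field (IntBar K ⧸ P) := Ideal.Quotient.field _
  have := finite_quotient_asIdeal v
  have := Fintype.ofFinite (𝓞 K ⧸ v.asIdeal)
  have hint : Algebra.IsIntegral (𝓞 K ⧸ v.asIdeal) (IntBar K ⧸ P) := inferInstance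
  have halg : Algebra.IsAlgebraic (𝓞 K ⧸ v.asIdeal) (IntBar K ⧸ P) := hint.isAlgebraic
  obtain ⟨σ, hσ⟩ := Ideal.Quotient.stabilizerHom_surjective_of_profinite (G := AbsGal K) v.asIdeal P
    (FiniteField.frobeniusAlgEquivOfAlgebraic (𝓞 K ⧸ v.asIdeal) (IntBar K ⧸ P))
  refine ⟨σ, fun x => ?_⟩
  rw [← Ideal.Quotient.eq, hP, Nat.card_eq_fintype_card]
  exact DFunLike.congr_fun hσ (Ideal.Quotient.mk P x)

/-- The inclusion of the ring of integers of a finite subextension into `IntBar K`. -/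
noncomputable def ringOfIntegersToIntBar (M : IntermediateField K (AlgebraicClosure K)) : 𝓞 M →+* IntBar K where
  toFun x := ⟨((x : M) : AlgebraicClosure K), by
    have h : IsIntegral ℤ (x : M) := x.2
    exact (h.map (M.val.restrictScalars ℤ)).tower_top⟩
  map_one' := rfl
  map_zero' := rfl
  map_mul' _ _ := rfl
  map_add' _ _ := rfl

omit [NumberField K] in
theorem exists_comap_ringOfIntegersToIntBar (M : IntermediateField K (AlgebraicClosure K))
    [FiniteDimensional K M] (w : Ideal (𝓞 M)) [hw : w.IsPrime] :
    ∃ P : Ideal (IntBar K), P.IsPrime ∧ P.comap (ringOfIntegersToIntBar M) = w := by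
  let _ := (ringOfIntegersToIntBar M).toAlgebra
  have hst : IsScalarTower (𝓞 K) (𝓞 M) (IntBar K) := IsScalarTower.of_algebraMap_eq fun x => rfl
  have : Algebra.IsIntegral (𝓞 M) (IntBar K) := Algebra.IsIntegral.tower_top (𝓞 K)
  have hinj : Function.Injective (ringOfIntegersToIntBar M) := fun x y h => by
    have : ((x : M) : AlgebraicClosure K) = y :=
      congrArg (fun z : IntBar K => (z : AlgebraicClosure K)) h
    exact NumberField.RingOfIntegers.ext (Subtype.ext this)
  obtain ⟨P, -, hP, h⟩ := Ideal.exists_ideal_over_prime_of_isIntegral w (⊥ : Ideal (IntBar K)) (by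
    change Ideal.comap (ringOfIntegersToIntBar M) ⊥ ≤ w
    rw [Ideal.comap_bot_of_injective _ hinj]; exact bot_le)
  exact ⟨P, hP, h⟩

theorem pow_card_quotient_mem_of_pow_eq_one {R S G : Type*} [CommRing R] [CommRing S] [Algebra R S]
    [Group G] [MulSemiringAction G S] [SMulCommClass G R S] {Q : Ideal S} {σ : G}
    (h : IsArithFrobAt R σ Q) (i : ℕ) (x : S) :
    σ ^ i • x - x ^ (Nat.card (R ⧸ Q.under R) ^ i) ∈ Q := by
  induction i with
  | zero => simp
  | succ i ih =>
    have h1 := h (σ ^ i • x)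
    have h2 : (σ ^ i • x) ^ Nat.card (R ⧸ Q.under R) -
        (x ^ (Nat.card (R ⧸ Q.under R) ^ i)) ^ Nat.card (R ⧸ Q.under R) ∈ Q :=
      Q.mem_of_dvd (sub_dvd_pow_sub_pow _ _ _) ih
    have h3 := Q.add_mem h1 h2
    rw [← pow_mul, ← pow_succ] at h3
    simpa [pow_succ', mul_smul] using h3

/-- If `σ^i = 1`, every element of the residue field is a root of `X^(q^i) - X`, so the field has at
most `q^i` elements. -/
theorem inertiaDeg_le_of_pow_eq_one {N M G : Type*} [Field N] [NumberField N] [Field M]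
    [NumberField M] [Algebra N M] [Group G] [MulSemiringAction G (𝓞 M)]
    [SMulCommClass G (𝓞 N) (𝓞 M)] (w : HeightOneSpectrum (𝓞 M)) {σ : G}
    (h : IsArithFrobAt (𝓞 N) σ w.asIdeal) {i : ℕ} (hi : 0 < i) (hσ : σ ^ i = 1) :
    w.asIdeal.inertiaDeg (𝓞 N) ≤ i := by
  have hmax := w.isMaximal
  let _ : Field (𝓞 M ⧸ w.asIdeal) := Ideal.Quotient.field _
  have := finite_quotient_asIdeal w
  have := Fintype.ofFinite (𝓞 M ⧸ w.asIdeal)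
  set q := Nat.card (𝓞 N ⧸ w.asIdeal.under (𝓞 N)) with hq
  have hqN : q = Ideal.absNorm (primeBelow (N := N) w).asIdeal := rfl
  have hq2 : 2 ≤ q := hqN ▸ two_le_absNorm_asIdeal _
  have hroot : ∀ x : 𝓞 M ⧸ w.asIdeal, x ^ q ^ i = x := by
    intro x
    obtain ⟨x, rfl⟩ := Ideal.Quotient.mk_surjective x
    have h1 := pow_card_quotient_mem_of_pow_eq_one h i x
    rw [hσ, one_smul, ← Ideal.Quotient.eq] at h1
    rw [← map_pow, h1]
  have hcard : Nat.card (𝓞 M ⧸ w.asIdeal) ≤ q ^ i := by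
    have hne : (Polynomial.X ^ q ^ i - Polynomial.X : Polynomial (𝓞 M ⧸ w.asIdeal)) ≠ 0 :=
      FiniteField.X_pow_card_sub_X_ne_zero _ (Nat.one_lt_pow hi.ne' (by omega))
    have h2 := Polynomial.card_roots' (Polynomial.X ^ q ^ i - Polynomial.X :
      Polynomial (𝓞 M ⧸ w.asIdeal))
    rw [FiniteField.X_pow_card_sub_X_natDegree_eq _ (Nat.one_lt_pow hi.ne' (by omega))] at h2
    refine le_trans ?_ h2
    classical
    rw [Nat.card_eq_fintype_card, ← Finset.card_univ]
    refine (Finset.card_le_card fun x _ => ?_).trans (Multiset.toFinset_card_le _)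
    rw [Multiset.mem_toFinset, Polynomial.mem_roots hne]
    simp [hroot x]
  have h3 : Nat.card (𝓞 M ⧸ w.asIdeal) = q ^ w.asIdeal.inertiaDeg (𝓞 N) :=
    (absNorm_primeBelow_pow (N := N) w).symm
  rw [h3] at hcard
  exact (Nat.pow_le_pow_iff_right hq2).1 hcard

theorem finite_primeBelow_mem {K N : Type*} [Field K] [NumberField K] [Field N] [NumberField N]
    [Algebra K N] {B : Set (HeightOneSpectrum (𝓞 K))} (hB : B.Finite) :
    {u : HeightOneSpectrum (𝓞 N) | primeBelow u ∈ B}.Finite := by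
  have : Finite B := hB
  have : ∀ v : B, Finite {u : HeightOneSpectrum (𝓞 N) // primeBelow u = v.1} :=
    fun v => finite_primeBelow_fiber v.1
  have : Finite {u : HeightOneSpectrum (𝓞 N) // primeBelow u ∈ B} := by
    refine Finite.of_injective (β := Σ v : B, {u : HeightOneSpectrum (𝓞 N) // primeBelow u = v.1})
      (fun Q => ⟨⟨_, Q.2⟩, ⟨Q.1, rfl⟩⟩) fun Q Q' h => ?_
    exact Subtype.ext (congrArg (fun x : Σ v : B,
      {u : HeightOneSpectrum (𝓞 N) // primeBelow u = v.1} => x.2.1) h)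
  exact this

/-- Given `g` in the Galois group of a finite Galois extension `M/K`, there is a prime `w` of `M`,
unramified over `K` and outside a given finite set, such that `g` is a power of every Frobenius
element at `w`. -/
theorem exists_prime_frobenius_pow {K M : Type*} [Field K] [NumberField K] [Field M]
    [NumberField M] [Algebra K M] [IsGalois K M] (g : Gal(M/K))
    {S : Set (HeightOneSpectrum (𝓞 K))} (hS : S.Finite) :
    ∃ w : HeightOneSpectrum (𝓞 M), primeBelow w ∉ S ∧
      ∀ φ : Gal(M/K), IsArithFrobAt (𝓞 K) φ w.asIdeal → ∃ i : ℕ, φ ^ i = g := by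
  set H : Subgroup Gal(M/K) := Subgroup.zpowers g with hH
  set N := subgroupField H with hN
  have : IsGalois N M := inferInstance
  let e : Gal(M/N) ≃* H := IsGaloisGroup.mulEquivCongr Gal(M/N) H N M
  have he : ∀ (a : Gal(M/N)) (x : M), e a • x = a • x := fun a x =>
    IsGaloisGroup.mulEquivCongr_apply_smul Gal(M/N) H N M a x
  have : IsCyclic Gal(M/N) := isCyclic_of_surjective e.symm e.symm.surjective
  obtain ⟨w, hwT, hwp, hst⟩ := exists_inert_prime (N := N) (M := M)
    (finite_primeBelow_mem (N := N) (hS.union (finite_ramifiedPrimes (N := K) (M := M))))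
  have hbb : primeBelow (N := K) (primeBelow (N := N) w) = primeBelow w := by
    have : w.asIdeal.LiesOver (primeBelow (N := K) (primeBelow (N := N) w)).asIdeal :=
      Ideal.LiesOver.trans _ (primeBelow (N := N) w).asIdeal _
    exact HeightOneSpectrum.ext this.over
  rw [Set.mem_ofPred_eq, hbb] at hwT
  refine ⟨w, fun h => hwT (Or.inl h), fun φ hφ => ?_⟩
  have hin : w.asIdeal.inertia Gal(M/K) = ⊥ := by
    by_contra h
    exact hwT (Or.inr ⟨w, h, rfl⟩)
  have := finite_quotient_asIdeal w
  have hinN : w.asIdeal.inertia Gal(M/N) = ⊥ := by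
    rw [eq_bot_iff]
    intro a ha
    have h1 : ((e a : H) : Gal(M/K)) ∈ w.asIdeal.inertia Gal(M/K) := fun x => by
      have h2 : ((e a : H) : Gal(M/K)) • x = a • x :=
        NumberField.RingOfIntegers.ext (he a (x : M))
      rw [h2]
      exact ha x
    rw [hin, Subgroup.mem_bot, OneMemClass.coe_eq_one] at h1
    rw [Subgroup.mem_bot]
    exact (map_eq_one_iff e e.injective).1 h1
  obtain ⟨σ, hσ⟩ := IsArithFrobAt.exists_of_isInvariant (𝓞 N) Gal(M/N) w.asIdeal
  -- The prime of `N` has absolute degree one, so it has the same residue field as the prime of `K`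
  -- below it; a Frobenius element over `N` is then one over `K`.
  have hcard : Nat.card (𝓞 N ⧸ w.asIdeal.under (𝓞 N)) = Nat.card (𝓞 K ⧸ w.asIdeal.under (𝓞 K)) := by
    have h1 := (prime_absNorm_iff (N := K) (primeBelow (N := N) w)).1 hwp
    have h2 := absNorm_primeBelow_pow (N := K) (primeBelow (N := N) w)
    rw [h1.2, pow_one, hbb] at h2
    exact h2.symm
  have hσK : IsArithFrobAt (𝓞 K) ((e σ : H) : Gal(M/K)) w.asIdeal := by
    intro x
    have h2 : ((e σ : H) : Gal(M/K)) • x = σ • x :=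
      NumberField.RingOfIntegers.ext (he σ (x : M))
    change ((e σ : H) : Gal(M/K)) • x - _ ∈ _
    rw [← hcard, h2]
    exact hσ x
  have hφσ : φ = (e σ : H) := by
    have h1 := hφ.mul_inv_mem_inertia hσK
    rw [hin, Subgroup.mem_bot, mul_inv_eq_one] at h1
    exact h1
  have hcardH : Nat.card Gal(M/N) = w.asIdeal.inertiaDeg (𝓞 N) := by
    rw [← card_stabilizer_eq_inertiaDeg Gal(M/N) (primeBelow (N := N) w) w.asIdeal hinN, hst,
      Subgroup.card_top]
  have hord : orderOf σ = Nat.card Gal(M/N) := by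
    refine le_antisymm (orderOf_le_card) ?_
    rw [hcardH]
    exact inertiaDeg_le_of_pow_eq_one w hσ (orderOf_pos σ) (pow_orderOf_eq_one σ)
  have hgen : Subgroup.zpowers σ = ⊤ := by
    apply Subgroup.eq_top_of_card_eq
    rw [Nat.card_zpowers, hord]
  have hg : e.symm ⟨g, Subgroup.mem_zpowers g⟩ ∈ Subgroup.zpowers σ := by
    rw [hgen]; exact Subgroup.mem_top _
  rw [← mem_powers_iff_mem_zpowers] at hg
  obtain ⟨i, hi⟩ := hg
  refine ⟨i, ?_⟩
  have h5 : (e σ) ^ i = ⟨g, Subgroup.mem_zpowers g⟩ := by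
    rw [← map_pow]
    exact (congrArg e hi).trans (e.apply_symm_apply _)
  rw [hφσ]
  exact congrArg Subtype.val h5

/-- A closed set of `G_K` which is stable under powers and contains the Frobenius elements outside
a finite set of primes is the whole group. -/
theorem mem_of_isClosed_of_frobenius (S : Finset (HeightOneSpectrum (𝓞 K))) {Z : Set (AbsGal K)}
    (hZ : IsClosed Z) (hpow : ∀ g ∈ Z, ∀ i : ℕ, g ^ i ∈ Z)
    (hfrob : ∀ v ∉ S, ∀ P : Ideal (IntBar K), P.IsPrime → P.under (𝓞 K) = v.asIdeal →
      ∀ φ : AbsGal K, IsArithFrobAt (𝓞 K) φ P → φ ∈ Z) (g : AbsGal K) : g ∈ Z := by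
  rw [← hZ.closure_eq, mem_closure_iff_nhds]
  intro U hU
  have hU1 : (fun x => g * x) ⁻¹' U ∈ 𝓝 (1 : AbsGal K) := by
    refine (continuous_const_mul g).continuousAt.preimage_mem_nhds ?_
    simpa using hU
  obtain ⟨M, hfd, hnorm, hMU⟩ := (krullTopology_mem_nhds_one_iff_of_normal K
    (AlgebraicClosure K) _).1 hU1
  have : NumberField M := NumberField.of_module_finite K M
  have : IsGalois K M := ⟨⟩
  -- A neighbourhood of `g` contains all elements with the same restriction to some finite normal
  -- `M`, so it suffices that some power of a Frobenius element agrees with `g` on `M`.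
  obtain ⟨w, hwS, hw⟩ := exists_prime_frobenius_pow (K := K) (M := M)
    (AlgEquiv.restrictNormalHom M g) S.finite_toSet
  have hwp := w.isPrime
  obtain ⟨P, hP, hPw⟩ := exists_comap_ringOfIntegersToIntBar M w.asIdeal
  have hPv : P.under (𝓞 K) = (primeBelow (N := K) w).asIdeal := by
    change _ = w.asIdeal.comap _
    rw [← hPw, Ideal.comap_comap]
    rfl
  obtain ⟨φ, hφ⟩ := exists_isArithFrobAt_absGal P _ hPv
  have hφM : IsArithFrobAt (𝓞 K) (AlgEquiv.restrictNormalHom M φ) w.asIdeal := by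
    intro x
    have h1 := hφ (ringOfIntegersToIntBar M x)
    have h2 : w.asIdeal.under (𝓞 K) = P.under (𝓞 K) := hPv.symm
    rw [h2, ← hPw, Ideal.mem_comap, map_sub, map_pow]
    convert h1 using 2
    apply Subtype.ext
    exact AlgEquiv.restrictNormal_commutes φ M (x : M)
  obtain ⟨i, hi⟩ := hw _ hφM
  refine ⟨φ ^ i, ?_, hpow φ (hfrob _ (by simpa using hwS) P hP hPv φ hφ) i⟩
  have h3 : g⁻¹ * φ ^ i ∈ M.fixingSubgroup := by
    rw [← IntermediateField.restrictNormalHom_ker M, MonoidHom.mem_ker, map_mul, map_inv, map_pow,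
      hi, inv_mul_cancel]
  have h4 := hMU h3
  simpa using h4

end FrobeniusDensity

/-! ### The Lie algebra `sl_n` is perfect and simple -/

section TraceZero

variable {ι k : Type*} [Fintype ι] [DecidableEq ι] [Field k] [CharZero k]

omit [CharZero k] in
theorem mem_of_trace_eq_zero {N : Submodule k (Matrix ι ι k)}
    (h1 : ∀ i j, i ≠ j → single i j (1 : k) ∈ N)
    (h2 : ∀ i j, i ≠ j → single i i (1 : k) - single j j 1 ∈ N) {x : Matrix ι ι k}
    (hx : x.trace = 0) : x ∈ N := by
  cases isEmpty_or_nonempty ι with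
  | inl h => rw [Subsingleton.elim x 0]; exact N.zero_mem
  | inr h =>
    obtain ⟨o⟩ := h
    -- The subtracted diagonal terms add up to `tr(x) E_oo = 0`.
    have key : x = ∑ i, ∑ j, x i j • (single i j (1 : k) - if i = j then single o o 1 else 0) := by
      simp only [smul_sub, Finset.sum_sub_distrib, smul_single, smul_eq_mul, mul_one, smul_ite,
        smul_zero, Finset.sum_ite_eq, Finset.mem_univ, if_true]
      rw [← matrix_eq_sum_single]
      have h0 : ∑ i, single o o (x i i) = single o o (∑ i, x i i) :=
        (map_sum (singleAddMonoidHom (α := k) o o) _ _).symm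
      rw [h0]
      change _ = _ - single o o x.trace
      rw [hx, single_zero, sub_zero]
    rw [key]
    refine N.sum_mem fun i _ => N.sum_mem fun j _ => N.smul_mem _ ?_
    by_cases hij : i = j
    · subst hij
      rw [if_pos rfl]
      by_cases hio : i = o
      · subst hio; rw [sub_self]; exact N.zero_mem
      · exact h2 i o hio
    · rw [if_neg hij, sub_zero]
      exact h1 i j hij

/-- `sl_n` is perfect. -/
theorem mem_of_bracket_mem {N : Submodule k (Matrix ι ι k)}
    (h : ∀ x y : Matrix ι ι k, x.trace = 0 → y.trace = 0 → x * y - y * x ∈ N) {x : Matrix ι ι k}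
    (hx : x.trace = 0) : x ∈ N := by
  refine mem_of_trace_eq_zero (fun i j hij => ?_) (fun i j hij => ?_) hx
  · have h3 := h (single i i 1 - single j j 1) (single i j 1)
      (by simp) (by simp [hij])
    have h4 : (single i i 1 - single j j 1) * single i j 1 - single i j 1 *
        (single i i 1 - single j j 1) = (2 : k) • single i j (1 : k) := by
      simp [sub_mul, mul_sub, single_mul_single_same, hij.symm, two_smul, ← single_add]
    rw [h4] at h3
    have := N.smul_mem (2⁻¹ : k) h3
    rwa [smul_smul, inv_mul_cancel₀ two_ne_zero, one_smul] at this
  · have h3 := h (single i j 1) (single j i 1) (by simp [hij]) (by simp [hij.symm])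
    simpa using h3

/-- `sl_n` is simple. -/
theorem eq_bot_or_mem_of_ideal {N : Submodule k (Matrix ι ι k)}
    (htr : ∀ x ∈ N, x.trace = 0)
    (h : ∀ x y : Matrix ι ι k, x.trace = 0 → y ∈ N → x * y - y * x ∈ N) :
    N = ⊥ ∨ ∀ x : Matrix ι ι k, x.trace = 0 → x ∈ N := by
  by_cases hN : N = ⊥
  · exact Or.inl hN
  right
  obtain ⟨x, hxN, hx0⟩ := (Submodule.ne_bot_iff N).1 hN
  have single_step : ∀ a b, a ≠ b → ∀ c : k, c ≠ 0 → single a b c ∈ N → single a b (1 : k) ∈ N := by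
    intro a b _ c hc hm
    have := N.smul_mem c⁻¹ hm
    rwa [smul_single, smul_eq_mul, inv_mul_cancel₀ hc] at this
  obtain ⟨a, b, hab, hE⟩ : ∃ a b, a ≠ b ∧ single a b (1 : k) ∈ N := by
    -- A nonzero entry `x_ij` off the diagonal is isolated by `[E_ji, [E_ji, x]] = -2 x_ij E_ji`. A
    -- nonzero diagonal `x` of trace zero has two distinct entries in characteristic zero, and then
    -- `[E_ij, x]` is a nonzero multiple of `E_ij`.
    by_cases hoff : ∃ i j, i ≠ j ∧ x i j ≠ 0
    · obtain ⟨i, j, hij, hne⟩ := hoff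
      refine ⟨j, i, hij.symm, single_step j i hij.symm (-2 * x i j)
        (mul_ne_zero (by norm_num) hne) ?_⟩
      have h3 := h _ _ (by simp [hij.symm] : (single j i (1 : k)).trace = 0)
        (h _ _ (by simp [hij.symm] : (single j i (1 : k)).trace = 0) hxN)
      convert h3 using 1
      have h4 : single j i (1 : k) * single j i 1 = 0 := by simp [hij]
      have h5 : single j i (1 : k) * x * single j i 1 = single j i (x i j) := by
        simp [single_mul_mul_single]
      have h6 : single j i (-2 * x i j) = (-2 : k) • single j i (x i j) := by
        rw [smul_single, smul_eq_mul]
      rw [h6, ← h5]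
      simp only [mul_sub, sub_mul, ← mul_assoc, h4, zero_mul]
      rw [mul_assoc x, h4, mul_zero, neg_smul, two_smul]
      abel
    · push Not at hoff
      have hdiag : ∃ i j, x i i ≠ x j j := by
        by_contra hcon
        push Not at hcon
        cases isEmpty_or_nonempty ι with
        | inl he => exact hx0 (Subsingleton.elim _ _)
        | inr he =>
          obtain ⟨o⟩ := he
          have ht := htr x hxN
          rw [trace, Finset.sum_congr rfl fun i _ => (show x.diag i = x o o from hcon i o),
            Finset.sum_const, nsmul_eq_mul] at ht
          have h0 : x o o = 0 := by
            refine (mul_eq_zero.1 ht).resolve_left ?_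
            rw [Finset.card_univ]
            exact Nat.cast_ne_zero.2 (Fintype.card_pos_iff.2 ⟨o⟩).ne'
          apply hx0
          ext i j
          by_cases hij : i = j
          · subst hij; rw [hcon i o, h0]; rfl
          · exact hoff i j hij
      obtain ⟨i, j, hne⟩ := hdiag
      have hij : i ≠ j := fun e => hne (by rw [e])
      refine ⟨i, j, hij, single_step i j hij (x j j - x i i) (sub_ne_zero.2 hne.symm) ?_⟩
      have h3 := h _ _ (by simp [hij] : (single i j (1 : k)).trace = 0) hxN
      convert h3 using 1
      obtain ⟨d, rfl⟩ : ∃ d, x = diagonal d := by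
        refine ⟨x.diag, ?_⟩
        ext a b
        by_cases hab : a = b
        · subst hab; simp
        · rw [hoff a b hab, diagonal_apply_ne _ hab]
      ext a b
      simp only [Matrix.sub_apply, mul_diagonal, diagonal_mul, single_apply, diagonal_apply_eq]
      by_cases h7 : i = a ∧ j = b
      · obtain ⟨rfl, rfl⟩ := h7
        simp
      · simp [h7]
  have left : ∀ a b c, a ≠ b → c ≠ b → single a b (1 : k) ∈ N → single c b (1 : k) ∈ N := by
    intro a b c hab hcb hm
    by_cases hca : c = a
    · rwa [hca]
    have := h (single c a 1) _ (by simp [hca]) hm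
    simpa [hcb.symm] using this
  have right : ∀ a b d, a ≠ b → a ≠ d → single a b (1 : k) ∈ N → single a d (1 : k) ∈ N := by
    intro a b d hab had hm
    by_cases hdb : d = b
    · rwa [hdb]
    have := N.neg_mem (h (single b d 1) _ (by simp [Ne.symm hdb]) hm)
    simpa [had.symm] using this
  have flip : ∀ a b, a ≠ b → single a b (1 : k) ∈ N → single b a (1 : k) ∈ N := by
    intro a b hab hm
    have ht : (single b a (1 : k)).trace = 0 := by simp [hab.symm]
    have := h _ _ ht (h _ _ ht hm)
    refine single_step b a hab.symm (-2) (by norm_num) ?_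
    convert this using 1
    have h2 : single b a (-2 : k) = -single b a 1 - single b a 1 := by
      rw [sub_eq_add_neg, single_neg, ← single_add]
      norm_num
    rw [h2]
    simp [mul_sub, sub_mul, hab]
  have all : ∀ c d, c ≠ d → single c d (1 : k) ∈ N := by
    intro c d hcd
    by_cases hcb : c = b
    · subst hcb
      exact right _ _ _ hab.symm hcd (flip _ _ hab hE)
    · exact right _ _ _ hcb hcd (left _ _ _ hab hcb hE)
  intro y hy
  refine mem_of_trace_eq_zero all (fun i j hij => ?_) hy
  have := h (single i j 1) _ (by simp [hij]) (all j i hij.symm)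
  simpa using this

end TraceZero

/-! ### Spaces of matrices of rank one, and extremal elements -/

section RankOne

variable {ι k : Type*} [Fintype ι] [DecidableEq ι] [Field k]

omit [Fintype ι] [DecidableEq ι] in
-- Since the columns `a` and `c` are independent, eliminating `a` between two rows of the identity
-- shows that `d` is a multiple of `f`; then so is `b`, with a nonzero factor because `b ≠ 0`.
theorem exists_eq_smul_of_vecMulVec_add {a b c d e f : ι → k} (ha : a ≠ 0) (hb : b ≠ 0)
    (hc : ∀ s : k, c ≠ s • a) (h : vecMulVec a b + vecMulVec c d = vecMulVec e f) :
    ∃ s : k, d = s • b := by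
  obtain ⟨i, hi⟩ := Function.ne_iff.1 ha
  obtain ⟨l, hl⟩ := Function.ne_iff.1 (hc (c i / a i))
  have hrow : ∀ r s, a r * b s + c r * d s = e r * f s := fun r s => by
    simpa [vecMulVec_apply] using congrFun (congrFun h r) s
  simp only [Pi.zero_apply, Pi.smul_apply, smul_eq_mul] at hi hl
  set u := c l - c i / a i * a l with hu
  have hu0 : u ≠ 0 := sub_ne_zero.2 hl
  have hd : ∀ s, d s = (e l - a l / a i * e i) / u * f s := by
    intro s
    have h1 := hrow i s
    have h2 := hrow l s
    have h3 : u * d s = (e l - a l / a i * e i) * f s := by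
      have h4 : (e l - a l / a i * e i) * f s = e l * f s - a l / a i * (e i * f s) := by ring
      rw [h4, ← h1, ← h2, hu]
      field_simp
      ring
    rw [div_mul_eq_mul_div, ← h3, mul_div_cancel_left₀ _ hu0]
  set s1 := (e l - a l / a i * e i) / u
  have hbf : ∀ s, a i * b s = (e i - c i * s1) * f s := by
    intro s
    have h1 := hrow i s
    rw [hd s] at h1
    linear_combination h1
  have ht : e i - c i * s1 ≠ 0 := by
    intro h0
    apply hb
    funext s
    have := hbf s
    rw [h0, zero_mul] at this
    exact (mul_eq_zero.1 this).resolve_left hi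
  refine ⟨s1 * (a i / (e i - c i * s1)), funext fun s => ?_⟩
  have h5 : f s = a i / (e i - c i * s1) * b s := by
    rw [div_mul_eq_mul_div, hbf s, mul_div_cancel_left₀ _ ht]
  rw [hd s, h5, Pi.smul_apply, smul_eq_mul, mul_assoc]

omit [Fintype ι] [DecidableEq ι] in
/-- A linear space of matrices of rank at most one has a common column or a common row. -/
theorem exists_common_vec {V : Type*} [AddCommGroup V] [Module k V] (ψ : V →ₗ[k] Matrix ι ι k)
    (h : ∀ f, ∃ a b, ψ f = vecMulVec a b) :
    (∃ a, ∀ f, ∃ b, ψ f = vecMulVec a b) ∨ (∃ b, ∀ f, ∃ a, ψ f = vecMulVec a b) := by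
  by_cases h0 : ∀ f, ψ f = 0
  · exact Or.inl ⟨0, fun f => ⟨0, by rw [h0 f, zero_vecMulVec]⟩⟩
  push Not at h0
  obtain ⟨f0, hf0⟩ := h0
  obtain ⟨a0, b0, h00⟩ := h f0
  rw [h00] at hf0
  have ha0 : a0 ≠ 0 := fun e => hf0 (by rw [e, zero_vecMulVec])
  have hb0 : b0 ≠ 0 := fun e => hf0 (by rw [e, vecMulVec_zero])
  by_contra hcon
  push Not at hcon
  -- The image of `f1` has a column not proportional to `a0`, hence its row is proportional to `b0`;
  -- the image of `f2` has a row not proportional to `b0`, hence its column is proportional to `a0`.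
  -- Then `f2 + f1` has independent columns and independent rows, which rank one excludes.
  obtain ⟨⟨f1, hf1⟩, ⟨f2, hf2⟩⟩ := And.intro (hcon.1 a0) (hcon.2 b0)
  obtain ⟨a1, b1, h11⟩ := h f1
  obtain ⟨a2, b2, h22⟩ := h f2
  have ha1 : ∀ s : k, a1 ≠ s • a0 := fun s e =>
    hf1 (s • b1) (by rw [h11, e, smul_vecMulVec, vecMulVec_smul])
  have hb2 : ∀ s : k, b2 ≠ s • b0 := fun s e =>
    hf2 (s • a2) (by rw [h22, e, smul_vecMulVec, vecMulVec_smul])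
  obtain ⟨s, hs⟩ : ∃ s : k, b1 = s • b0 := by
    obtain ⟨e, f, hef⟩ := h (f0 + f1)
    rw [map_add, h00, h11] at hef
    exact exists_eq_smul_of_vecMulVec_add ha0 hb0 ha1 hef
  obtain ⟨t, ht⟩ : ∃ t : k, a2 = t • a0 := by
    obtain ⟨e, f, hef⟩ := h (f0 + f2)
    rw [map_add, h00, h22] at hef
    have := congrArg transpose hef
    rw [transpose_add, transpose_vecMulVec, transpose_vecMulVec, transpose_vecMulVec] at this
    exact exists_eq_smul_of_vecMulVec_add hb0 ha0 hb2 this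
  have hs0 : s ≠ 0 := by
    rintro rfl
    exact hf1 0 (by rw [h11, hs, zero_smul, vecMulVec_zero, vecMulVec_zero])
  have ht0 : t ≠ 0 := by
    rintro rfl
    exact hf2 0 (by rw [h22, ht, zero_smul, zero_vecMulVec, zero_vecMulVec])
  have hb20 : b2 ≠ 0 := fun e => hb2 0 (by rw [e, zero_smul])
  obtain ⟨r, hr⟩ : ∃ r : k, s • b0 = r • (t • b2) := by
    obtain ⟨e, f, hef⟩ := h (f2 + f1)
    rw [map_add, h11, h22, hs, ht, smul_vecMulVec, ← vecMulVec_smul] at hef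
    exact exists_eq_smul_of_vecMulVec_add ha0 (smul_ne_zero ht0 hb20) ha1 hef
  have hr0 : r ≠ 0 := by
    rintro rfl
    rw [zero_smul] at hr
    exact smul_ne_zero hs0 hb0 hr
  apply hb2 ((r * t)⁻¹ * s)
  rw [mul_smul, hr, smul_smul, smul_smul, mul_assoc, inv_mul_cancel₀ (mul_ne_zero hr0 ht0), one_smul]

theorem eq_zero_of_forall_vecMul {x : Matrix ι ι k} (h : ∀ w : ι → k, w ᵥ* x = 0) : x = 0 := by
  ext i j
  have := congrFun (h (Pi.single i 1)) j
  simpa using this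

theorem exists_mulVec_ne_zero {x : Matrix ι ι k} (h : x ≠ 0) : ∃ w : ι → k, x *ᵥ w ≠ 0 := by
  by_contra hcon
  push Not at hcon
  apply h
  ext i j
  have := congrFun (hcon (Pi.single j 1)) i
  simpa using this

theorem exists_vecMul_ne_zero {x : Matrix ι ι k} (h : x ≠ 0) : ∃ w : ι → k, w ᵥ* x ≠ 0 := by
  by_contra hcon
  push Not at hcon
  exact h (eq_zero_of_forall_vecMul hcon)

/-- An extremal element of `sl_n` has rank one. -/
theorem exists_eq_vecMulVec_of_extremal [CharZero k] [IsAlgClosed k] {x : Matrix ι ι k}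
    (htr : x.trace = 0) (hx : x ≠ 0)
    (h : ∀ y : Matrix ι ι k, ∃ c : k, x * (x * y - y * x) - (x * y - y * x) * x = c • x) :
    ∃ a b, x = vecMulVec a b ∧ b ⬝ᵥ a = 0 := by
  suffices hs : ∃ a b, ∃ c : k, vecMulVec a b ≠ 0 ∧ vecMulVec a b = c • x by
    obtain ⟨a, b, c, hne, hab⟩ := hs
    have hc : c ≠ 0 := by rintro rfl; exact hne (by rw [hab, zero_smul])
    have hx' : x = vecMulVec a (c⁻¹ • b) := by
      rw [vecMulVec_smul, hab, smul_smul, inv_mul_cancel₀ hc, one_smul]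
    refine ⟨a, c⁻¹ • b, hx', ?_⟩
    rw [hx', trace_vecMulVec, dotProduct_comm] at htr
    exact htr
  have hne : Nonempty ι := by
    by_contra hcon
    rw [not_nonempty_iff] at hcon
    exact hx (Subsingleton.elim _ _)
  obtain ⟨μ, hμ⟩ := Module.End.exists_eigenvalue (toLin' x)
  obtain ⟨v, hv⟩ := hμ.exists_hasEigenvector
  have hxv : x *ᵥ v = μ • v := by simpa using hv.apply_eq_smul
  have hv0 : v ≠ 0 := hv.2
  -- For an eigenvector `v` one has `ad(x)²(v wᵀ) = v (wᵀ Z)`, which gives a rank one multiple of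
  -- `x` unless `Z = 0`. If `Z = 0`, then `x - μ` is nilpotent, so `μ = 0` by the trace and `x² =
  -- 0`; in this case `ad(x)² y = -2xyx`, which has rank one for suitable `y` of rank one.
  set Z := (x - μ • (1 : Matrix ι ι k)) * (x - μ • (1 : Matrix ι ι k)) with hZ
  by_cases hw : ∃ w, w ᵥ* Z ≠ 0
  · obtain ⟨w, hw⟩ := hw
    obtain ⟨c, hc⟩ := h (vecMulVec v w)
    refine ⟨v, w ᵥ* Z, c, by simp [hv0, hw], ?_⟩
    rw [← hc, ← vecMulVec_mul, hZ]
    have h1 : x * vecMulVec v w = μ • vecMulVec v w := by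
      rw [mul_vecMulVec, hxv, smul_vecMulVec]
    simp only [mul_sub, sub_mul, ← mul_assoc, h1, smul_mul_assoc, mul_smul_comm, mul_one, one_mul,
      smul_sub]
    abel
  · push Not at hw
    have hZ0 : Z = 0 := eq_zero_of_forall_vecMul hw
    have hnil : IsNilpotent (x - μ • (1 : Matrix ι ι k)) := ⟨2, by rw [pow_two, ← hZ, hZ0]⟩
    have h1 := (Matrix.isNilpotent_trace_of_isNilpotent hnil).eq_zero
    rw [trace_sub, htr, trace_smul, trace_one, zero_sub, neg_eq_zero, smul_eq_mul,
      mul_eq_zero] at h1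
    have hμ0 : μ = 0 := h1.resolve_right (Nat.cast_ne_zero.2 Fintype.card_ne_zero)
    rw [hZ, hμ0, zero_smul, sub_zero] at hZ0
    obtain ⟨v', hv'⟩ := exists_mulVec_ne_zero hx
    obtain ⟨w', hw'⟩ := exists_vecMul_ne_zero hx
    obtain ⟨c, hc⟩ := h (vecMulVec v' w')
    refine ⟨x *ᵥ v', w' ᵥ* x, (-2)⁻¹ * c, by simp [hv', hw'], ?_⟩
    rw [mul_smul, ← hc, ← vecMulVec_mul, ← mul_vecMulVec]
    have h2 : x * (x * vecMulVec v' w' - vecMulVec v' w' * x) -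
        (x * vecMulVec v' w' - vecMulVec v' w' * x) * x =
        (-2 : k) • (x * vecMulVec v' w' * x) := by
      rw [mul_sub, sub_mul, ← mul_assoc x x, hZ0, mul_assoc _ x x, hZ0, mul_zero, zero_mul,
        ← mul_assoc, neg_smul, two_smul]
      abel
    rw [h2, smul_smul, inv_mul_cancel₀ (by norm_num), one_smul]

end RankOne

/-! ### Automorphisms of `sl_n` -/

section Automorphisms

variable {ι k : Type*} [Fintype ι] [DecidableEq ι] [Field k] [CharZero k]

/-- A square-zero `Y = a bᵀ` satisfies `YxY = (bᵀxa) Y`, so `ad(Y)²` has values in the line of `Y`.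
This extremality is preserved by `φ`, and extremal elements have rank one. -/
theorem exists_eq_vecMulVec_of_bracketHom [IsAlgClosed k]
    (φ : Matrix ι ι k →ₗ[k] Matrix ι ι k) (htr : ∀ x, (φ x).trace = 0)
    (hbr : ∀ x y, φ (x * y - y * x) = φ x * φ y - φ y * φ x)
    (hsurj : ∀ y : Matrix ι ι k, y.trace = 0 → ∃ x, φ x = y) {a b : ι → k} (hab : b ⬝ᵥ a = 0) :
    ∃ c d, φ (vecMulVec a b) = vecMulVec c d ∧ d ⬝ᵥ c = 0 := by
  by_cases h0 : φ (vecMulVec a b) = 0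
  · exact ⟨0, 0, by rw [h0, vecMulVec_zero], by simp⟩
  refine exists_eq_vecMulVec_of_extremal (htr _) h0 fun y => ?_
  set Y := vecMulVec a b with hY
  have hYY : Y * Y = 0 := by rw [hY, vecMulVec_mul_vecMulVec, hab, zero_smul, vecMulVec_zero]
  cases isEmpty_or_nonempty ι with
  | inl h => exact ⟨0, Subsingleton.elim _ _⟩
  | inr h =>
    obtain ⟨x, hx⟩ := hsurj (y - (y.trace / Fintype.card ι) • (1 : Matrix ι ι k)) (by
      rw [trace_sub, trace_smul, trace_one, smul_eq_mul,
        div_mul_cancel₀ _ (Nat.cast_ne_zero.2 Fintype.card_ne_zero), sub_self])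
    have hy : y = φ x + (y.trace / Fintype.card ι) • (1 : Matrix ι ι k) := by rw [hx]; abel
    have h1 : φ Y * y - y * φ Y = φ (Y * x - x * Y) := by
      rw [hbr]
      nth_rewrite 1 [hy]
      nth_rewrite 2 [hy]
      rw [mul_add, add_mul, mul_smul_comm, smul_mul_assoc, mul_one, one_mul]
      abel
    have h2 : Y * (Y * x - x * Y) - (Y * x - x * Y) * Y = (-2 * (b ⬝ᵥ (x *ᵥ a))) • Y := by
      have h3 : Y * x * Y = (b ⬝ᵥ (x *ᵥ a)) • Y := by
        rw [hY, mul_assoc, mul_vecMulVec, vecMulVec_mul_vecMulVec, vecMulVec_smul]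
      rw [mul_sub, sub_mul, ← mul_assoc Y Y, hYY, mul_assoc _ Y Y, hYY, mul_zero, zero_mul,
        ← mul_assoc, h3, mul_smul, neg_smul, two_smul]
      abel
    refine ⟨-2 * (b ⬝ᵥ (x *ᵥ a)), ?_⟩
    rw [h1, ← hbr, h2, map_smul]

/-- A conjugation by `A` sends `E_oj` to the column `o` of `A` times the row `j` of `A⁻¹`. The
matrices `A` and `W = A⁻¹` are therefore read off from the images of the `E_oj` and of the `E_io`,
and these elements generate `sl_n` as a Lie algebra. -/
theorem exists_conj_of_common_column [IsAlgClosed k]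
    (φ : Matrix ι ι k →ₗ[k] Matrix ι ι k) (htr : ∀ x, (φ x).trace = 0)
    (hbr : ∀ x y, φ (x * y - y * x) = φ x * φ y - φ y * φ x)
    (hsurj : ∀ y : Matrix ι ι k, y.trace = 0 → ∃ x, φ x = y)
    (hinj : ∀ x : Matrix ι ι k, x.trace = 0 → φ x = 0 → x = 0) {o o' : ι} (hoo : o' ≠ o)
    {v : ι → k} (hv : ∀ j, j ≠ o → ∃ w, φ (single o j 1) = vecMulVec v w) :
    ∃ P Q : Matrix ι ι k, P * Q = 1 ∧ ∀ x : Matrix ι ι k, x.trace = 0 → φ x = P * x * Q := by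
  choose! w hw using hv
  have hab : ∀ i, i ≠ o → ∃ a b, φ (single i o 1) = vecMulVec a b ∧ b ⬝ᵥ a = 0 := by
    intro i hi
    rw [single_eq_single_vecMulVec_single]
    exact exists_eq_vecMulVec_of_bracketHom φ htr hbr hsurj (by simp [hi.symm])
  choose! a b hab hba using hab
  have hwv : ∀ j, j ≠ o → w j ⬝ᵥ v = 0 := by
    intro j hj
    have := htr (single o j 1)
    rwa [hw j hj, trace_vecMulVec, dotProduct_comm] at this
  have hne : ∀ j, j ≠ o → vecMulVec v (w j) ≠ 0 := by
    intro j hj h0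
    have := hinj (single o j 1) (by simp [hj.symm]) (by rw [hw j hj, h0])
    have := congrFun (congrFun this o) j
    simp at this
  -- This is the image under `φ` of `[[E_oj, E_io], E_oj] = 2δ_ij E_oj`.
  have hdual : ∀ i j, i ≠ o → j ≠ o → (b i ⬝ᵥ v) * (w j ⬝ᵥ a i) = if j = i then 1 else 0 := by
    intro i j hi hj
    have h1 : φ ((single o j 1 * single i o 1 - single i o 1 * single o j 1) * single o j 1 -
        single o j 1 * (single o j 1 * single i o 1 - single i o 1 * single o j 1)) =
        (2 * ((b i ⬝ᵥ v) * (w j ⬝ᵥ a i))) • vecMulVec v (w j) := by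
      rw [hbr, hbr, hw j hj, hab i hi]
      simp only [vecMulVec_mul_vecMulVec, sub_mul, mul_sub, vecMulVec_smul, smul_mul_assoc,
        mul_smul_comm, smul_smul, hwv j hj, zero_smul, vecMulVec_zero, smul_zero]
      rw [sub_zero, zero_sub, sub_neg_eq_add, ← add_smul]
      congr 1
      ring
    have h2 : (single o j (1 : k) * single i o 1 - single i o 1 * single o j 1) * single o j 1 -
        single o j 1 * (single o j 1 * single i o 1 - single i o 1 * single o j 1) =
        (2 * if j = i then 1 else 0 : k) • single o j (1 : k) := by
      by_cases hij : j = i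
      · subst hij
        simp only [if_true, mul_one, two_smul]
        simp [sub_mul, mul_sub, hj]
      · simp [hij, hj]
    rw [h2, map_smul, hw j hj] at h1
    have h3 := smul_left_injective k (hne j hj) h1
    exact (mul_left_cancel₀ two_ne_zero h3).symm
  have hbv : ∀ i, i ≠ o → b i ⬝ᵥ v ≠ 0 := by
    intro i hi h0
    have := hdual i i hi hi
    rw [h0, zero_mul, if_pos rfl] at this
    exact zero_ne_one this
  -- For `i ≠ j` the elements `E_io` and `E_jo` commute; pairing the resulting relation with `w i`
  -- isolates `b i ⬝ᵥ a j`.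
  have hbiaj : ∀ i j, i ≠ o → j ≠ o → b i ⬝ᵥ a j = 0 := by
    intro i j hi hj
    by_cases hij : i = j
    · subst hij; exact hba i hi
    have h1 := hbr (single i o 1) (single j o 1)
    have h2 : single i o (1 : k) * single j o 1 - single j o 1 * single i o 1 = 0 := by
      simp [hi.symm, hj.symm]
    rw [h2, map_zero, hab i hi, hab j hj, vecMulVec_mul_vecMulVec, vecMulVec_mul_vecMulVec,
      eq_comm, sub_eq_zero] at h1
    have h3 := congrArg (fun M => w i ᵥ* M) h1
    simp only [vecMul_vecMulVec, smul_smul] at h3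
    have h4 : w i ⬝ᵥ a j = 0 := by
      have := hdual j i hj hi
      rw [if_neg hij] at this
      exact (mul_eq_zero.1 this).resolve_left (hbv j hj)
    have h5 : w i ⬝ᵥ a i ≠ 0 := by
      intro h0
      have := hdual i i hi hi
      rw [h0, mul_zero, if_pos rfl] at this
      exact zero_ne_one this
    rw [h4, zero_mul, zero_smul, smul_eq_zero, mul_eq_zero] at h3
    rcases h3 with h3 | h3
    · exact h3.resolve_left h5
    · exact absurd (by rw [h3, zero_dotProduct]) (hbv j hj)
  let A : Matrix ι ι k := of fun r c => if c = o then v r else (b c ⬝ᵥ v) * a c r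
  -- All the `b i` turn out to be proportional, so any index `o' ≠ o` may be used to normalise the
  -- row `o` of the inverse.
  let W : Matrix ι ι k := of fun r c => if r = o then (b o' ⬝ᵥ v)⁻¹ * b o' c else w r c
  have hAcol : ∀ c, c ≠ o → A.col c = (b c ⬝ᵥ v) • a c := by
    intro c hc; funext r; simp [A, hc]
  have hAo : A.col o = v := by funext r; simp [A]
  have hWrow : ∀ r, r ≠ o → W.row r = w r := by
    intro r hr; funext c; simp [W, hr]
  have hWo : W.row o = (b o' ⬝ᵥ v)⁻¹ • b o' := by funext c; simp [W]
  have hWA : W * A = 1 := by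
    ext r c
    change W.row r ⬝ᵥ A.col c = _
    by_cases hr : r = o <;> by_cases hc : c = o
    · subst hr; subst hc
      rw [hWo, hAo, smul_dotProduct, smul_eq_mul, inv_mul_cancel₀ (hbv o' hoo), one_apply_eq]
    · subst hr
      rw [hWo, hAcol c hc, smul_dotProduct, dotProduct_smul, hbiaj o' c hoo hc, smul_zero,
        smul_zero, one_apply_ne (Ne.symm hc)]
    · subst hc
      rw [hWrow r hr, hAo, hwv r hr, one_apply_ne hr]
    · rw [hWrow r hr, hAcol c hc, dotProduct_smul, smul_eq_mul, hdual c r hc hr, one_apply]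
  have hAW : A * W = 1 := mul_eq_one_comm.1 hWA
  have hb : ∀ i, i ≠ o → b i = (b i ⬝ᵥ v) • W.row o := by
    intro i hi
    have h1 : b i ᵥ* A = ((b i ⬝ᵥ v) • W.row o) ᵥ* A := by
      funext c
      change b i ⬝ᵥ A.col c = ((b i ⬝ᵥ v) • W.row o) ⬝ᵥ A.col c
      have h2 : W.row o ⬝ᵥ A.col c = (1 : Matrix ι ι k) o c := congrFun (congrFun hWA o) c
      rw [smul_dotProduct, h2]
      by_cases hc : c = o
      · subst hc; rw [hAo, one_apply_eq, smul_eq_mul, mul_one]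
      · rw [hAcol c hc, dotProduct_smul, hbiaj i c hi hc, one_apply_ne (Ne.symm hc), smul_zero,
          smul_zero]
    have h3 := congrArg (fun u => u ᵥ* W) h1
    simpa only [vecMul_vecMul, hAW, vecMul_one] using h3
  have hconj : ∀ i j, A * single i j 1 * W = vecMulVec (A.col i) (W.row j) := by
    intro i j
    rw [single_eq_single_vecMulVec_single, mul_vecMulVec, vecMulVec_mul, mulVec_single_one,
      single_one_vecMul]
  refine ⟨A, W, hAW, fun x hx => ?_⟩
  let N : Submodule k (Matrix ι ι k) :=
    LinearMap.eqLocus φ ((LinearMap.mulRight k W).comp (LinearMap.mulLeft k A))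
  have hN : ∀ x, x ∈ N ↔ φ x = A * x * W := fun x => Iff.rfl
  have hN1 : ∀ j, j ≠ o → single o j (1 : k) ∈ N := by
    intro j hj
    rw [hN, hconj, hw j hj, hAo, hWrow j hj]
  have hN2 : ∀ i, i ≠ o → single i o (1 : k) ∈ N := by
    intro i hi
    rw [hN, hconj, hab i hi, hAcol i hi, smul_vecMulVec, ← vecMulVec_smul, ← hb i hi]
  have hNbr : ∀ x y, x ∈ N → y ∈ N → x * y - y * x ∈ N := by
    intro x y hx hy
    rw [hN] at hx hy ⊢
    have h1 : ∀ x y : Matrix ι ι k, A * x * W * (A * y * W) = A * (x * y) * W := by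
      intro x y
      calc A * x * W * (A * y * W) = A * x * (W * A) * y * W := by simp only [mul_assoc]
        _ = A * (x * y) * W := by rw [hWA]; simp only [mul_assoc, one_mul]
    rw [hbr, hx, hy, h1, h1, mul_sub, sub_mul]
  have hN3 : ∀ i, i ≠ o → single i i (1 : k) - single o o 1 ∈ N := by
    intro i hi
    have := hNbr _ _ (hN2 i hi) (hN1 i hi)
    simpa using this
  have hN3' : ∀ i, single i i (1 : k) - single o o 1 ∈ N := by
    intro i
    by_cases hi : i = o
    · subst hi; rw [sub_self]; exact N.zero_mem
    · exact hN3 i hi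
  refine (hN x).1 (mem_of_trace_eq_zero (fun i j hij => ?_) (fun i j hij => ?_) hx)
  · by_cases hi : i = o
    · subst hi; exact hN1 j hij.symm
    by_cases hj : j = o
    · subst hj; exact hN2 i hi
    have := hNbr _ _ (hN2 i hi) (hN1 j hj)
    simpa [hij.symm] using this
  · simpa using N.sub_mem (hN3' i) (hN3' j)

/-- Every automorphism of `sl_n` is conjugation by a matrix, possibly composed with
`x ↦ -xᵀ`. -/
theorem exists_conj_or_conj_transpose [IsAlgClosed k]
    (φ : Matrix ι ι k →ₗ[k] Matrix ι ι k) (htr : ∀ x, (φ x).trace = 0)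
    (hbr : ∀ x y, φ (x * y - y * x) = φ x * φ y - φ y * φ x)
    (hsurj : ∀ y : Matrix ι ι k, y.trace = 0 → ∃ x, φ x = y)
    (hinj : ∀ x : Matrix ι ι k, x.trace = 0 → φ x = 0 → x = 0) :
    (∃ P Q : Matrix ι ι k, P * Q = 1 ∧ ∀ x : Matrix ι ι k, x.trace = 0 → φ x = P * x * Q) ∨
    (∃ P Q : Matrix ι ι k, P * Q = 1 ∧
      ∀ x : Matrix ι ι k, x.trace = 0 → φ x = -(P * xᵀ * Q)) := by
  by_cases hne : ∃ o o' : ι, o' ≠ o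
  · obtain ⟨o, o', hoo⟩ := hne
    -- The matrices `e_o fᵀ` with `f(o) = 0` form a linear space of square-zero elements of rank at
    -- most one, and so do their images. A common column leads to a conjugation. A common row
    -- becomes a common column after replacing `φ` by `x ↦ -φ(x)ᵀ`.
    let V : Submodule k (ι → k) := LinearMap.ker (LinearMap.proj (R := k) (φ := fun _ : ι => k) o)
    let β : V →ₗ[k] Matrix ι ι k :=
      { toFun := fun f => vecMulVec (Pi.single o 1) f.1
        map_add' := fun f g => vecMulVec_add _ _ _
        map_smul' := fun c f => vecMulVec_smul _ _ _ }
    have hβ : ∀ j, j ≠ o → ∃ f : V, β f = single o j 1 := fun j hj =>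
      ⟨⟨Pi.single j 1, by simp [V, hj.symm]⟩, (single_eq_single_vecMulVec_single o j).symm⟩
    rcases exists_common_vec (φ.comp β) (fun f => by
        obtain ⟨c, d, h, -⟩ := exists_eq_vecMulVec_of_bracketHom φ htr hbr hsurj
          (a := Pi.single o 1) (b := f.1) (by
            have h0 : f.1 o = 0 := f.2
            simpa using h0)
        exact ⟨c, d, h⟩) with ⟨v, hv⟩ | ⟨v, hv⟩
    · left
      refine exists_conj_of_common_column φ htr hbr hsurj hinj hoo (v := v) fun j hj => ?_
      obtain ⟨f, hf⟩ := hβ j hj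
      rw [← hf]
      exact hv f
    · right
      let φ' : Matrix ι ι k →ₗ[k] Matrix ι ι k :=
        -((transposeLinearEquiv ι ι k k).toLinearMap.comp φ)
      have hφ' : ∀ x, φ' x = -(φ x)ᵀ := fun x => rfl
      obtain ⟨P, Q, hPQ, h⟩ := exists_conj_of_common_column φ'
        (fun x => by rw [hφ', trace_neg, trace_transpose, htr, neg_zero])
        (fun x y => by
          rw [hφ', hφ', hφ', hbr, transpose_sub, transpose_mul, transpose_mul, neg_mul_neg,
            neg_mul_neg]
          abel)
        (fun y hy => by
          obtain ⟨x, hx⟩ := hsurj (-yᵀ) (by rw [trace_neg, trace_transpose, hy, neg_zero])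
          exact ⟨x, by rw [hφ', hx, transpose_neg, transpose_transpose, neg_neg]⟩)
        (fun x hx h0 => hinj x hx (by
          rw [hφ', neg_eq_zero, transpose_eq_zero] at h0
          exact h0)) hoo (v := v) (fun j hj => by
          obtain ⟨f, hf⟩ := hβ j hj
          obtain ⟨a, ha⟩ := hv f
          refine ⟨-a, ?_⟩
          rw [← hf, hφ']
          change -(φ.comp β f)ᵀ = _
          rw [ha, transpose_vecMulVec, vecMulVec_neg])
      refine ⟨Qᵀ, Pᵀ, by rw [← transpose_mul, hPQ, transpose_one], fun x hx => ?_⟩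
      have h1 := h x hx
      rw [hφ', neg_eq_iff_eq_neg] at h1
      rw [← transpose_transpose (φ x), h1, transpose_neg, transpose_mul, transpose_mul, mul_assoc]
  · left
    push Not at hne
    refine ⟨1, 1, mul_one 1, fun x hx => ?_⟩
    have hx0 : x = 0 := by
      cases isEmpty_or_nonempty ι with
      | inl h => exact Subsingleton.elim _ _
      | inr h =>
        obtain ⟨o⟩ := h
        have : Unique ι := ⟨⟨o⟩, fun i => hne o i⟩
        ext i j
        rw [trace, Fintype.sum_unique] at hx
        rw [Subsingleton.elim i default, Subsingleton.elim j default]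
        exact hx
    rw [hx0, map_zero, mul_zero, zero_mul]

end Automorphisms

/-! ### Goursat's lemma for products of copies of `sl_n` -/

section Goursat

variable {ι k : Type*} [Fintype ι] [DecidableEq ι] [Field k] [CharZero k]

/-- The projection of `gl_n` to `sl_n` along the scalar matrices. -/
noncomputable def traceless (ι k : Type*) [Fintype ι] [DecidableEq ι] [Field k] :
    Matrix ι ι k →ₗ[k] Matrix ι ι k :=
  LinearMap.id - ((Fintype.card ι : k)⁻¹ • traceLinearMap ι k k).smulRight 1

omit [CharZero k] in
theorem traceless_apply (x : Matrix ι ι k) :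
    traceless ι k x = x - ((Fintype.card ι : k)⁻¹ * x.trace) • (1 : Matrix ι ι k) := rfl

theorem trace_traceless (x : Matrix ι ι k) : (traceless ι k x).trace = 0 := by
  cases isEmpty_or_nonempty ι with
  | inl h => simp [trace]
  | inr h =>
    have h1 : (Fintype.card ι : k) ≠ 0 := Nat.cast_ne_zero.2 Fintype.card_ne_zero
    rw [traceless_apply, trace_sub, trace_smul, trace_one, smul_eq_mul]
    field_simp
    ring

omit [CharZero k] in
theorem traceless_of_trace_eq_zero {x : Matrix ι ι k} (hx : x.trace = 0) :
    traceless ι k x = x := by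
  rw [traceless_apply, hx, mul_zero, zero_smul, sub_zero]

omit [CharZero k] in
theorem traceless_mul_sub_mul (x y : Matrix ι ι k) :
    traceless ι k x * traceless ι k y - traceless ι k y * traceless ι k x = x * y - y * x := by
  simp only [traceless_apply, mul_sub, sub_mul, mul_smul_comm, smul_mul_assoc, mul_one, one_mul,
    smul_sub]
  rw [smul_comm ((Fintype.card ι : k)⁻¹ * x.trace)]
  abel

variable {I : Type*} {M : Submodule k (I → Matrix ι ι k)}

/-- The projection to two factors of a subalgebra of a product of copies of `sl_n` that surjects on
each factor is either everything or the graph of an automorphism. -/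
theorem surjective_or_graph (htr : ∀ m ∈ M, ∀ i, (m i).trace = 0)
    (hbr : ∀ m ∈ M, ∀ m' ∈ M, m * m' - m' * m ∈ M)
    (hsurj : ∀ i, ∀ y : Matrix ι ι k, y.trace = 0 → ∃ m ∈ M, m i = y) (i j : I) :
    (∀ y z : Matrix ι ι k, y.trace = 0 → z.trace = 0 → ∃ m ∈ M, m i = y ∧ m j = z) ∨
    ∃ φ : Matrix ι ι k →ₗ[k] Matrix ι ι k, (∀ x, (φ x).trace = 0) ∧
      (∀ x y, φ (x * y - y * x) = φ x * φ y - φ y * φ x) ∧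
      (∀ y : Matrix ι ι k, y.trace = 0 → ∃ x, φ x = y) ∧
      (∀ x : Matrix ι ι k, x.trace = 0 → φ x = 0 → x = 0) ∧ ∀ m ∈ M, m i = φ (m j) := by
  -- The `i`-th components of the elements of `M` vanishing at `j`. By surjectivity at `i` it is an
  -- ideal of `sl_n`, hence zero or everything. If it is zero, `m i` is a function of `m j`.
  let N : Submodule k (Matrix ι ι k) :=
    (M ⊓ LinearMap.ker (LinearMap.proj (R := k) (φ := fun _ : I => Matrix ι ι k) j)).map
      (LinearMap.proj (R := k) (φ := fun _ : I => Matrix ι ι k) i)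
  have hN : ∀ y, y ∈ N ↔ ∃ m ∈ M, m j = 0 ∧ m i = y := by
    intro y
    constructor
    · rintro ⟨m, ⟨h1, h2⟩, h3⟩
      exact ⟨m, h1, h2, h3⟩
    · rintro ⟨m, h1, h2, h3⟩
      exact ⟨m, ⟨h1, h2⟩, h3⟩
  rcases eq_bot_or_mem_of_ideal (N := N) (fun x hx => by
      obtain ⟨m, hm, -, rfl⟩ := (hN x).1 hx
      exact htr m hm i) (fun x y hx hy => by
      obtain ⟨m, hm, hmj, rfl⟩ := (hN y).1 hy
      obtain ⟨m', hm', rfl⟩ := hsurj i x hx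
      exact (hN _).2 ⟨_, hbr m' hm' m hm, by simp [hmj], rfl⟩) with hbot | hall
  · right
    let f : M →ₗ[k] Matrix ι ι k :=
      (LinearMap.proj (R := k) (φ := fun _ : I => Matrix ι ι k) j).comp M.subtype
    -- A linear section of the projection to the factor `j`, extended to all matrices. Composing it
    -- with `traceless` defines `φ` on the whole matrix algebra.
    obtain ⟨s0, hs0⟩ := f.rangeRestrict.exists_rightInverse_of_surjective f.range_rangeRestrict
    obtain ⟨s, hs⟩ := LinearMap.exists_extend s0
    have hsf : ∀ y : Matrix ι ι k, y.trace = 0 → (s y).1 j = y := by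
      intro y hy
      obtain ⟨m, hm, hmj⟩ := hsurj j y hy
      have hy' : y ∈ LinearMap.range f := ⟨⟨m, hm⟩, hmj⟩
      have h1 : s y = s0 ⟨y, hy'⟩ := LinearMap.congr_fun hs ⟨y, hy'⟩
      rw [h1]
      exact congrArg Subtype.val (LinearMap.congr_fun hs0 ⟨y, hy'⟩)
    let φ : Matrix ι ι k →ₗ[k] Matrix ι ι k :=
      ((LinearMap.proj (R := k) (φ := fun _ : I => Matrix ι ι k) i).comp M.subtype).comp
        (s.comp (traceless ι k))
    have hφ : ∀ x, φ x = (s (traceless ι k x)).1 i := fun x => rfl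
    have key : ∀ m ∈ M, ∀ x, m j = traceless ι k x → m i = φ x := by
      intro m hm x hmx
      have h1 : m i - φ x ∈ N := (hN _).2 ⟨m - (s (traceless ι k x)).1,
        M.sub_mem hm (s (traceless ι k x)).2, by
          rw [Pi.sub_apply, hsf _ (trace_traceless x), hmx, sub_self], rfl⟩
      rw [hbot, Submodule.mem_bot, sub_eq_zero] at h1
      exact h1
    have hφtr : ∀ x, (φ x).trace = 0 := fun x => htr _ (s (traceless ι k x)).2 i
    have hφbr : ∀ x y, φ (x * y - y * x) = φ x * φ y - φ y * φ x := by
      intro x y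
      refine (key _ (hbr _ (s (traceless ι k x)).2 _ (s (traceless ι k y)).2) _ ?_).symm
      rw [Pi.sub_apply, Pi.mul_apply, Pi.mul_apply, hsf _ (trace_traceless x),
        hsf _ (trace_traceless y), traceless_mul_sub_mul, traceless_of_trace_eq_zero]
      rw [trace_sub, trace_mul_comm, sub_self]
    have hgraph : ∀ m ∈ M, m i = φ (m j) := fun m hm =>
      key m hm _ (traceless_of_trace_eq_zero (htr m hm j)).symm
    have hφsurj : ∀ y : Matrix ι ι k, y.trace = 0 → ∃ x, φ x = y := by
      intro y hy
      obtain ⟨m, hm, hmi⟩ := hsurj i y hy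
      exact ⟨m j, by rw [← hgraph m hm, hmi]⟩
    refine ⟨φ, hφtr, hφbr, hφsurj, ?_, hgraph⟩
    -- The kernel of `φ` in `sl_n` is an ideal. If it were everything, surjectivity would give `sl_n
    -- = 0`, and injectivity holds in this case too.
    rcases eq_bot_or_mem_of_ideal (N := LinearMap.ker φ ⊓ LinearMap.ker (traceLinearMap ι k k))
      (fun x hx => hx.2) (fun x y hx hy => by
        have h1 : φ y = 0 := hy.1
        refine ⟨?_, ?_⟩
        · change φ _ = 0
          rw [hφbr, h1, mul_zero, zero_mul, sub_self]
        · change trace _ = 0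
          rw [trace_sub, trace_mul_comm, sub_self]) with h | h
    · intro x hx h0
      have : x ∈ LinearMap.ker φ ⊓ LinearMap.ker (traceLinearMap ι k k) := ⟨h0, hx⟩
      rwa [h, Submodule.mem_bot] at this
    · intro x hx _
      obtain ⟨y, hy⟩ := hφsurj x hx
      have h1 : φ (traceless ι k y) = φ y := by
        rw [hφ, hφ, traceless_of_trace_eq_zero (trace_traceless y)]
      rw [← hy, ← h1]
      exact (h _ (trace_traceless y)).1
  · left
    intro y z hy hz
    obtain ⟨m, hm, hmj⟩ := hsurj j z hz
    obtain ⟨m', hm', hm'j, hm'i⟩ := (hN _).1 (hall (y - m i) (by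
      rw [trace_sub, hy, htr m hm i, sub_zero]))
    exact ⟨m + m', M.add_mem hm hm', by rw [Pi.add_apply, hm'i]; abel, by
      rw [Pi.add_apply, hm'j, hmj, add_zero]⟩

/-- A subalgebra of a finite product of copies of `sl_n` that surjects on each factor is determined
by its projections to pairs of factors. -/
theorem mem_of_forall_pair [Finite I] (htr : ∀ m ∈ M, ∀ i, (m i).trace = 0)
    (hbr : ∀ m ∈ M, ∀ m' ∈ M, m * m' - m' * m ∈ M)
    (hsurj : ∀ i, ∀ y : Matrix ι ι k, y.trace = 0 → ∃ m ∈ M, m i = y)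
    {X : I → Matrix ι ι k} (hX : ∀ i j, ∃ m ∈ M, m i = X i ∧ m j = X j) : X ∈ M := by
  classical
  have hXtr : ∀ i, (X i).trace = 0 := fun i => by
    obtain ⟨m, hm, h, -⟩ := hX i i
    rw [← h]
    exact htr m hm i
  -- The bracket of an element vanishing on `J` with one vanishing at `j` vanishes on both. Since
  -- `sl_n` is perfect, such brackets still fill the factor `i`.
  have hfull : ∀ i, ∀ J : Finset I, (∀ j ∈ J, ∀ y z : Matrix ι ι k, y.trace = 0 → z.trace = 0 →
      ∃ m ∈ M, m i = y ∧ m j = z) → ∀ y : Matrix ι ι k, y.trace = 0 →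
      ∃ m ∈ M, m i = y ∧ ∀ j ∈ J, m j = 0 := by
    intro i J
    induction J using Finset.induction_on with
    | empty =>
      intro _ y hy
      obtain ⟨m, hm, h⟩ := hsurj i y hy
      exact ⟨m, hm, h, by simp⟩
    | insert j J _ ih =>
      intro hJ y hy
      let D : Submodule k (I → Matrix ι ι k) :=
        M ⊓ ⨅ l ∈ insert j J, LinearMap.ker
          (LinearMap.proj (R := k) (φ := fun _ : I => Matrix ι ι k) l)
      have hD : ∀ m, m ∈ D ↔ m ∈ M ∧ ∀ l ∈ insert j J, m l = 0 := by
        intro m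
        simp [D, Submodule.mem_inf, Submodule.mem_iInf]
      have hmem : y ∈ D.map (LinearMap.proj (R := k) (φ := fun _ : I => Matrix ι ι k) i) := by
        refine mem_of_bracket_mem (fun a b ha hb => ?_) hy
        obtain ⟨m, hm, hmi, hmJ⟩ := ih (fun l hl => hJ l (Finset.mem_insert_of_mem hl)) a ha
        obtain ⟨m', hm', hm'i, hm'j⟩ := hJ j (Finset.mem_insert_self j J) b 0 hb (by simp)
        refine ⟨m * m' - m' * m, (hD _).2 ⟨hbr m hm m' hm', fun l hl => ?_⟩, ?_⟩
        · rcases Finset.mem_insert.1 hl with rfl | hl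
          · simp [hm'j]
          · simp [hmJ l hl]
        · simp [hmi, hm'i]
      obtain ⟨m, hm, hmi⟩ := hmem
      exact ⟨m, ((hD m).1 hm).1, hmi, ((hD m).1 hm).2⟩
  have hind : ∀ J : Finset I, ∃ m ∈ M, ∀ j ∈ J, m j = X j := by
    intro J
    induction J using Finset.induction_on with
    | empty => exact ⟨0, M.zero_mem, by simp⟩
    | insert i J _ ih =>
      obtain ⟨m, hm, hmJ⟩ := ih
      -- If the factor `i` is independent of each factor in `J`, the component at `i` can be
      -- corrected without changing the others. Otherwise it is a function of the component at some
      -- `j ∈ J` and is already the right one.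
      by_cases hcase : ∀ j ∈ J, ∀ y z : Matrix ι ι k, y.trace = 0 → z.trace = 0 →
          ∃ m ∈ M, m i = y ∧ m j = z
      · obtain ⟨m', hm', hm'i, hm'J⟩ := hfull i J hcase (X i - m i) (by
          rw [trace_sub, hXtr i, htr m hm i, sub_zero])
        refine ⟨m + m', M.add_mem hm hm', fun j hj => ?_⟩
        rcases Finset.mem_insert.1 hj with rfl | hj
        · rw [Pi.add_apply, hm'i]; abel
        · rw [Pi.add_apply, hmJ j hj, hm'J j hj, add_zero]
      · push Not at hcase
        obtain ⟨j, hj, y, z, hy, hz, hno⟩ := hcase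
        rcases surjective_or_graph htr hbr hsurj i j with h | ⟨φ, -, -, -, -, hφ⟩
        · obtain ⟨m', hm', h1, h2⟩ := h y z hy hz
          exact absurd h2 (hno m' hm' h1)
        · refine ⟨m, hm, fun l hl => ?_⟩
          rcases Finset.mem_insert.1 hl with rfl | hl
          · obtain ⟨m', hm', h1, h2⟩ := hX l j
            rw [← h1, hφ m hm, hφ m' hm', h2, hmJ j hj]
          · exact hmJ l hl
  have := Fintype.ofFinite I
  obtain ⟨m, hm, h⟩ := hind Finset.univ
  rwa [← funext fun j => h j (Finset.mem_univ j)]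

end Goursat

/-! ### The `p`-adic exponential -/

section PadicExp

open NormedSpace Filter

variable {p : ℕ} [Fact p.Prime]

/-- Legendre's formula gives `v_p(n!) ≤ n`. This crude bound already makes the radius of convergence
at least `1/p`, for every `p`. -/
theorem norm_inv_factorial_le (n : ℕ) : ‖((n.factorial : ℚ_[p])⁻¹)‖ ≤ (p : ℝ) ^ n := by
  have hp1 : (1 : ℝ) ≤ p := by exact_mod_cast (Fact.out : p.Prime).one_le
  have h0 : (n.factorial : ℚ_[p]) ≠ 0 := Nat.cast_ne_zero.2 n.factorial_ne_zero
  rw [norm_inv, Padic.norm_eq_zpow_neg_valuation h0, Padic.valuation_natCast, _root_.zpow_neg, inv_inv,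
    zpow_natCast]
  refine pow_le_pow_right₀ hp1 ?_
  have h1 := sub_one_mul_padicValNat_factorial (p := p) n
  have h2 := (Fact.out : p.Prime).two_le
  have h3 : 1 * padicValNat p n.factorial ≤ (p - 1) * padicValNat p n.factorial :=
    Nat.mul_le_mul_right _ (by omega)
  omega

variable {𝔸 : Type*} [NormedRing 𝔸] [NormedAlgebra ℚ_[p] 𝔸]

theorem expSeries_padic_radius_pos : 0 < (expSeries ℚ_[p] 𝔸).radius := by
  have hp0 : (0 : ℝ) < p := by exact_mod_cast (Fact.out : p.Prime).pos
  let r : NNReal := ⟨(p : ℝ)⁻¹, by positivity⟩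
  have h : (r : ENNReal) ≤ (expSeries ℚ_[p] 𝔸).radius := by
    refine FormalMultilinearSeries.le_radius_of_bound _ (max 1 ‖(1 : 𝔸)‖) fun n => ?_
    have h1 : ‖expSeries ℚ_[p] 𝔸 n‖ ≤ (p : ℝ) ^ n * max 1 ‖(1 : 𝔸)‖ := by
      have h2 : ‖ContinuousMultilinearMap.mkPiAlgebraFin ℚ_[p] n 𝔸‖ ≤ max 1 ‖(1 : 𝔸)‖ :=
        ContinuousMultilinearMap.norm_mkPiAlgebraFin_le
      refine (norm_smul_le ((n.factorial : ℚ_[p])⁻¹)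
        (ContinuousMultilinearMap.mkPiAlgebraFin ℚ_[p] n 𝔸)).trans ?_
      exact mul_le_mul (norm_inv_factorial_le n) h2 (norm_nonneg _) (by positivity)
    refine (mul_le_mul_of_nonneg_right h1 (by positivity)).trans (le_of_eq ?_)
    change _ * ((p : ℝ)⁻¹) ^ n = _
    rw [inv_pow]
    field_simp
  refine lt_of_lt_of_le ?_ h
  rw [ENNReal.coe_pos]
  exact inv_pos.2 hp0

theorem map_exp_nhds_zero (p : ℕ) [Fact p.Prime] (𝔸 : Type*) [NormedRing 𝔸]
    [NormedAlgebra ℚ_[p] 𝔸] [CompleteSpace 𝔸] : map (exp : 𝔸 → 𝔸) (𝓝 0) = 𝓝 1 := by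
  have h : HasStrictFDerivAt exp (ContinuousLinearEquiv.refl ℚ_[p] 𝔸 : 𝔸 →L[ℚ_[p]] 𝔸) 0 :=
    hasStrictFDerivAt_exp_zero_of_radius_pos expSeries_padic_radius_pos
  have h2 := h.map_nhds_eq_of_equiv
  rwa [exp_zero] at h2

theorem eventually_norm_smul_lt (x : 𝔸) {r : ℝ} (hr : 0 < r) :
    ∀ᶠ t in 𝓝 (0 : ℚ_[p]), ‖t • x‖ < r := by
  have h : Tendsto (fun t : ℚ_[p] => ‖t • x‖) (𝓝 0) (𝓝 0) := by
    have : Continuous fun t : ℚ_[p] => ‖t • x‖ := by fun_prop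
    simpa using this.tendsto 0
  exact h.eventually (gt_mem_nhds hr)

variable (p) [CompleteSpace 𝔸]

theorem exists_expRadius (𝔸 : Type*) [NormedRing 𝔸] [NormedAlgebra ℚ_[p] 𝔸] [CompleteSpace 𝔸] :
    ∃ r : ℝ, 0 < r ∧ (∀ x : 𝔸, ‖x‖ < r → x ∈ Metric.eball (0 : 𝔸) (expSeries ℚ_[p] 𝔸).radius) ∧
      Set.InjOn exp (Metric.ball (0 : 𝔸) r) := by
  have h := (hasStrictFDerivAt_exp_zero_of_radius_pos (𝕂 := ℚ_[p]) (𝔸 := 𝔸)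
    expSeries_padic_radius_pos)
  let e := HasStrictFDerivAt.toOpenPartialHomeomorph exp
    (f' := ContinuousLinearEquiv.refl ℚ_[p] 𝔸) h
  have h1 : e.source ∈ 𝓝 (0 : 𝔸) := e.open_source.mem_nhds
    (HasStrictFDerivAt.mem_toOpenPartialHomeomorph_source (f' := ContinuousLinearEquiv.refl ℚ_[p] 𝔸)
      h)
  have h2 : Metric.eball (0 : 𝔸) (expSeries ℚ_[p] 𝔸).radius ∈ 𝓝 (0 : 𝔸) :=
    Metric.eball_mem_nhds _ expSeries_padic_radius_pos
  obtain ⟨r, hr, hr'⟩ := Metric.mem_nhds_iff.1 (inter_mem h1 h2)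
  refine ⟨r, hr, fun x hx => (hr' (by simpa using hx)).2, ?_⟩
  exact e.injOn.mono fun x hx => (hr' hx).1

/-- A radius of a ball on which the exponential of a `p`-adic Banach algebra converges and is
injective. -/
noncomputable def expRadius (𝔸 : Type*) [NormedRing 𝔸] [NormedAlgebra ℚ_[p] 𝔸] [CompleteSpace 𝔸] :
    ℝ := (exists_expRadius p 𝔸).choose

theorem expRadius_pos : 0 < expRadius p 𝔸 := (exists_expRadius p 𝔸).choose_spec.1

variable {p}

theorem mem_eball_of_norm_lt {x : 𝔸} (hx : ‖x‖ < expRadius p 𝔸) :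
    x ∈ Metric.eball (0 : 𝔸) (expSeries ℚ_[p] 𝔸).radius :=
  (exists_expRadius p 𝔸).choose_spec.2.1 x hx

theorem eq_of_exp_eq {x y : 𝔸} (hx : ‖x‖ < expRadius p 𝔸) (hy : ‖y‖ < expRadius p 𝔸)
    (h : exp x = exp y) : x = y :=
  (exists_expRadius p 𝔸).choose_spec.2.2 (mem_ball_zero_iff.2 hx)
    (mem_ball_zero_iff.2 hy) h

theorem norm_smul_lt_expRadius {x : 𝔸} (hx : ‖x‖ < expRadius p 𝔸) {t : ℚ_[p]} (ht : ‖t‖ ≤ 1) :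
    ‖t • x‖ < expRadius p 𝔸 := by
  refine lt_of_le_of_lt ?_ hx
  rw [norm_smul]
  exact mul_le_of_le_one_left (norm_nonneg _) ht

theorem continuousOn_exp_ball : ContinuousOn (exp : 𝔸 → 𝔸) (Metric.ball 0 (expRadius p 𝔸)) :=
  (continuousOn_exp (𝕂 := ℚ_[p])).mono fun x hx => mem_eball_of_norm_lt (by simpa using hx)

theorem exp_neg_mul_exp {x : 𝔸} (hx : ‖x‖ < expRadius p 𝔸) : exp (-x) * exp x = 1 := by
  rw [← exp_add_of_commute_of_mem_ball (𝕂 := ℚ_[p]) (Commute.refl x).neg_left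
    (mem_eball_of_norm_lt (by rwa [norm_neg])) (mem_eball_of_norm_lt hx), neg_add_cancel, exp_zero]

theorem exp_natCast_smul {x : 𝔸} (hx : ‖x‖ < expRadius p 𝔸) (m : ℕ) :
    exp ((m : ℚ_[p]) • x) = exp x ^ m := by
  induction m with
  | zero => rw [Nat.cast_zero, zero_smul, exp_zero, pow_zero]
  | succ m ih =>
    have hm : ‖(m : ℚ_[p])‖ ≤ 1 := by
      simpa using Padic.norm_int_le_one (p := p) (m : ℤ)
    rw [Nat.cast_succ, add_smul, one_smul, exp_add_of_commute_of_mem_ball (𝕂 := ℚ_[p])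
      ((Commute.refl x).smul_left _) (mem_eball_of_norm_lt (norm_smul_lt_expRadius hx hm))
      (mem_eball_of_norm_lt hx), ih, pow_succ]

theorem hasDerivAt_exp_smul (x : 𝔸) : HasDerivAt (fun t : ℚ_[p] => exp (t • x)) x 0 := by
  have h1 : HasFDerivAt exp (1 : 𝔸 →L[ℚ_[p]] 𝔸) ((0 : ℚ_[p]) • x) := by
    rw [zero_smul]
    exact hasFDerivAt_exp_zero_of_radius_pos expSeries_padic_radius_pos
  have h2 : HasDerivAt (fun t : ℚ_[p] => t • x) x 0 := by
    simpa using (hasDerivAt_id (0 : ℚ_[p])).smul_const x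
  exact h1.comp_hasDerivAt (0 : ℚ_[p]) h2

theorem tendsto_exp_sub_one_div (x : 𝔸) :
    Tendsto (fun t : ℚ_[p] => t⁻¹ • (exp (t • x) - 1)) (𝓝[≠] 0) (𝓝 x) := by
  have := (hasDerivAt_exp_smul (p := p) x).tendsto_slope_zero
  simpa using this

theorem eventually_map_exp {𝔹 : Type*} [NormedRing 𝔹] [Algebra ℚ_[p] 𝔹] (f : 𝔸 →ₐ[ℚ_[p]] 𝔹)
    (hf : Continuous f) (x : 𝔸) : ∀ᶠ t in 𝓝 (0 : ℚ_[p]), f (exp (t • x)) = exp (t • f x) := by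
  filter_upwards [eventually_norm_smul_lt x (expRadius_pos p (𝔸 := 𝔸))] with t ht
  rw [map_exp_of_mem_ball (𝕂 := ℚ_[p]) f hf _ (mem_eball_of_norm_lt ht), map_smul]

end PadicExp

/-! ### The Lie algebra of a closed subgroup -/

section LieSet

open NormedSpace Filter

variable (p : ℕ) [Fact p.Prime]

/-- The Lie algebra of a subgroup of the unit group of a `p`-adic algebra. -/
def lieSet {𝔸 : Type*} [Ring 𝔸] [TopologicalSpace 𝔸] [IsTopologicalRing 𝔸] [Algebra ℚ_[p] 𝔸]
    (S : Subgroup 𝔸ˣ) : Set 𝔸 :=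
  {X | ∀ᶠ t in 𝓝 (0 : ℚ_[p]), ∃ g ∈ S, (g : 𝔸) = exp (t • X)}

variable {p} {𝔸 : Type*} [NormedRing 𝔸] [NormedAlgebra ℚ_[p] 𝔸] [CompleteSpace 𝔸]
  {S : Subgroup 𝔸ˣ}

omit [CompleteSpace 𝔸] in
theorem smul_mem_lieSet {X : 𝔸} (hX : X ∈ lieSet p S) (c : ℚ_[p]) : c • X ∈ lieSet p S := by
  have h : Tendsto (fun t : ℚ_[p] => t * c) (𝓝 0) (𝓝 0) := by
    have : Continuous fun t : ℚ_[p] => t * c := by fun_prop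
    simpa using this.tendsto 0
  have h2 : ∀ᶠ t in 𝓝 (0 : ℚ_[p]), ∃ g ∈ S, (g : 𝔸) = exp ((t * c) • X) := h.eventually hX
  filter_upwards [h2] with t ht
  rwa [smul_smul]

/-- For natural `m` one has `exp(mX) = g^m`, which lies in the group. The natural numbers are dense
in `ℤ_p` and the group is closed. -/
theorem exists_mem_eq_exp_smul (hS : IsClosed (Units.val '' (S : Set 𝔸ˣ))) {X : 𝔸}
    (hX : ‖X‖ < expRadius p 𝔸) (hg : ∃ g ∈ S, (g : 𝔸) = exp X) {t : ℚ_[p]} (ht : ‖t‖ ≤ 1) :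
    ∃ g ∈ S, (g : 𝔸) = exp (t • X) := by
  have hc : Continuous fun t : ℤ_[p] => exp ((t : ℚ_[p]) • X) := by
    refine ContinuousOn.comp_continuous (continuousOn_exp_ball (p := p))
      (g := exp) (f := fun t : ℤ_[p] => (t : ℚ_[p]) • X) (by fun_prop) fun t => ?_
    simpa using norm_smul_lt_expRadius hX t.2
  have hcl := hS.preimage hc
  obtain ⟨g, hgS, hg⟩ := hg
  have hall : (fun t : ℤ_[p] => exp ((t : ℚ_[p]) • X)) ⁻¹' (Units.val '' (S : Set 𝔸ˣ)) =
      Set.univ := by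
    refine hcl.closure_eq ▸ Dense.closure_eq ((PadicInt.denseRange_natCast (p := p)).mono ?_)
    rintro _ ⟨m, rfl⟩
    refine ⟨g ^ m, S.pow_mem hgS m, ?_⟩
    have h1 := exp_natCast_smul hX m
    rw [← hg, ← Units.val_pow_eq_pow_val, ← PadicInt.coe_natCast] at h1
    exact h1.symm
  have : (⟨t, ht⟩ : ℤ_[p]) ∈ (fun t : ℤ_[p] => exp ((t : ℚ_[p]) • X)) ⁻¹'
      (Units.val '' (S : Set 𝔸ˣ)) := by rw [hall]; trivial
  exact this

theorem mem_lieSet_of_exp_mem (hS : IsClosed (Units.val '' (S : Set 𝔸ˣ))) {X : 𝔸}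
    (hX : ‖X‖ < expRadius p 𝔸) (hg : ∃ g ∈ S, (g : 𝔸) = exp X) : X ∈ lieSet p S := by
  filter_upwards [Metric.ball_mem_nhds (0 : ℚ_[p]) one_pos] with t ht
  exact exists_mem_eq_exp_smul hS hX hg (by simpa using le_of_lt (mem_ball_zero_iff.1 ht))

theorem conj_mem_lieSet {X : 𝔸} (hX : X ∈ lieSet p S) (u : 𝔸ˣ) (hu : ∀ g ∈ S, u * g * u⁻¹ ∈ S) :
    (u : 𝔸) * X * (↑u⁻¹ : 𝔸) ∈ lieSet p S := by
  have hc : Continuous (MulSemiringAction.toAlgHom ℚ_[p] 𝔸 (ConjAct.toConjAct u)) := by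
    change Continuous fun x : 𝔸 => (u : 𝔸) * x * (↑u⁻¹ : 𝔸)
    fun_prop
  filter_upwards [hX, eventually_map_exp _ hc X] with t ht ht'
  obtain ⟨g, hg, h⟩ := ht
  refine ⟨_, hu g hg, ?_⟩
  change (u : 𝔸) * exp (t • X) * (↑u⁻¹ : 𝔸) = exp (t • ((u : 𝔸) * X * (↑u⁻¹ : 𝔸))) at ht'
  rw [← ht', ← h]
  rfl

/-- The map `v ↦ ∏ exp(lᵢ(v) Xᵢ)`, coordinates of the second kind, has values in the group although
sums of elements of `lieSet` are not yet known to lie in `lieSet`. -/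
theorem exists_chart_of_mem_lieSet {V : Type*} [NormedAddCommGroup V] [NormedSpace ℚ_[p] V]
    {ι : Type*} (s : Finset ι) (l : ι → V →L[ℚ_[p]] ℚ_[p]) (X : ι → 𝔸)
    (hX : ∀ i, X i ∈ lieSet p S) :
    ∃ G : V → 𝔸, HasStrictFDerivAt G (∑ i ∈ s, (l i).smulRight (X i)) 0 ∧ G 0 = 1 ∧
      ∀ᶠ v in 𝓝 (0 : V), ∃ g ∈ S, (g : 𝔸) = G v := by
  classical
  induction s using Finset.induction_on with
  | empty =>
    exact ⟨fun _ => 1, by simpa using hasStrictFDerivAt_const (1 : 𝔸) (0 : V), rfl,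
      Eventually.of_forall fun _ => ⟨1, S.one_mem, rfl⟩⟩
  | insert i s hi ih =>
    obtain ⟨G, hG, hG1, hGS⟩ := ih
    have h0 : (l i) 0 • X i = 0 := by rw [map_zero, zero_smul]
    have h1 : HasStrictFDerivAt (fun v : V => exp (l i v • X i)) ((l i).smulRight (X i)) 0 := by
      have h2 : HasStrictFDerivAt exp (1 : 𝔸 →L[ℚ_[p]] 𝔸) ((l i).smulRight (X i) 0) := by
        rw [map_zero]
        exact hasStrictFDerivAt_exp_zero_of_radius_pos expSeries_padic_radius_pos
      exact h2.comp (0 : V) ((l i).smulRight (X i)).hasStrictFDerivAt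
    refine ⟨fun v => exp (l i v • X i) * G v, ?_, ?_, ?_⟩
    · have h2 := h1.mul' hG
      rw [Finset.sum_insert hi]
      refine h2.congr_fderiv ?_
      rw [h0, exp_zero, hG1]
      ext v
      simp [add_comm]
    · change exp (l i 0 • X i) * G 0 = 1
      rw [h0, exp_zero, hG1, one_mul]
    · have h2 : Tendsto (l i) (𝓝 0) (𝓝 0) := by simpa using (l i).continuous.tendsto 0
      have h3 : ∀ᶠ v in 𝓝 (0 : V), ∃ g ∈ S, (g : 𝔸) = exp (l i v • X i) := h2.eventually (hX i)
      filter_upwards [h3, hGS] with v hv hv'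
      obtain ⟨g, hg, hge⟩ := hv
      obtain ⟨g', hg', hge'⟩ := hv'
      exact ⟨g * g', S.mul_mem hg hg', by rw [Units.val_mul, hge, hge']⟩

variable [FiniteDimensional ℚ_[p] 𝔸]

/-- A neighbourhood of zero in the span of the Lie algebra exponentiates into the group. -/
theorem eventually_exp_mem (hS : IsClosed (Units.val '' (S : Set 𝔸ˣ))) :
    ∀ᶠ v : Submodule.span ℚ_[p] (lieSet p S) in 𝓝 0,
      (v : 𝔸) ∈ lieSet p S ∧ ∃ g ∈ S, (g : 𝔸) = exp (v : 𝔸) := by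
  set V := Submodule.span ℚ_[p] (lieSet p S) with hV
  obtain ⟨X, hX, hspan, hli⟩ := Submodule.exists_fun_fin_finrank_span_eq ℚ_[p] (lieSet p S)
  let b : Module.Basis _ ℚ_[p] V := (Module.Basis.span hli).map
    (LinearEquiv.ofEq _ _ hspan)
  have hb : ∀ i, (b i : 𝔸) = X i := fun i => by
    simp [b, Module.Basis.span_apply]
  let l : _ → V →L[ℚ_[p]] ℚ_[p] := fun i => LinearMap.toContinuousLinearMap (b.coord i)
  obtain ⟨G, hG, hG1, hGS⟩ := exists_chart_of_mem_lieSet Finset.univ l X hX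
  have hsum : ∑ i, (l i).smulRight (X i) = V.subtypeL := by
    ext v
    have := congrArg Subtype.val (b.sum_repr v)
    rw [AddSubmonoidClass.coe_finsetSum] at this
    rw [_root_.sum_apply]
    refine Eq.trans (Finset.sum_congr rfl fun i _ => ?_) this
    rw [Submodule.coe_smul, hb]
    rfl
  rw [hsum] at hG
  have hexp : HasStrictFDerivAt exp (ContinuousLinearEquiv.refl ℚ_[p] 𝔸 : 𝔸 →L[ℚ_[p]] 𝔸) 0 :=
    hasStrictFDerivAt_exp_zero_of_radius_pos expSeries_padic_radius_pos
  let log := hexp.localInverse exp (ContinuousLinearEquiv.refl ℚ_[p] 𝔸) 0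
  have hlog : HasStrictFDerivAt log (ContinuousLinearMap.id ℚ_[p] 𝔸) (G 0) := by
    rw [hG1, ← exp_zero (𝔸 := 𝔸)]
    exact hexp.to_localInverse
  have hlog1 : log (G 0) = 0 := by
    have := hexp.localInverse_apply_image
    rw [exp_zero] at this
    rwa [hG1]
  -- For `v` near `0` the element `log (G v)` lies in `lieSet`, hence in `V`, and equals its
  -- projection to `V`. The map `v ↦ πc (log (G v))` has the identity as derivative, so its values
  -- fill a neighbourhood of `0` in `V`.
  have hΨ : HasStrictFDerivAt (fun v => log (G v)) V.subtypeL 0 := hlog.comp 0 hG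
  obtain ⟨π, hπ⟩ := LinearMap.exists_leftInverse_of_injective V.subtype
    (LinearMap.ker_eq_bot.2 V.subtype_injective)
  let πc : 𝔸 →L[ℚ_[p]] V := LinearMap.toContinuousLinearMap π
  have hπV : ∀ v : V, πc (v : 𝔸) = v := fun v => LinearMap.congr_fun hπ v
  have hπΨ : HasStrictFDerivAt (fun v => πc (log (G v)))
      (ContinuousLinearEquiv.refl ℚ_[p] V : V →L[ℚ_[p]] V) 0 := by
    have h1 := (πc.hasStrictFDerivAt (x := log (G 0))).comp 0 hΨ
    refine h1.congr_fderiv ?_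
    ext v
    exact congrArg Subtype.val (hπV v)
  have : CompleteSpace V := FiniteDimensional.complete ℚ_[p] V
  have hmap := hπΨ.map_nhds_eq_of_equiv
  rw [hlog1, map_zero] at hmap
  have hev : ∀ᶠ v in 𝓝 (0 : V), exp (log (G v)) = G v ∧ ‖log (G v)‖ < expRadius p 𝔸 ∧
      ∃ g ∈ S, (g : 𝔸) = G v := by
    have h1 : ∀ᶠ y in 𝓝 (G 0), exp (log y) = y := by
      rw [hG1, ← exp_zero (𝔸 := 𝔸)]
      exact hexp.eventually_right_inverse
    have h2 : ∀ᶠ v in 𝓝 (0 : V), ‖log (G v)‖ < expRadius p 𝔸 := by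
      have := hΨ.continuousAt.norm
      have h3 : Tendsto (fun v => ‖log (G v)‖) (𝓝 0) (𝓝 0) := by
        simpa [ContinuousAt, hlog1] using this
      exact h3.eventually (gt_mem_nhds (expRadius_pos p))
    filter_upwards [hG.continuousAt.eventually h1, h2, hGS] with v h1 h2 h3
    exact ⟨h1, h2, h3⟩
  rw [← hmap, eventually_map]
  filter_upwards [hev] with v hv
  obtain ⟨h1, h2, g, hg, hge⟩ := hv
  have h3 : log (G v) ∈ lieSet p S := mem_lieSet_of_exp_mem hS h2 ⟨g, hg, by rw [h1, hge]⟩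
  have h4 : (πc (log (G v)) : 𝔸) = log (G v) :=
    congrArg Subtype.val (hπV ⟨log (G v), Submodule.subset_span h3⟩)
  rw [h4]
  exact ⟨h3, g, hg, by rw [h1, hge]⟩

/-- The Lie algebra of a closed subgroup is a subspace. -/
theorem span_lieSet_eq (hS : IsClosed (Units.val '' (S : Set 𝔸ˣ))) :
    (Submodule.span ℚ_[p] (lieSet p S) : Set 𝔸) = lieSet p S := by
  refine Set.Subset.antisymm (fun X hX => ?_) Submodule.subset_span
  have h : Tendsto (fun t : ℚ_[p] => t • (⟨X, hX⟩ : Submodule.span ℚ_[p] (lieSet p S)))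
      (𝓝[≠] 0) (𝓝 0) := by
    have : Continuous fun t : ℚ_[p] => t • (⟨X, hX⟩ : Submodule.span ℚ_[p] (lieSet p S)) := by
      fun_prop
    exact Tendsto.mono_left (by simpa using this.tendsto 0) nhdsWithin_le_nhds
  obtain ⟨t, ht, ht0⟩ := ((h.eventually (eventually_exp_mem hS)).and
    eventually_mem_nhdsWithin).exists
  have := smul_mem_lieSet ht.1 t⁻¹
  rwa [Submodule.coe_smul, smul_smul, inv_mul_cancel₀ ht0, one_smul] at this

omit [CompleteSpace 𝔸] in
theorem mem_of_tendsto_submodule (V : Submodule ℚ_[p] 𝔸) {X : 𝔸} {f : ℚ_[p] → 𝔸}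
    (hf : Tendsto f (𝓝[≠] 0) (𝓝 X)) (h : ∀ᶠ t in 𝓝 0, f t ∈ V) : X ∈ V :=
  V.closed_of_finiteDimensional.mem_of_tendsto hf (h.filter_mono nhdsWithin_le_nhds)

/-- The Lie algebra of a closed subgroup is a Lie algebra. -/
theorem bracket_mem_lieSet (hS : IsClosed (Units.val '' (S : Set 𝔸ˣ))) {X Y : 𝔸}
    (hX : X ∈ lieSet p S) (hY : Y ∈ lieSet p S) : X * Y - Y * X ∈ lieSet p S := by
  rw [← span_lieSet_eq hS] at hY ⊢
  -- The bracket is the derivative at `0` of a curve which stays, for small `t`, in a subspace; this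
  -- subspace is closed, being finite-dimensional.
  have hd : HasDerivAt (fun t : ℚ_[p] => exp (t • X) * Y * exp (t • -X)) (X * Y - Y * X) 0 := by
    have h1 := ((hasDerivAt_exp_smul (p := p) X).mul_const Y).mul (hasDerivAt_exp_smul (p := p) (-X))
    have h2 : X * Y * exp ((0 : ℚ_[p]) • -X) + exp ((0 : ℚ_[p]) • X) * Y * -X = X * Y - Y * X := by
      rw [zero_smul, zero_smul, exp_zero, mul_one, one_mul, mul_neg, sub_eq_add_neg]
    rw [h2] at h1
    exact h1
  refine mem_of_tendsto_submodule _ hd.tendsto_slope_zero ?_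
  filter_upwards [hX, eventually_norm_smul_lt X (expRadius_pos p (𝔸 := 𝔸))] with t ht ht'
  refine Submodule.smul_mem _ _ (Submodule.sub_mem _ ?_ (by simpa using hY))
  obtain ⟨g, hg, hge⟩ := ht
  have hinv : (↑g⁻¹ : 𝔸) = exp (t • -X) := by
    rw [smul_neg]
    refine Units.inv_eq_of_mul_eq_one_left ?_
    rw [hge, exp_neg_mul_exp ht']
  have hY' : Y ∈ lieSet p S := by rw [← span_lieSet_eq hS]; exact hY
  have := conj_mem_lieSet hY' g fun h hh => S.mul_mem (S.mul_mem hg hh) (S.inv_mem hg)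
  rw [zero_add, ← hge, ← hinv]
  exact Submodule.subset_span this

end LieSet

/-! ### Norms on finite-dimensional `p`-adic algebras -/

section FiniteNorm

open NormedSpace Filter

variable (p : ℕ) [Fact p.Prime] (𝔸 : Type*) [Ring 𝔸] [Algebra ℚ_[p] 𝔸] [FiniteDimensional ℚ_[p] 𝔸]

/-- The norm of a finite-dimensional `p`-adic algebra given by its left regular representation. -/
@[reducible] noncomputable def regularNormedRing : NormedRing 𝔸 :=
  letI := Matrix.linftyOpNormedRing (n := Module.Free.ChooseBasisIndex ℚ_[p] 𝔸) (α := ℚ_[p])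
  NormedRing.induced 𝔸 (Matrix (Module.Free.ChooseBasisIndex ℚ_[p] 𝔸)
    (Module.Free.ChooseBasisIndex ℚ_[p] 𝔸) ℚ_[p])
    (Algebra.leftMulMatrix (Module.Free.chooseBasis ℚ_[p] 𝔸))
    (Algebra.leftMulMatrix_injective (Module.Free.chooseBasis ℚ_[p] 𝔸))

@[reducible] noncomputable def regularNormedAlgebra :
    letI := regularNormedRing p 𝔸
    NormedAlgebra ℚ_[p] 𝔸 :=
  letI := regularNormedRing p 𝔸
  { (inferInstance : Algebra ℚ_[p] 𝔸) with
    norm_smul_le := fun c x => by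
      let _ := Matrix.linftyOpNormedRing (n := Module.Free.ChooseBasisIndex ℚ_[p] 𝔸) (α := ℚ_[p])
      let _ := Matrix.linftyOpNormedAlgebra (R := ℚ_[p])
        (n := Module.Free.ChooseBasisIndex ℚ_[p] 𝔸) (α := ℚ_[p])
      change ‖Algebra.leftMulMatrix (Module.Free.chooseBasis ℚ_[p] 𝔸) (c • x)‖ ≤
        ‖c‖ * ‖Algebra.leftMulMatrix (Module.Free.chooseBasis ℚ_[p] 𝔸) x‖
      rw [map_smul]
      exact norm_smul_le _ _ }

variable [t : TopologicalSpace 𝔸] [IsModuleTopology ℚ_[p] 𝔸]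

/-- The module topology is the finest one compatible with the module structure, and conversely
linear maps out of a finite-dimensional normed space over `ℚ_p` are continuous. -/
theorem regularNormedRing_topology :
    t = (regularNormedRing p 𝔸).toMetricSpace.toPseudoMetricSpace.toUniformSpace.toTopologicalSpace
    := by
  let N := regularNormedRing p 𝔸
  let _ := regularNormedAlgebra p 𝔸
  have hT := eq_moduleTopology ℚ_[p] 𝔸
  refine le_antisymm ?_ ?_
  · rw [hT]
    exact @moduleTopology_le ℚ_[p] _ 𝔸 _ _
      N.toMetricSpace.toPseudoMetricSpace.toUniformSpace.toTopologicalSpace inferInstance inferInstance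
  · have h : @Continuous 𝔸 𝔸 N.toMetricSpace.toPseudoMetricSpace.toUniformSpace.toTopologicalSpace
        t (LinearMap.id : 𝔸 →ₗ[ℚ_[p]] 𝔸) := by
      have hs : @ContinuousSMul ℚ_[p] 𝔸 _ _ t := IsModuleTopology.toContinuousSMul ℚ_[p] 𝔸
      have ha : @IsTopologicalAddGroup 𝔸 t _ := IsModuleTopology.topologicalAddGroup ℚ_[p] 𝔸
      exact @LinearMap.continuous_of_finiteDimensional ℚ_[p] _ 𝔸 _ _
        N.toMetricSpace.toPseudoMetricSpace.toUniformSpace.toTopologicalSpace _ _ 𝔸 _ _ t ha hs _ _ _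
        LinearMap.id
    exact continuous_id_iff_le.1 h

/-- A norm defining the canonical topology of a finite-dimensional `p`-adic algebra. -/
@[reducible] noncomputable def finiteNormedRing : NormedRing 𝔸 :=
  { regularNormedRing p 𝔸 with
    toMetricSpace := (regularNormedRing p 𝔸).toMetricSpace.replaceTopology
      (regularNormedRing_topology p 𝔸)
    dist_eq := (regularNormedRing p 𝔸).dist_eq
    norm_mul_le := (regularNormedRing p 𝔸).norm_mul_le }

@[reducible] noncomputable def finiteNormedAlgebra :
    letI := finiteNormedRing p 𝔸
    NormedAlgebra ℚ_[p] 𝔸 :=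
  letI := finiteNormedRing p 𝔸
  { (inferInstance : Algebra ℚ_[p] 𝔸) with
    norm_smul_le := fun c x => (regularNormedAlgebra p 𝔸).norm_smul_le c x }

theorem finiteNormedRing_completeSpace :
    letI := finiteNormedRing p 𝔸
    CompleteSpace 𝔸 := by
  let _ := finiteNormedRing p 𝔸
  let _ := finiteNormedAlgebra p 𝔸
  exact FiniteDimensional.complete ℚ_[p] 𝔸

variable {p 𝔸} [IsTopologicalRing 𝔸] {S : Subgroup 𝔸ˣ}

theorem coe_span_lieSet (hS : IsClosed (Units.val '' (S : Set 𝔸ˣ))) :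
    (Submodule.span ℚ_[p] (lieSet p S) : Set 𝔸) = lieSet p S := by
  let _ := finiteNormedRing p 𝔸
  let _ := finiteNormedAlgebra p 𝔸
  have := finiteNormedRing_completeSpace p 𝔸
  exact span_lieSet_eq hS

theorem mul_sub_mul_mem_lieSet (hS : IsClosed (Units.val '' (S : Set 𝔸ˣ))) {X Y : 𝔸}
    (hX : X ∈ lieSet p S) (hY : Y ∈ lieSet p S) : X * Y - Y * X ∈ lieSet p S := by
  let _ := finiteNormedRing p 𝔸
  let _ := finiteNormedAlgebra p 𝔸
  have := finiteNormedRing_completeSpace p 𝔸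
  exact bracket_mem_lieSet hS hX hY

theorem units_conj_mem_lieSet {X : 𝔸} (hX : X ∈ lieSet p S) (u : 𝔸ˣ)
    (hu : ∀ g ∈ S, u * g * u⁻¹ ∈ S) : (u : 𝔸) * X * (↑u⁻¹ : 𝔸) ∈ lieSet p S := by
  let _ := finiteNormedRing p 𝔸
  let _ := finiteNormedAlgebra p 𝔸
  have := finiteNormedRing_completeSpace p 𝔸
  exact conj_mem_lieSet hX u hu

theorem eventually_exp_mem_of_mem_span (hS : IsClosed (Units.val '' (S : Set 𝔸ˣ))) :
    ∃ W ∈ 𝓝 (0 : 𝔸), ∀ X ∈ W, X ∈ lieSet p S → ∃ g ∈ S, (g : 𝔸) = exp X := by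
  let _ := finiteNormedRing p 𝔸
  let _ := finiteNormedAlgebra p 𝔸
  have := finiteNormedRing_completeSpace p 𝔸
  obtain ⟨W, hW, h⟩ := mem_nhds_subtype _ _ _ |>.1 (eventually_exp_mem (p := p) hS)
  exact ⟨W, hW, fun X hX hXS => (@h ⟨X, Submodule.subset_span hXS⟩ hX).2⟩

variable (p) in
theorem tendsto_inv_smul_exp_sub_one (X : 𝔸) :
    Tendsto (fun t : ℚ_[p] => t⁻¹ • (exp (t • X) - 1)) (𝓝[≠] 0) (𝓝 X) := by
  let _ := finiteNormedRing p 𝔸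
  let _ := finiteNormedAlgebra p 𝔸
  have := finiteNormedRing_completeSpace p 𝔸
  exact tendsto_exp_sub_one_div X

variable (p 𝔸)

include p in
theorem map_exp_nhds : map (exp : 𝔸 → 𝔸) (𝓝 0) = 𝓝 1 := by
  let _ := finiteNormedRing p 𝔸
  let _ := finiteNormedAlgebra p 𝔸
  have := finiteNormedRing_completeSpace p 𝔸
  exact map_exp_nhds_zero p 𝔸

/-- The local properties of the exponential in a form that mentions only the topology, so that the
auxiliary norm can be forgotten. -/
theorem exists_exp_nhds : ∃ U ∈ 𝓝 (0 : 𝔸), Set.InjOn exp U ∧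
    (∀ X ∈ U, ∀ m : ℕ, exp ((m : ℚ_[p]) • X) = exp X ^ m) ∧
    (∀ X ∈ U, exp (-X) * exp X = 1) ∧
    (∀ X ∈ U, ∀ f : 𝔸 →ₐ[ℚ_[p]] 𝔸, Continuous f → f (exp X) = exp (f X)) := by
  let _ := finiteNormedRing p 𝔸
  let _ := finiteNormedAlgebra p 𝔸
  have := finiteNormedRing_completeSpace p 𝔸
  refine ⟨Metric.ball 0 (expRadius p 𝔸), Metric.ball_mem_nhds _ (expRadius_pos p),
    fun X hX Y hY => eq_of_exp_eq (mem_ball_zero_iff.1 hX) (mem_ball_zero_iff.1 hY),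
    fun X hX => exp_natCast_smul (mem_ball_zero_iff.1 hX),
    fun X hX => exp_neg_mul_exp (p := p) (mem_ball_zero_iff.1 hX), fun X hX f hf =>
      map_exp_of_mem_ball (𝕂 := ℚ_[p]) f hf _ (mem_eball_of_norm_lt (mem_ball_zero_iff.1 hX))⟩

end FiniteNorm

/-! ### Lie algebras of images of profinite groups -/

section Descent

open NormedSpace Filter

variable {p : ℕ} [Fact p.Prime]
  {𝔸 : Type*} [NormedRing 𝔸] [NormedAlgebra ℚ_[p] 𝔸] [CompleteSpace 𝔸]
  {𝔹 : Type*} [NormedRing 𝔹] [NormedAlgebra ℚ_[p] 𝔹] [CompleteSpace 𝔹]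
  {G : Type*} [Group G] [TopologicalSpace G] [IsTopologicalGroup G] [CompactSpace G]

/-- The Lie algebra of the image of a profinite group is the image of the Lie algebra of any open
subgroup. -/
theorem exists_mem_lieSet_map_eq (hG : ∀ W ∈ 𝓝 (1 : G), ∃ U : OpenSubgroup G, (U : Set G) ⊆ W)
    (ρ : G →* 𝔸ˣ) (hρ : Continuous fun g => (ρ g : 𝔸)) (U : Subgroup G)
    (hU : IsOpen (U : Set G)) (hcl : IsClosed (Units.val '' (U.map ρ : Set 𝔸ˣ)))
    (f : 𝔸 →ₐ[ℚ_[p]] 𝔹) (hf : Continuous f) {Y : 𝔹}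
    (hY : ∀ᶠ t in 𝓝 (0 : ℚ_[p]), ∃ g, f (ρ g) = exp (t • Y)) :
    ∃ X ∈ lieSet p (U.map ρ), f X = Y := by
  have hN : {X : 𝔸 | ‖X‖ < expRadius p 𝔸 ∧ ‖f X‖ < expRadius p 𝔹} ∈ 𝓝 (0 : 𝔸) := by
    refine inter_mem ?_ ?_
    · have : Tendsto (fun X : 𝔸 => ‖X‖) (𝓝 0) (𝓝 0) := by simpa using (continuous_norm.tendsto (0 : 𝔸))
      exact this.eventually (gt_mem_nhds (expRadius_pos p))
    · have : Tendsto (fun X : 𝔸 => ‖f X‖) (𝓝 0) (𝓝 0) := by simpa using (hf.norm.tendsto (0 : 𝔸))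
      exact this.eventually (gt_mem_nhds (expRadius_pos p))
  have hN1 : exp '' {X : 𝔸 | ‖X‖ < expRadius p 𝔸 ∧ ‖f X‖ < expRadius p 𝔹} ∈ 𝓝 (1 : 𝔸) := by
    rw [← map_exp_nhds_zero p 𝔸]
    exact image_mem_map hN
  have hpre : (fun g => (ρ g : 𝔸)) ⁻¹' (exp '' {X : 𝔸 | ‖X‖ < expRadius p 𝔸 ∧
      ‖f X‖ < expRadius p 𝔹}) ∈ 𝓝 (1 : G) := by
    refine hρ.continuousAt.preimage_mem_nhds ?_
    simpa using hN1
  obtain ⟨U', hU'⟩ := hG _ (inter_mem hpre (hU.mem_nhds U.one_mem))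
  have := Subgroup.quotient_finite_of_isOpen (U' : Subgroup G) U'.isOpen
  have hind : (U' : Subgroup G).index ≠ 0 :=
    (Subgroup.finiteIndex_of_finite_quotient (H := (U' : Subgroup G))).index_ne_zero
  obtain ⟨t, ⟨⟨g, hg⟩, ht⟩, ht0⟩ := (((hY.and (eventually_norm_smul_lt Y
    (expRadius_pos p (𝔸 := 𝔹)))).filter_mono nhdsWithin_le_nhds).and
      (eventually_mem_nhdsWithin (a := (0 : ℚ_[p])) (s := {0}ᶜ))).exists
  -- Some power `g^m` lies in the small open subgroup `U'`, where `ρ(g^m) = exp X` with `X` small.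
  -- Then `exp (f X) = exp (mtY)`, and injectivity of `exp` on small elements gives `f X = mtY`.
  obtain ⟨m, hm, -, hmU⟩ := Subgroup.exists_pow_mem_of_index_ne_zero hind g
  obtain ⟨⟨X, ⟨hX, hfX⟩, hXe⟩, hXU⟩ := hU' hmU
  have hXg : exp X = ((ρ (g ^ m) : 𝔸ˣ) : 𝔸) := hXe
  have hXL : X ∈ lieSet p (U.map ρ) := mem_lieSet_of_exp_mem hcl hX
    ⟨ρ (g ^ m), ⟨_, hXU, rfl⟩, hXg.symm⟩
  have hfe : exp (f X) = exp ((m : ℚ_[p]) • t • Y) := by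
    rw [exp_natCast_smul ht, ← hg, ← map_exp_of_mem_ball (𝕂 := ℚ_[p]) f hf _
      (mem_eball_of_norm_lt hX), hXg, map_pow, Units.val_pow_eq_pow_val, map_pow]
  have hm1 : ‖(m : ℚ_[p])‖ ≤ 1 := by simpa using Padic.norm_int_le_one (p := p) (m : ℤ)
  have hfXY := eq_of_exp_eq hfX (norm_smul_lt_expRadius ht hm1) hfe
  refine ⟨((m : ℚ_[p]) * t)⁻¹ • X, smul_mem_lieSet hXL _, ?_⟩
  have hmt : (m : ℚ_[p]) * t ≠ 0 := mul_ne_zero (Nat.cast_ne_zero.2 hm.ne') ht0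
  rw [map_smul, hfXY, smul_smul, smul_smul, mul_assoc, inv_mul_cancel₀ hmt, one_smul]

end Descent

section Descent

open NormedSpace Filter

/-- For targets such as matrices over `ℚ̄_p`, which need not be complete: everything takes place in
a finite-dimensional subalgebra, and that is complete. -/
theorem exists_mem_lieSet_map_eq_of_subalgebra {p : ℕ} [Fact p.Prime]
    {𝔸 : Type*} [NormedRing 𝔸] [NormedAlgebra ℚ_[p] 𝔸] [CompleteSpace 𝔸]
    {𝔹 : Type*} [NormedRing 𝔹] [NormedAlgebra ℚ_[p] 𝔹]
    {G : Type*} [Group G] [TopologicalSpace G] [IsTopologicalGroup G] [CompactSpace G]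
    (hG : ∀ W ∈ 𝓝 (1 : G), ∃ U : OpenSubgroup G, (U : Set G) ⊆ W)
    (ρ : G →* 𝔸ˣ) (hρ : Continuous fun g => (ρ g : 𝔸)) (U : Subgroup G)
    (hU : IsOpen (U : Set G)) (hcl : IsClosed (Units.val '' (U.map ρ : Set 𝔸ˣ)))
    (f : 𝔸 →ₐ[ℚ_[p]] 𝔹) (hf : Continuous f) (B : Subalgebra ℚ_[p] 𝔹) [FiniteDimensional ℚ_[p] B]
    (hfB : ∀ x, f x ∈ B) {Y : 𝔹} (hYB : Y ∈ B)
    (hY : ∀ᶠ t in 𝓝 (0 : ℚ_[p]), ∃ g, f (ρ g) = exp (t • Y)) :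
    ∃ X ∈ lieSet p (U.map ρ), f X = Y := by
  have hc : CompleteSpace B := FiniteDimensional.complete ℚ_[p] B
  obtain ⟨X, hX, h⟩ := exists_mem_lieSet_map_eq hG ρ hρ U hU hcl (f.codRestrict B hfB)
    (hf.subtype_mk _) (Y := ⟨Y, hYB⟩) (by
      filter_upwards [hY, eventually_map_exp B.val continuous_subtype_val ⟨Y, hYB⟩] with t ht ht'
      obtain ⟨g, hg⟩ := ht
      refine ⟨g, Subtype.ext ?_⟩
      refine Eq.trans ?_ ht'.symm
      exact hg)
  exact ⟨X, hX, congrArg Subtype.val h⟩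

end Descent

/-! ### Matrices over `E_p` and the Lie algebra of `ρ_λ` -/

section LocalMatrices

open NormedSpace Filter

variable {p : ℕ} [Fact p.Prime] {n : ℕ} {E : Type u} [Field E] [NumberField E]

instance matLocIsModuleTopology :
    IsModuleTopology ℚ_[p] (Matrix (Fin n) (Fin n) (Loc p E)) :=
  IsModuleTopology.instPi

instance locT2Space : T2Space (Loc p E) := by
  let _ := finiteNormedRing p (Loc p E)
  infer_instance

theorem exists_finite_subalgebra (l : E →+* PadicAlgCl p) (Y : Matrix (Fin n) (Fin n) (PadicAlgCl p)) :
    ∃ B : Subalgebra ℚ_[p] (PadicAlgCl p), FiniteDimensional ℚ_[p] B ∧ (locEmb p l).range ≤ B ∧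
      ∀ i j, Y i j ∈ B := by
  let s : Set (PadicAlgCl p) := Set.range fun ij : Fin n × Fin n => Y ij.1 ij.2
  have h1 : FiniteDimensional ℚ_[p] (Algebra.adjoin ℚ_[p] s) :=
    Module.Finite.iff_fg.2 (fg_adjoin_of_finite (Set.finite_range _)
      fun x _ => Algebra.IsIntegral.isIntegral x)
  have h2 : FiniteDimensional ℚ_[p] (locEmb p l).range :=
    Module.Finite.range (locEmb p l).toLinearMap
  refine ⟨Algebra.adjoin ℚ_[p] s ⊔ (locEmb p l).range, Subalgebra.finite_sup _ _,
    le_sup_right, fun i j => le_sup_left (a := Algebra.adjoin ℚ_[p] s)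
      (Algebra.subset_adjoin ⟨(i, j), rfl⟩)⟩

variable {K : Type v} [Field K]

theorem exists_openSubgroup_subset {W : Set (AbsGal K)} (hW : W ∈ 𝓝 1) :
    ∃ U : OpenSubgroup (AbsGal K), (U : Set (AbsGal K)) ⊆ W := by
  obtain ⟨M, hM, h⟩ := (krullTopology_mem_nhds_one_iff K (AlgebraicClosure K) W).1 hW
  exact ⟨⟨M.fixingSubgroup, M.fixingSubgroup_isOpen⟩, h⟩

theorem continuous_coe_rep (ρ : AbsGal K →ₜ* GL (Fin n) (Loc p E)) :
    Continuous fun g => (ρ g : Matrix (Fin n) (Fin n) (Loc p E)) :=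
  Units.continuous_val.comp ρ.continuous_toFun

variable [NumberField K]

theorem isClosed_coe_image (ρ : AbsGal K →ₜ* GL (Fin n) (Loc p E)) (U : Subgroup (AbsGal K))
    (hU : IsClosed (U : Set (AbsGal K))) :
    IsClosed (Units.val '' (U.map ρ.toMonoidHom : Set (GL (Fin n) (Loc p E)))) := by
  have h : IsCompact ((fun g => (ρ g : Matrix (Fin n) (Fin n) (Loc p E))) '' U) :=
    hU.isCompact.image (continuous_coe_rep ρ)
  convert h.isClosed using 1
  rw [Subgroup.coe_map, Set.image_image]
  rfl

attribute [local instance] Matrix.linftyOpNormedRing Matrix.linftyOpNormedAlgebra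

/-- The Lie algebra of `ρ_λ` comes from the Lie algebra of `ρ` on any open subgroup. -/
theorem exists_mem_padicLie_map_eq (ρ : AbsGal K →ₜ* GL (Fin n) (Loc p E)) (U : Subgroup (AbsGal K))
    (hU : IsOpen (U : Set (AbsGal K))) (l : E →+* PadicAlgCl p)
    {Y : Matrix (Fin n) (Fin n) (PadicAlgCl p)}
    (hY : Y ∈ padicLie p (repAt ρ.toMonoidHom l).range) :
    ∃ X ∈ padicLie p (U.map ρ.toMonoidHom), X.map (locEmb p l) = Y := by
  obtain ⟨B, hB, hlB, hYB⟩ := exists_finite_subalgebra l Y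
  let f : Matrix (Fin n) (Fin n) (Loc p E) →ₐ[ℚ_[p]] Matrix (Fin n) (Fin n) (PadicAlgCl p) :=
    (locEmb p l).mapMatrix
  let j : Matrix (Fin n) (Fin n) B →ₐ[ℚ_[p]] Matrix (Fin n) (Fin n) (PadicAlgCl p) :=
    B.val.mapMatrix
  have hfc : Continuous f := IsModuleTopology.continuous_of_linearMap f.toLinearMap
  have hcl := isClosed_coe_image ρ U (U.isClosed_of_isOpen hU)
  have hfin : FiniteDimensional ℚ_[p] j.range := Module.Finite.range j.toLinearMap
  let _ := finiteNormedRing p (Matrix (Fin n) (Fin n) (Loc p E))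
  let _ := finiteNormedAlgebra p (Matrix (Fin n) (Fin n) (Loc p E))
  have := finiteNormedRing_completeSpace p (Matrix (Fin n) (Fin n) (Loc p E))
  refine exists_mem_lieSet_map_eq_of_subalgebra (fun W hW => exists_openSubgroup_subset hW)
    ρ.toMonoidHom (continuous_coe_rep ρ) U hU hcl f hfc j.range
    (fun x => ⟨of fun a b => ⟨locEmb p l (x a b), hlB ⟨_, rfl⟩⟩, rfl⟩)
    ⟨of fun a b => ⟨Y a b, hYB a b⟩, rfl⟩ ?_
  filter_upwards [hY] with t ht
  obtain ⟨_, ⟨g, rfl⟩, hg⟩ := ht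
  exact ⟨g, hg⟩

end LocalMatrices

/-! ### The embeddings of `E_p` and descent of linear algebra to `ℚ_p` -/

section Embeddings

variable {p : ℕ} [Fact p.Prime] {E : Type u} [Field E] [NumberField E]

theorem locEmb_tmul (l : E →+* PadicAlgCl p) (a : ℚ_[p]) (e : E) :
    locEmb p l (a ⊗ₜ e) = algebraMap ℚ_[p] (PadicAlgCl p) a * l e := rfl

theorem locEmb_includeRight (l : E →+* PadicAlgCl p) (e : E) :
    locEmb p l ((Algebra.TensorProduct.includeRight : E →ₐ[ℚ] Loc p E) e) = l e := by
  simp [locEmb_tmul]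

theorem locEmb_locMap (l : E →+* PadicAlgCl p) (σ : E →+* E) (x : Loc p E) :
    locEmb p l (locMap p σ x) = locEmb p (l.comp σ) x := by
  have : (locEmb p l).comp (locMap p σ) = locEmb p (l.comp σ) := by
    ext; simp [locMap, locEmb_tmul]
  exact congrArg (fun f => f x) this

theorem locEmb_injective : Function.Injective (locEmb p (E := E)) := by
  intro l l' h
  ext e
  rw [← locEmb_includeRight l, ← locEmb_includeRight l', h]

theorem linearIndependent_locEmb :
    LinearIndependent (PadicAlgCl p) fun l : E →+* PadicAlgCl p => (locEmb p l).toLinearMap :=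
  (linearIndependent_algHom_toLinearMap ℚ_[p] (Loc p E) (PadicAlgCl p)).comp _ locEmb_injective

/-- The embeddings are linearly independent by Dedekind, and their number `[E : ℚ]` is the dimension
of the space of `ℚ_p`-linear maps from `E_p` to `ℚ̄_p`. -/
theorem exists_eq_sum_locEmb (h : Loc p E →ₗ[ℚ_[p]] PadicAlgCl p) :
    ∃ c : (E →+* PadicAlgCl p) → PadicAlgCl p, ∀ x, h x = ∑ l, c l * locEmb p l x := by
  have hc : Fintype.card (E →+* PadicAlgCl p) =
      Module.finrank (PadicAlgCl p) (Loc p E →ₗ[ℚ_[p]] PadicAlgCl p) := by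
    rw [NumberField.Embeddings.card, Module.finrank_linearMap, Module.finrank_self, mul_one,
      Module.finrank_baseChange]
  have : Nonempty (E →+* PadicAlgCl p) := by
    rw [← Fintype.card_pos_iff, NumberField.Embeddings.card]
    exact Module.finrank_pos
  have hs := linearIndependent_locEmb.span_eq_top_of_card_eq_finrank hc
  have hm : h ∈ Submodule.span (PadicAlgCl p)
      (Set.range fun l : E →+* PadicAlgCl p => (locEmb p l).toLinearMap) := hs ▸ Submodule.mem_top
  obtain ⟨c, rfl⟩ := (Submodule.mem_span_range_iff_exists_fun _).1 hm
  exact ⟨c, fun x => by simp [LinearMap.sum_apply]⟩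

/-- A nonzero element is detected by a `ℚ_p`-linear functional, and every functional is a
combination of embeddings. -/
theorem eq_of_forall_locEmb_eq {x y : Loc p E} (h : ∀ l, locEmb p l x = locEmb p l y) : x = y := by
  rw [← sub_eq_zero]
  by_contra hx
  obtain ⟨f, hf, -⟩ := Submodule.exists_le_ker_of_notMem (K := ℚ_[p]) (p := ⊥)
    (v := x - y) (by simpa using hx)
  obtain ⟨c, hc⟩ := exists_eq_sum_locEmb ((Algebra.linearMap ℚ_[p] (PadicAlgCl p)).comp f)
  have h0 := hc (x - y)
  rw [Finset.sum_eq_zero fun l _ => by rw [map_sub, h l, sub_self, mul_zero]] at h0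
  exact hf ((algebraMap ℚ_[p] (PadicAlgCl p)).injective (h0.trans (map_zero _).symm))

theorem isUnit_of_forall_locEmb_ne_zero {x : Loc p E} (h : ∀ l, locEmb p l x ≠ 0) : IsUnit x := by
  have hinj : Function.Injective (LinearMap.mulLeft ℚ_[p] x) := by
    intro y z hyz
    refine eq_of_forall_locEmb_eq fun l => mul_left_cancel₀ (h l) ?_
    rw [← map_mul, ← map_mul]
    exact congrArg _ hyz
  obtain ⟨y, hy⟩ := (LinearMap.injective_iff_surjective.1 hinj) 1
  exact IsUnit.of_mul_eq_one y hy

theorem span_range_locEmb : Submodule.span (PadicAlgCl p)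
    (Set.range fun (x : Loc p E) (l : E →+* PadicAlgCl p) => locEmb p l x) = ⊤ := by
  classical
  by_contra hne
  obtain ⟨f, hf, hle⟩ := Submodule.exists_le_ker_of_lt_top _ (lt_top_iff_ne_top.2 hne)
  refine hf (LinearMap.pi_ext' fun l => LinearMap.ext_ring ?_)
  have h0 := Fintype.linearIndependent_iff.1 (linearIndependent_locEmb (p := p) (E := E))
    (fun l => f (Pi.single l 1)) (by
      refine LinearMap.ext fun x => ?_
      have h1 := hle (Submodule.subset_span ⟨x, rfl⟩)
      rw [LinearMap.mem_ker, LinearMap.pi_apply_eq_sum_univ f] at h1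
      rw [LinearMap.sum_apply, LinearMap.zero_apply, ← h1]
      exact Finset.sum_congr rfl fun i _ => by
        rw [LinearMap.smul_apply, smul_eq_mul, smul_eq_mul, mul_comm]
        refine congrArg (_ * ·) (congrArg f (funext fun j => ?_))
        simp [Pi.single_apply, eq_comm]) l
  exact h0

variable {n : ℕ}

/-- Functionals on `M_n(E_p)` extend to the product over the embeddings; this allows a functional
separating a matrix from a `ℚ_p`-subspace to be tested after extension of scalars. -/
theorem exists_eq_sum_locEmb_matrix
    (h : Matrix (Fin n) (Fin n) (Loc p E) →ₗ[ℚ_[p]] PadicAlgCl p) :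
    ∃ H : ((E →+* PadicAlgCl p) → Matrix (Fin n) (Fin n) (PadicAlgCl p)) →ₗ[PadicAlgCl p]
      PadicAlgCl p, ∀ X, h X = H fun l => X.map (locEmb p l) := by
  choose c hc using fun i j => exists_eq_sum_locEmb
    (h.comp (Matrix.singleLinearMap ℚ_[p] i j))
  refine ⟨∑ i, ∑ j, ∑ l, c i j l • ((Matrix.entryLinearMap _ _ i j).comp
    (LinearMap.proj l)), fun X => ?_⟩
  conv_lhs => rw [Matrix.matrix_eq_sum_single X]
  simp only [map_sum, LinearMap.sum_apply]
  refine Finset.sum_congr rfl fun i _ => Finset.sum_congr rfl fun j _ => ?_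
  exact hc i j (X i j)

/-- A matrix lies in a `ℚ_p`-subspace of `M_n(E_p)` as soon as it does after extension of scalars
to `ℚ̄_p`. -/
theorem mem_of_mem_span_locEmb {V : Submodule ℚ_[p] (Matrix (Fin n) (Fin n) (Loc p E))}
    {X : Matrix (Fin n) (Fin n) (Loc p E)}
    (hX : (fun l => X.map (locEmb p l)) ∈ Submodule.span (PadicAlgCl p)
      ((fun Z : Matrix (Fin n) (Fin n) (Loc p E) =>
        fun l : E →+* PadicAlgCl p => Z.map (locEmb p l)) '' V)) : X ∈ V := by
  by_contra hn
  obtain ⟨f, hf, hle⟩ := Submodule.exists_le_ker_of_notMem hn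
  obtain ⟨H, hH⟩ := exists_eq_sum_locEmb_matrix
    ((Algebra.linearMap ℚ_[p] (PadicAlgCl p)).comp f)
  have h1 : Submodule.span (PadicAlgCl p)
      ((fun Z : Matrix (Fin n) (Fin n) (Loc p E) =>
        fun l : E →+* PadicAlgCl p => Z.map (locEmb p l)) '' V) ≤ LinearMap.ker H := by
    rw [Submodule.span_le]
    rintro _ ⟨Z, hZ, rfl⟩
    refine (hH Z).symm.trans ?_
    have : f Z = 0 := hle hZ
    simp [this]
  have h2 : H (fun l => X.map (locEmb p l)) = 0 := h1 hX
  rw [← hH X] at h2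
  exact hf ((algebraMap ℚ_[p] (PadicAlgCl p)).injective (h2.trans (map_zero _).symm))

/-- A subset of `M_n(E_p)` whose images under all embeddings span spans `M_n(E_p)` over `E_p`. -/
theorem span_eq_top_of_forall_locEmb {T : Set (Matrix (Fin n) (Fin n) (Loc p E))}
    (hT : ∀ l : E →+* PadicAlgCl p, Submodule.span (PadicAlgCl p)
      ((fun Z : Matrix (Fin n) (Fin n) (Loc p E) => Z.map (locEmb p l)) '' T) = ⊤) :
    Submodule.span (Loc p E) T = ⊤ := by
  classical
  rw [eq_top_iff]
  rintro X -
  change X ∈ (Submodule.span (Loc p E) T).restrictScalars ℚ_[p]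
  refine mem_of_mem_span_locEmb ?_
  set W := Submodule.span (PadicAlgCl p)
      ((fun Z : Matrix (Fin n) (Fin n) (Loc p E) =>
        fun l : E →+* PadicAlgCl p => Z.map (locEmb p l)) ''
          ((Submodule.span (Loc p E) T).restrictScalars ℚ_[p])) with hW
  -- The vectors `(λ(x))_λ`, for `x` in `E_p`, span all coefficient vectors. So the components of an
  -- element of `T` can be rescaled independently, and in particular isolated.
  have h1 (Z) (hZ : Z ∈ T) (c : (E →+* PadicAlgCl p) → PadicAlgCl p) :
      (fun l => c l • Z.map (locEmb p l)) ∈ W := by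
    have hc : c ∈ Submodule.span (PadicAlgCl p)
      (Set.range fun (x : Loc p E) (l : E →+* PadicAlgCl p) => locEmb p l x) :=
      span_range_locEmb (p := p) (E := E) ▸ Submodule.mem_top
    induction hc using Submodule.span_induction with
    | mem c hc =>
      obtain ⟨x, rfl⟩ := hc
      refine Submodule.subset_span ⟨x • Z, Submodule.smul_mem _ x (Submodule.subset_span hZ), ?_⟩
      ext l i j
      simp
    | zero => convert W.zero_mem using 1; ext; simp
    | add c c' _ _ h h' => convert W.add_mem h h' using 1; ext; simp [add_mul]
    | smul a c _ h => convert W.smul_mem a h using 1; ext; simp [mul_assoc]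
  have h2 (l : E →+* PadicAlgCl p) (y : Matrix (Fin n) (Fin n) (PadicAlgCl p)) :
      Pi.single l y ∈ W := by
    have hy : y ∈ Submodule.span (PadicAlgCl p)
      ((fun Z : Matrix (Fin n) (Fin n) (Loc p E) => Z.map (locEmb p l)) '' T) :=
      hT l ▸ Submodule.mem_top
    induction hy using Submodule.span_induction with
    | mem y hy =>
      obtain ⟨Z, hZ, rfl⟩ := hy
      convert h1 Z hZ (Pi.single l 1) using 1
      ext l' : 1
      by_cases hl : l' = l
      · subst hl; simp
      · simp [hl]
    | zero => simp
    | add c c' _ _ h h' => rw [Pi.single_add]; exact W.add_mem h h'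
    | smul a c _ h => rw [Pi.single_smul]; exact W.smul_mem a h
  rw [← Finset.univ_sum_single (fun l => X.map (locEmb p l))]
  exact W.sum_mem fun l _ => h2 l _

end Embeddings

/-! ### Traces of polynomials in a matrix with characteristic polynomial over `E` -/

section CharpolyTraces

open Polynomial

theorem Matrix.det_aeval_X_sub_C {k ι : Type*} [CommRing k] [Fintype ι] [DecidableEq ι]
    (A : Matrix ι ι k) (x : k) :
    (aeval A (X - C x)).det = (-1) ^ Fintype.card ι * A.charpoly.eval x := by
  rw [eval_charpoly, ← Matrix.det_neg, map_sub, aeval_X, aeval_C, neg_sub]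
  rfl

/-- Over an algebraically closed field `q` splits, and `det(M - x)` is a value of the characteristic
polynomial up to a sign depending only on the size. -/
theorem Matrix.det_aeval_eq_of_charpoly_eq {k ι ι' : Type*} [Field k] [IsAlgClosed k] [Fintype ι]
    [DecidableEq ι] [Fintype ι'] [DecidableEq ι'] {M : Matrix ι ι k} {N : Matrix ι' ι' k}
    (h : M.charpoly = N.charpoly) (q : k[X]) : (aeval M q).det = (aeval N q).det := by
  have hcard : Fintype.card ι = Fintype.card ι' := by
    rw [← M.charpoly_natDegree_eq_dim, h, N.charpoly_natDegree_eq_dim]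
  let f : k[X] →* k :=
    (Matrix.detMonoidHom (n := ι) (R := k)).comp (aeval M).toRingHom.toMonoidHom
  let f' : k[X] →* k :=
    (Matrix.detMonoidHom (n := ι') (R := k)).comp (aeval N).toRingHom.toMonoidHom
  change f q = f' q
  rw [(IsAlgClosed.splits q).eq_prod_roots, map_mul, map_mul, map_multiset_prod, map_multiset_prod,
    Multiset.map_map, Multiset.map_map]
  congr 1
  · change (aeval M (C _)).det = (aeval N (C _)).det
    rw [aeval_C, aeval_C, Matrix.algebraMap_eq_diagonal, Matrix.algebraMap_eq_diagonal]
    simp [hcard]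
  · congr 1
    refine Multiset.map_congr rfl fun x _ => ?_
    exact (M.det_aeval_X_sub_C x).trans (by rw [h, hcard]; exact (N.det_aeval_X_sub_C x).symm)

theorem Matrix.charpoly_aeval_eq_of_charpoly_eq {k ι ι' : Type*} [Field k] [IsAlgClosed k]
    [Fintype ι] [DecidableEq ι] [Fintype ι'] [DecidableEq ι'] {M : Matrix ι ι k}
    {N : Matrix ι' ι' k} (h : M.charpoly = N.charpoly) (q : k[X]) :
    (aeval M q).charpoly = (aeval N q).charpoly := by
  refine Polynomial.funext fun t => ?_
  have := Matrix.det_aeval_eq_of_charpoly_eq h (C t - q)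
  rw [map_sub, map_sub, aeval_C, aeval_C] at this
  rw [eval_charpoly, eval_charpoly]
  exact this

theorem Matrix.trace_aeval_eq_of_charpoly_eq {k ι ι' : Type*} [Field k] [IsAlgClosed k]
    [Fintype ι] [DecidableEq ι] [Fintype ι'] [DecidableEq ι'] [Nonempty ι] [Nonempty ι']
    {M : Matrix ι ι k} {N : Matrix ι' ι' k} (h : M.charpoly = N.charpoly) (q : k[X]) :
    (aeval M q).trace = (aeval N q).trace := by
  have hcard : Fintype.card ι = Fintype.card ι' := by
    rw [← M.charpoly_natDegree_eq_dim, h, N.charpoly_natDegree_eq_dim]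
  rw [trace_eq_neg_charpoly_coeff, trace_eq_neg_charpoly_coeff,
    Matrix.charpoly_aeval_eq_of_charpoly_eq h, hcard]

theorem Polynomial.Monic.exists_charpoly_eq {k : Type*} [Field k] {h : k[X]} (hm : h.Monic) :
    ∃ N : Matrix (Fin h.natDegree) (Fin h.natDegree) k, N.charpoly = h := by
  let b := AdjoinRoot.powerBasis hm.ne_zero
  refine ⟨Algebra.leftMulMatrix b.basis b.gen, ?_⟩
  refine (charpoly_leftMulMatrix b).trans ?_
  change minpoly k (AdjoinRoot.root h) = h
  rw [AdjoinRoot.minpoly_root hm.ne_zero, hm.leadingCoeff, inv_one, C_1, mul_one]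

theorem Matrix.map_aeval_map {R S T ι : Type*} [CommRing R] [CommRing S] [CommRing T] [Fintype ι]
    [DecidableEq ι] (f : R →+* S) (g : S →+* T) (M : Matrix ι ι S) (q : R[X]) :
    (aeval M (q.map f)).map g = aeval (M.map g) (q.map (g.comp f)) := by
  change g.mapMatrix _ = _
  rw [aeval_def, aeval_def, eval₂_map, eval₂_map, hom_eval₂]
  congr 1
  ext x i j
  by_cases hij : i = j <;> simp [Matrix.algebraMap_matrix_apply, hij]

variable {p : ℕ} [Fact p.Prime] {E : Type u} [Field E] [NumberField E] {n : ℕ}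

theorem trace_map_locEmb (l : E →+* PadicAlgCl p) (M : Matrix (Fin n) (Fin n) (Loc p E)) :
    (M.map (locEmb p l)).trace = locEmb p l M.trace :=
  (AddMonoidHom.map_trace (locEmb p l : Loc p E →+ PadicAlgCl p) M).symm

/-- If the characteristic polynomial of `M` has coefficients in `E`, so have the traces of the
polynomials in `M` over `E`. -/
theorem exists_trace_aeval_eq [NeZero n] {M : Matrix (Fin n) (Fin n) (Loc p E)} {h : E[X]}
    (hM : M.charpoly = h.map (Algebra.TensorProduct.includeRight : E →ₐ[ℚ] Loc p E).toRingHom)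
    (q : E[X]) : ∃ e : E, (aeval M (q.map
      (Algebra.TensorProduct.includeRight : E →ₐ[ℚ] Loc p E).toRingHom)).trace =
        (Algebra.TensorProduct.includeRight : E →ₐ[ℚ] Loc p E) e := by
  set j := (Algebra.TensorProduct.includeRight : E →ₐ[ℚ] Loc p E) with hj
  have hinj : Function.Injective j.toRingHom := j.toRingHom.injective
  have hm : h.Monic := (Polynomial.monic_map_iff (f := j.toRingHom)).1 (hM ▸ M.charpoly_monic)
  have hdeg : h.natDegree = n := by
    rw [← Polynomial.natDegree_map_eq_of_injective hinj, ← hM, M.charpoly_natDegree_eq_dim,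
      Fintype.card_fin]
  -- A matrix over `E` itself with characteristic polynomial `h`. Under every embedding it has the
  -- same characteristic polynomial as `M`, so the trace of `q(M)` is the image of that of `q(N)`.
  obtain ⟨N, hN⟩ := hm.exists_charpoly_eq
  have : Nonempty (Fin h.natDegree) := ⟨⟨0, hdeg ▸ Nat.pos_of_ne_zero (NeZero.ne n)⟩⟩
  refine ⟨(aeval N q).trace, eq_of_forall_locEmb_eq fun l => ?_⟩
  have hl : (locEmb p l : Loc p E →+* PadicAlgCl p).comp j.toRingHom = l := by
    ext e; exact locEmb_includeRight l e
  rw [locEmb_includeRight, ← trace_map_locEmb]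
  have h1 := Matrix.map_aeval_map j.toRingHom (locEmb p l : Loc p E →+* PadicAlgCl p) M q
  have h2 := Matrix.map_aeval_map (RingHom.id E) l N q
  rw [Polynomial.map_id, RingHom.comp_id] at h2
  rw [hl] at h1
  refine (congrArg Matrix.trace h1).trans
    ((Matrix.trace_aeval_eq_of_charpoly_eq ?_ _).trans ((congrArg Matrix.trace h2.symm).trans (AddMonoidHom.map_trace (l : E →+ PadicAlgCl p) _).symm))
  rw [Matrix.charpoly_map, Matrix.charpoly_map, hM, hN, Polynomial.map_map, hl]

theorem exists_trace_pow_eq [NeZero n] {M : GL (Fin n) (Loc p E)} {h : E[X]}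
    (hM : (M : Matrix (Fin n) (Fin n) (Loc p E)).charpoly =
      h.map (Algebra.TensorProduct.includeRight : E →ₐ[ℚ] Loc p E).toRingHom)
    (i : ℕ) : ∃ e : E, ((M ^ i : GL (Fin n) (Loc p E)) : Matrix (Fin n) (Fin n) (Loc p E)).trace =
        (Algebra.TensorProduct.includeRight : E →ₐ[ℚ] Loc p E) e := by
  simpa using exists_trace_aeval_eq hM (X ^ i)

theorem exists_trace_inv_pow_eq [NeZero n] {M : GL (Fin n) (Loc p E)} {h : E[X]}
    (hM : (M : Matrix (Fin n) (Fin n) (Loc p E)).charpoly =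
      h.map (Algebra.TensorProduct.includeRight : E →ₐ[ℚ] Loc p E).toRingHom)
    (hdet : (M : Matrix (Fin n) (Fin n) (Loc p E)).det = 1) (i : ℕ) :
    ∃ e : E, (((M ^ i)⁻¹ : GL (Fin n) (Loc p E)) : Matrix (Fin n) (Fin n) (Loc p E)).trace =
        (Algebra.TensorProduct.includeRight : E →ₐ[ℚ] Loc p E) e := by
  set j := (Algebra.TensorProduct.includeRight : E →ₐ[ℚ] Loc p E) with hj
  have hinj : Function.Injective j.toRingHom := j.toRingHom.injective
  have h0 : h.coeff 0 = (-1) ^ n := by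
    apply hinj
    have := Matrix.det_eq_sign_charpoly_coeff (M : Matrix (Fin n) (Fin n) (Loc p E))
    rw [hdet, hM, coeff_map, Fintype.card_fin] at this
    calc j.toRingHom (h.coeff 0)
        = (-1) ^ n * ((-1) ^ n * j.toRingHom (h.coeff 0)) := by
          rw [← mul_assoc, ← mul_pow]; simp
      _ = j.toRingHom ((-1) ^ n) := by rw [← this]; simp
  -- As `det M = 1`, the constant coefficient of `h` is `(-1)^n`, so `X q = 1 - (-1)^n h`. By
  -- Cayley-Hamilton `q` evaluates to `M⁻¹`.
  let q : E[X] := C (-(-1) ^ n) * h.divX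
  have hq : (M : Matrix (Fin n) (Fin n) (Loc p E)) * aeval (M : Matrix (Fin n) (Fin n) (Loc p E))
      (q.map j.toRingHom) = 1 := by
    have hCH : aeval (M : Matrix (Fin n) (Fin n) (Loc p E)) (h.map j.toRingHom) = 0 :=
      hM ▸ Matrix.aeval_self_charpoly _
    have hX : X * q = 1 - C ((-1) ^ n) * h := by
      conv_rhs => rw [← Polynomial.divX_mul_X_add h, h0]
      rw [mul_add, ← C_mul, ← mul_pow]
      simp [q]
      ring
    have h3 := congrArg (fun r => aeval (M : Matrix (Fin n) (Fin n) (Loc p E))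
      (r.map j.toRingHom)) hX
    simp only [Polynomial.map_mul, Polynomial.map_sub, map_mul, map_sub, hCH, Polynomial.map_one,
      map_one, Polynomial.map_X, aeval_X, mul_zero, sub_zero] at h3
    exact h3
  have hinv : ((M⁻¹ : GL (Fin n) (Loc p E)) : Matrix (Fin n) (Fin n) (Loc p E)) =
      aeval (M : Matrix (Fin n) (Fin n) (Loc p E)) (q.map j.toRingHom) := by
    rw [Units.inv_eq_of_mul_eq_one_right hq]
  obtain ⟨e, he⟩ := exists_trace_aeval_eq hM (q ^ i)
  refine ⟨e, ?_⟩
  rw [← he, Polynomial.map_pow, map_pow, ← hinv, ← inv_pow, Units.val_pow_eq_pow_val]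

end CharpolyTraces

/-! ### Representations over `E_p` with equal traces -/

section TracesDetermine

/-- Two representations that span the matrix algebra and have the same traces are related by an
endomorphism of the matrix algebra. -/
theorem exists_ringHom_of_trace_eq {A ι G : Type*} [CommRing A] [Fintype ι] [DecidableEq ι]
    [Group G] (s r : G →* (Matrix ι ι A)ˣ)
    (hs : Submodule.span A (Set.range fun g => (s g : Matrix ι ι A)) = ⊤)
    (hr : Submodule.span A (Set.range fun g => (r g : Matrix ι ι A)) = ⊤)
    (htr : ∀ g, (s g : Matrix ι ι A).trace = (r g : Matrix ι ι A).trace) :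
    ∃ ψ : Matrix ι ι A →ₐ[A] Matrix ι ι A, ∀ g, ψ (r g) = s g := by
  let L (t : G →* (Matrix ι ι A)ˣ) : MonoidAlgebra A G →ₐ[A] Matrix ι ι A :=
    MonoidAlgebra.lift A (Matrix ι ι A) G ((Units.coeHom _).comp t)
  have hL (t) (g : G) (a : A) : L t (MonoidAlgebra.single g a) = a • (t g : Matrix ι ι A) := by
    simp [L]
  have hsurj (t : G →* (Matrix ι ι A)ˣ)
      (ht : Submodule.span A (Set.range fun g => (t g : Matrix ι ι A)) = ⊤) :
      Function.Surjective (L t) := by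
    have h1 : Submodule.span A (Set.range fun g => (t g : Matrix ι ι A)) ≤
        LinearMap.range (L t).toLinearMap := by
      rw [Submodule.span_le]
      rintro _ ⟨g, rfl⟩
      exact ⟨MonoidAlgebra.single g 1, by simp [hL]⟩
    rw [ht, top_le_iff, LinearMap.range_eq_top] at h1
    exact h1
  have htrace (c : MonoidAlgebra A G) : (L s c).trace = (L r c).trace := by
    induction c using MonoidAlgebra.induction_linear with
    | zero => simp
    | add f g hf hg => simp [hf, hg, trace_add]
    | single g a => simp [hL, htr]
  -- The trace form is nondegenerate and `L s` is surjective, so `L s c` is determined by the traces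
  -- of `L s (c e)`. These equal the traces of `L r (c e)`, which depend only on `L r c`.
  have hker (c d : MonoidAlgebra A G) (h : L r c = L r d) : L s c = L s d := by
    rw [Matrix.ext_iff_trace_mul_right]
    intro x
    obtain ⟨e, rfl⟩ := hsurj s hs x
    rw [← map_mul, ← map_mul, htrace, htrace, map_mul, map_mul, h]
  choose c hc using hsurj r hr
  have hψ (d) : L s (c (L r d)) = L s d := hker _ _ (hc _)
  refine ⟨AlgHom.ofLinearMap ⟨⟨fun X => L s (c X), fun X Y => ?_⟩, fun a X => ?_⟩ ?_ ?_, ?_⟩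
  · rw [← map_add]; exact hker _ _ (by simp [hc])
  · rw [RingHom.id_apply, ← map_smul]; exact hker _ _ (by simp [hc])
  · exact (hker _ 1 (by simp [hc])).trans (map_one _)
  · intro X Y; exact (hker _ (c X * c Y) (by simp [hc])).trans (map_mul _ _ _)
  · intro g
    refine (hker _ (MonoidAlgebra.single g 1) ?_).trans ?_
    · rw [hc, hL, one_smul]
    · rw [hL, one_smul]

variable {p : ℕ} [Fact p.Prime] {E : Type u} [Field E] [NumberField E] {n : ℕ}

theorem Matrix.isUnit_of_forall_locEmb {P : Matrix (Fin n) (Fin n) (Loc p E)}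
    (h : ∀ l : E →+* PadicAlgCl p, ∀ v : Fin n → PadicAlgCl p, P.map (locEmb p l) *ᵥ v = 0 → v = 0) :
    IsUnit P := by
  rw [Matrix.isUnit_iff_isUnit_det]
  refine isUnit_of_forall_locEmb_ne_zero fun l hl => ?_
  have hd : (P.map (locEmb p l)).det = 0 := by
    rw [← hl]; exact ((locEmb p l).map_det P).symm
  obtain ⟨v, hv, hv'⟩ := Matrix.exists_mulVec_eq_zero_iff.2 hd
  exact hv (h l v hv')

/-- Endomorphisms of the `E_p`-algebra `M_n(E_p)` are inner. -/
theorem exists_mul_eq_mul_of_algHom [NeZero n]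
    (ψ : Matrix (Fin n) (Fin n) (Loc p E) →ₐ[Loc p E] Matrix (Fin n) (Fin n) (Loc p E)) :
    ∃ P : GL (Fin n) (Loc p E), ∀ X, ψ X * P = P * X := by
  classical
  let e (i j : Fin n) : Matrix (Fin n) (Fin n) (Loc p E) := Matrix.single i j 1
  have hne (l : E →+* PadicAlgCl p) : (ψ (e 0 0)).map (locEmb p l) ≠ 0 := by
    intro h0
    have h1 (j) : (ψ (e j j)).map (locEmb p l) = 0 := by
      have : e j j = e j 0 * e 0 0 * e 0 j := by simp [e]
      rw [this, map_mul, map_mul, Matrix.map_mul, Matrix.map_mul, h0]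
      simp
    have h2 : (ψ (∑ j, e j j)).map (locEmb p l) = 0 := by
      rw [map_sum]
      change (locEmb p l).mapMatrix _ = _
      rw [map_sum]
      exact Finset.sum_eq_zero fun j _ => h1 j
    have h3 : (∑ j, e j j) = 1 := by
      ext a b
      rw [Matrix.sum_apply, Finset.sum_eq_single a]
      · simp [e, Matrix.single_apply, Matrix.one_apply]
      · intro j _ hj; simp [e, hj]
      · simp
    rw [h3, map_one, Matrix.map_one _ (map_zero _) (map_one _)] at h2
    exact one_ne_zero h2
  let φ (l : E →+* PadicAlgCl p) : Matrix (Fin n) (Fin n) (Loc p E) →ₗ[ℚ_[p]]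
      Matrix (Fin n) (Fin n) (PadicAlgCl p) :=
    ((locEmb p l).mapMatrix.toLinearMap).comp
      ((LinearMap.mulRight ℚ_[p] (e 0 0)).comp (LinearMap.mulLeft ℚ_[p] (ψ (e 0 0))))
  -- Each condition excludes a proper `ℚ_p`-subspace, and finitely many of these do not cover the
  -- space, `ℚ_p` being infinite.
  obtain ⟨B, hB⟩ : ∃ B, ∀ l, φ l B ≠ 0 := by
    have htop : (⊤ : Subspace ℚ_[p] (Matrix (Fin n) (Fin n) (Loc p E))) ∉
        Finset.univ.image fun l => LinearMap.ker (φ l) := by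
      rw [Finset.mem_image]
      rintro ⟨l, -, hl⟩
      refine hne l (Matrix.ext fun a b => ?_)
      have h1 : φ l (e b 0) = 0 := by
        rw [← LinearMap.mem_ker, hl]; trivial
      have h2 := congrFun (congrFun h1 a) 0
      have h3 : (ψ (e 0 0) * e b 0 * e 0 0) a 0 = ψ (e 0 0) a b := by
        rw [mul_assoc]; simp [e]
      exact (congrArg (locEmb p l) h3).symm.trans h2
    have h1 := Subspace.biUnion_ne_univ_of_top_notMem htop
    obtain ⟨B, hB⟩ := (Set.ne_univ_iff_exists_notMem _).1 h1
    refine ⟨B, fun l hl => hB ?_⟩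
    simp only [Finset.mem_image, Finset.mem_univ, true_and, Set.iUnion_exists, Set.mem_iUnion]
    exact ⟨_, l, rfl, hl⟩
  -- This sum intertwines `ψ` with the identity for any `B`; the choice of `B` serves only for
  -- invertibility.
  let P : Matrix (Fin n) (Fin n) (Loc p E) := ∑ j, ψ (e j 0) * B * e 0 j
  have hP (X) : ψ X * P = P * X := by
    have hX1 (j) : X * e j 0 = ∑ k, X k j • e k 0 := by
      ext a b
      by_cases hb : b = 0
      · subst hb; simp [e, Matrix.sum_apply, Matrix.single_apply]
      · simp [e, Matrix.sum_apply, Matrix.mul_single_apply_of_ne, hb, Ne.symm hb]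
    have hX2 (k) : e 0 k * X = ∑ j, X k j • e 0 j := by
      ext a b
      by_cases ha : a = 0
      · subst ha; simp [e, Matrix.sum_apply, Matrix.single_apply]
      · simp [e, Matrix.sum_apply, Matrix.single_mul_apply_of_ne, ha, Ne.symm ha]
    calc ψ X * P = ∑ j, ∑ k, X k j • (ψ (e k 0) * B * e 0 j) := by
          simp only [P, Finset.mul_sum]
          refine Finset.sum_congr rfl fun j _ => ?_
          rw [← mul_assoc, ← mul_assoc, ← map_mul, hX1, map_sum, Finset.sum_mul, Finset.sum_mul]
          exact Finset.sum_congr rfl fun k _ => by rw [map_smul, smul_mul_assoc, smul_mul_assoc]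
      _ = ∑ k, ∑ j, X k j • (ψ (e k 0) * B * e 0 j) := Finset.sum_comm
      _ = P * X := by
          simp only [P, Finset.sum_mul]
          refine Finset.sum_congr rfl fun k _ => ?_
          rw [mul_assoc _ (e 0 k), hX2, Finset.mul_sum]
          exact Finset.sum_congr rfl fun j _ => by rw [mul_smul_comm]
  have hPe : P * e 0 0 = ψ (e 0 0) * B * e 0 0 := by
    simp only [P, Finset.sum_mul]
    rw [Finset.sum_eq_single 0]
    · simp [mul_assoc, e]
    · intro j _ hj
      rw [mul_assoc]
      simp [e, Matrix.single_mul_single_of_ne, hj]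
    · simp
  -- If `P` kills a vector with `v_j ≠ 0` at some embedding, then so does `P e_0j`, by `ψ(e_0j) P =
  -- P e_0j`. Hence the column `0` of `P` vanishes there, contrary to the choice of `B`.
  have hu : IsUnit P := by
    refine Matrix.isUnit_of_forall_locEmb fun l v hv => funext fun j => ?_
    by_contra hvj
    refine hB l ?_
    change (ψ (e 0 0) * B * e 0 0).map (locEmb p l) = 0
    have h1 : (P.map (locEmb p l) * (e 0 j).map (locEmb p l)) *ᵥ v = 0 := by
      rw [← Matrix.map_mul, ← hP, Matrix.map_mul, ← Matrix.mulVec_mulVec, hv, Matrix.mulVec_zero]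
    have h2 : (e 0 j).map (locEmb p l) *ᵥ v = Pi.single 0 (v j) := by
      ext a
      by_cases ha : a = 0
      · subst ha
        simp [e, Matrix.mulVec, dotProduct, Matrix.single_apply]
      · simp [e, Matrix.mulVec, dotProduct, ha, Ne.symm ha]
    rw [← Matrix.mulVec_mulVec, h2] at h1
    rw [← hPe]
    ext a b
    have h3 := congrFun h1 a
    rw [Matrix.mulVec_single] at h3
    have h4 : locEmb p l (P a 0) = 0 := by
      have h5 : locEmb p l (P a 0) = 0 ∨ v j = 0 := by simpa using h3
      exact h5.resolve_right hvj
    by_cases hb : b = 0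
    · subst hb; simp [e, h4]
    · simp [e, Matrix.mul_single_apply_of_ne, hb]
  obtain ⟨P', hP'⟩ := hu
  exact ⟨P', fun X => by rw [hP']; exact hP X⟩

theorem repIso_of_trace_eq [NeZero n] {G : Type*} [Group G] {s r : G →* GL (Fin n) (Loc p E)}
    (hs : Submodule.span (Loc p E)
      (Set.range fun g => (s g : Matrix (Fin n) (Fin n) (Loc p E))) = ⊤)
    (hr : Submodule.span (Loc p E)
      (Set.range fun g => (r g : Matrix (Fin n) (Fin n) (Loc p E))) = ⊤)
    (htr : ∀ g, (s g : Matrix (Fin n) (Fin n) (Loc p E)).trace =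
      (r g : Matrix (Fin n) (Fin n) (Loc p E)).trace) : RepIso s r := by
  obtain ⟨ψ, hψ⟩ := exists_ringHom_of_trace_eq s r hs hr htr
  obtain ⟨P, hP⟩ := exists_mul_eq_mul_of_algHom ψ
  refine ⟨P, fun g => ?_⟩
  rw [eq_mul_inv_iff_mul_eq]
  apply Units.ext
  rw [Units.val_mul, Units.val_mul, ← hψ, hP]

end TracesDetermine

/-! ### Consequences of validity on open subgroups -/

section FullRepresentations

attribute [local instance] LieRing.ofAssociativeRing

variable {p : ℕ} [Fact p.Prime] {n : ℕ} {E : Type u} [Field E] [NumberField E] {K : Type v} [Field K]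

theorem continuous_locEmb (l : E →+* PadicAlgCl p) : Continuous (locEmb p l) :=
  IsModuleTopology.continuous_of_linearMap (locEmb p l).toLinearMap

theorem continuous_locMap (σ : E →+* E) : Continuous (locMap p σ) :=
  IsModuleTopology.continuous_of_linearMap (locMap p σ).toLinearMap

theorem coe_dualRep {A G : Type*} [CommRing A] [Group G] (r : G →* GL (Fin n) A) (g : G) :
    (dualRep r g : Matrix (Fin n) (Fin n) A) = (r g⁻¹ : Matrix (Fin n) (Fin n) A)ᵀ := by
  rw [map_inv]; rfl

theorem coe_twistRep {A G : Type*} [CommRing A] [Group G] (r : G →* GL (Fin n) A) (χ : G →* Aˣ)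
    (g : G) : (twistRep r χ g : Matrix (Fin n) (Fin n) A) =
      (χ g : A) • (r g : Matrix (Fin n) (Fin n) A) := by
  change Matrix.scalar (Fin n) (χ g : A) * (r g : Matrix (Fin n) (Fin n) A) = _
  rw [Matrix.scalar_apply, Matrix.smul_eq_diagonal_mul]

theorem map_mem_padicLie (ρ : AbsGal K →ₜ* GL (Fin n) (Loc p E)) {U : Subgroup (AbsGal K)}
    (l : E →+* PadicAlgCl p) {X : Matrix (Fin n) (Fin n) (Loc p E)}
    (hX : X ∈ padicLie p (U.map ρ.toMonoidHom)) :
    X.map (locEmb p l) ∈ padicLie p (repAt ρ.toMonoidHom l).range := by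
  let _ := Matrix.linftyOpNormedRing (n := Fin n) (α := PadicAlgCl p)
  let f : Matrix (Fin n) (Fin n) (Loc p E) →ₐ[ℚ_[p]] Matrix (Fin n) (Fin n) (PadicAlgCl p) :=
    (locEmb p l).mapMatrix
  have hfc : Continuous f := IsModuleTopology.continuous_of_linearMap f.toLinearMap
  let _ := finiteNormedRing p (Matrix (Fin n) (Fin n) (Loc p E))
  let _ := finiteNormedAlgebra p (Matrix (Fin n) (Fin n) (Loc p E))
  have := finiteNormedRing_completeSpace p (Matrix (Fin n) (Fin n) (Loc p E))
  have h2 := eventually_map_exp f hfc X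
  change ∀ᶠ t in 𝓝 (0 : ℚ_[p]), _
  filter_upwards [hX, h2] with t ht ht2
  obtain ⟨_, ⟨g, -, rfl⟩, hg⟩ := ht
  refine ⟨_, ⟨g, rfl⟩, ?_⟩
  refine Eq.trans ?_ ht2
  exact congrArg f hg

variable {ρ : AbsGal K →ₜ* GL (Fin n) (Loc p E)} (hρ : IsValid ρ)

include hρ in
theorem IsValid.trace_eq_zero_of_mem {U : Subgroup (AbsGal K)}
    {X : Matrix (Fin n) (Fin n) (Loc p E)} (hX : X ∈ padicLie p (U.map ρ.toMonoidHom)) :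
    X.trace = 0 := by
  refine eq_of_forall_locEmb_eq fun l => ?_
  have h1 := hρ.span_lie_eq_sl l ▸ Submodule.subset_span (map_mem_padicLie ρ l hX)
  have h2 : (X.map (locEmb p l)).trace = 0 := h1
  rw [← trace_map_locEmb, h2, map_zero]

variable [NumberField K]

include hρ in
theorem IsValid.mem_span_of_trace_eq_zero {U : Subgroup (AbsGal K)}
    (hU : IsOpen (U : Set (AbsGal K))) (l : E →+* PadicAlgCl p)
    {y : Matrix (Fin n) (Fin n) (PadicAlgCl p)} (hy : y.trace = 0) :
    y ∈ Submodule.span (PadicAlgCl p)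
      ((fun X : Matrix (Fin n) (Fin n) (Loc p E) => X.map (locEmb p l)) ''
        padicLie p (U.map ρ.toMonoidHom)) := by
  have h1 : y ∈ Submodule.span (PadicAlgCl p) (padicLie p (repAt ρ.toMonoidHom l).range) := by
    rw [hρ.span_lie_eq_sl l]; exact hy
  refine Submodule.span_mono ?_ h1
  intro Y hY
  obtain ⟨X, hX, h⟩ := exists_mem_padicLie_map_eq ρ U hU l hY
  exact ⟨X, hX, h⟩

include hρ in
-- A linear form vanishing on `ρ_λ(U)` vanishes at `1`, hence on the difference quotients of the
-- one-parameter subgroups and on the Lie algebra. The latter spans `sl_n`, and `sl_n` together with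
-- `1` spans all matrices.
theorem IsValid.span_image_eq_top [NeZero n] {U : Subgroup (AbsGal K)}
    (hU : IsOpen (U : Set (AbsGal K))) (l : E →+* PadicAlgCl p) :
    Submodule.span (PadicAlgCl p)
      ((fun g => (ρ g : Matrix (Fin n) (Fin n) (Loc p E)).map (locEmb p l)) '' U) = ⊤ := by
  by_contra hne
  obtain ⟨f, hf, hle⟩ := Submodule.exists_le_ker_of_lt_top _ (lt_top_iff_ne_top.2 hne)
  have hg (g) (hg : g ∈ U) : f ((ρ g : Matrix (Fin n) (Fin n) (Loc p E)).map (locEmb p l)) = 0 :=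
    hle (Submodule.subset_span ⟨g, hg, rfl⟩)
  have h1 : f 1 = 0 := by
    have := hg 1 U.one_mem
    rwa [map_one, Units.val_one, Matrix.map_one _ (map_zero _) (map_one _)] at this
  let F : Matrix (Fin n) (Fin n) (Loc p E) →ₗ[ℚ_[p]] PadicAlgCl p :=
    (f.restrictScalars ℚ_[p]).comp (locEmb p l).mapMatrix.toLinearMap
  have hFc : Continuous F := IsModuleTopology.continuous_of_linearMap F
  have hX (X) (hX : X ∈ padicLie p (U.map ρ.toMonoidHom)) : F X = 0 := by
    have hlim := (hFc.tendsto X).comp (tendsto_inv_smul_exp_sub_one p X)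
    refine tendsto_nhds_unique hlim (tendsto_const_nhds.congr' ?_)
    filter_upwards [nhdsWithin_le_nhds hX] with t ht
    obtain ⟨_, ⟨g, hgU, rfl⟩, hg'⟩ := ht
    rw [Function.comp_apply, map_smul, map_sub, ← hg']
    have h2 : F 1 = 0 := by
      change f ((1 : Matrix (Fin n) (Fin n) (Loc p E)).map (locEmb p l)) = 0
      rw [Matrix.map_one _ (map_zero _) (map_one _), h1]
    have h3 : F ((ρ.toMonoidHom g : GL (Fin n) (Loc p E)) : Matrix (Fin n) (Fin n) (Loc p E)) = 0 :=
      hg g hgU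
    rw [h2, h3, sub_zero, smul_zero]
  have hsl (y : Matrix (Fin n) (Fin n) (PadicAlgCl p)) (hy : y.trace = 0) : f y = 0 := by
    have := hρ.mem_span_of_trace_eq_zero hU l hy
    have hle' : Submodule.span (PadicAlgCl p)
      ((fun X : Matrix (Fin n) (Fin n) (Loc p E) => X.map (locEmb p l)) ''
        padicLie p (U.map ρ.toMonoidHom)) ≤ LinearMap.ker f := by
      rw [Submodule.span_le]
      rintro _ ⟨X, hX', rfl⟩
      exact hX X hX'
    exact hle' this
  refine hf (LinearMap.ext fun y => ?_)
  have hn : (n : PadicAlgCl p) ≠ 0 := Nat.cast_ne_zero.2 (NeZero.ne n)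
  have h4 := hsl (y - (y.trace / n) • 1) (by
    rw [trace_sub, trace_smul, trace_one, Fintype.card_fin, smul_eq_mul, div_mul_cancel₀ _ hn,
      sub_self])
  rwa [map_sub, map_smul, h1, smul_zero, sub_zero] at h4

/-- The properties of a representation with coefficients in `E_p` which allow one to recognise its
twists from the traces of Frobenius elements. -/
structure IsFullRep (r : AbsGal K →* GL (Fin n) (Loc p E)) : Prop where
  continuous_coe : Continuous fun g => (r g : Matrix (Fin n) (Fin n) (Loc p E))
  det_eq_one : ∀ g, (r g : Matrix (Fin n) (Fin n) (Loc p E)).det = 1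
  span_eq_top : ∀ U : Subgroup (AbsGal K), IsOpen (U : Set (AbsGal K)) →
    ∀ l : E →+* PadicAlgCl p, Submodule.span (PadicAlgCl p)
      ((fun g => (r g : Matrix (Fin n) (Fin n) (Loc p E)).map (locEmb p l)) '' U) = ⊤
  exists_places : ∃ S : Finset (IsDedekindDomain.HeightOneSpectrum (𝓞 K)),
    ∀ v ∉ S, ∀ P : Ideal (IntBar K), P.IsPrime → P.under (𝓞 K) = v.asIdeal →
      ∀ φ : AbsGal K, IsArithFrobAt (𝓞 K) φ P → ∀ i : ℕ,
        ∃ e : E, (r (φ ^ i) : Matrix (Fin n) (Fin n) (Loc p E)).trace =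
          (Algebra.TensorProduct.includeRight : E →ₐ[ℚ] Loc p E) e

include hρ in
theorem IsValid.isFullRep [NeZero n] : IsFullRep ρ.toMonoidHom where
  continuous_coe := continuous_coe_rep ρ
  det_eq_one := hρ.det_eq_one
  span_eq_top _ hU l := hρ.span_image_eq_top hU l
  exists_places := by
    obtain ⟨S, -, -, hS⟩ := hρ.exists_places
    refine ⟨S, fun v hv P hP hPv φ hφ i => ?_⟩
    obtain ⟨h, hh⟩ := hS v hv P hP hPv φ hφ
    rw [map_pow]
    exact exists_trace_pow_eq hh i

include hρ in
theorem IsValid.isFullRep_dualRep [NeZero n] : IsFullRep (dualRep ρ.toMonoidHom) where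
  continuous_coe := by
    simp_rw [coe_dualRep]
    exact ((continuous_coe_rep ρ).comp continuous_inv).matrix_transpose
  det_eq_one g := by
    rw [coe_dualRep, det_transpose]
    exact hρ.det_eq_one _
  span_eq_top U hU l := by
    have h1 := congrArg (Submodule.map
      (Matrix.transposeLinearEquiv (Fin n) (Fin n) (PadicAlgCl p) (PadicAlgCl p)).toLinearMap)
      (hρ.span_image_eq_top hU l)
    rw [Submodule.map_top, LinearEquiv.range, Submodule.map_span] at h1
    rw [← h1]
    congr 1
    ext x
    constructor
    · rintro ⟨g, hg, rfl⟩
      refine ⟨_, ⟨g⁻¹, U.inv_mem hg, rfl⟩, ?_⟩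
      simp only [coe_dualRep]
      rfl
    · rintro ⟨_, ⟨g, hg, rfl⟩, rfl⟩
      refine ⟨g⁻¹, U.inv_mem hg, ?_⟩
      simp only [coe_dualRep, inv_inv]
      rfl
  exists_places := by
    obtain ⟨S, -, -, hS⟩ := hρ.exists_places
    refine ⟨S, fun v hv P hP hPv φ hφ i => ?_⟩
    obtain ⟨h, hh⟩ := hS v hv P hP hPv φ hφ
    rw [coe_dualRep, trace_transpose, map_inv, map_pow]
    exact exists_trace_inv_pow_eq hh (hρ.det_eq_one φ) i

end FullRepresentations

/-! ### From isomorphisms over `ℚ̄_p` to twists over `E_p` -/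

section TwistsFromEmbeddings

variable {p : ℕ} [Fact p.Prime] {n : ℕ} {E : Type u} [Field E] [NumberField E] {K : Type v} [Field K]

/-- `Aut(E)` acts freely on the embeddings, and for `E/ℚ` Galois both sets have `[E : ℚ]` elements.
-/
theorem exists_comp_eq [IsGalois ℚ E] (l l' : E →+* PadicAlgCl p) :
    ∃ σ : E ≃ₐ[ℚ] E, l = l'.comp (σ : E →+* E) := by
  have hinj : Function.Injective fun σ : E ≃ₐ[ℚ] E => l'.comp (σ : E →+* E) := by
    intro σ τ h
    ext e
    exact l'.injective (congrArg (fun f : E →+* PadicAlgCl p => f e) h)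
  have hcard : Fintype.card (E ≃ₐ[ℚ] E) = Fintype.card (E →+* PadicAlgCl p) := by
    rw [NumberField.Embeddings.card, ← Nat.card_eq_fintype_card, IsGalois.card_aut_eq_finrank]
  obtain ⟨σ, hσ⟩ := ((Fintype.bijective_iff_injective_and_card _).2 ⟨hinj, hcard⟩).2 l
  exact ⟨σ, hσ.symm⟩

theorem coe_mapRep_locEmb {G : Type*} [Group G] (l : E →+* PadicAlgCl p)
    (r : G →* GL (Fin n) (Loc p E)) (g : G) :
    (mapRep (locEmb p l : Loc p E →+* PadicAlgCl p) r g : Matrix (Fin n) (Fin n) (PadicAlgCl p)) =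
      (r g : Matrix (Fin n) (Fin n) (Loc p E)).map (locEmb p l) := rfl

theorem coe_conjRep (σ : E ≃ₐ[ℚ] E) (r : AbsGal K →* GL (Fin n) (Loc p E)) (g : AbsGal K) :
    (conjRep σ r g : Matrix (Fin n) (Fin n) (Loc p E)) =
      (r g : Matrix (Fin n) (Fin n) (Loc p E)).map (locMap p (σ : E →+* E)) := rfl

theorem map_locMap_map_locEmb (l : E →+* PadicAlgCl p) (σ : E →+* E)
    (M : Matrix (Fin n) (Fin n) (Loc p E)) :
    (M.map (locMap p σ)).map (locEmb p l) = M.map (locEmb p (l.comp σ)) := by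
  ext i j
  exact locEmb_locMap l σ (M i j)

theorem span_range_twistRep {A G : Type*} [CommRing A] [Group G] {r : G →* GL (Fin n) A}
    (hr : Submodule.span A (Set.range fun g => (r g : Matrix (Fin n) (Fin n) A)) = ⊤)
    (χ : G →* Aˣ) :
    Submodule.span A (Set.range fun g => (twistRep r χ g : Matrix (Fin n) (Fin n) A)) = ⊤ := by
  rw [eq_top_iff, ← hr, Submodule.span_le]
  rintro _ ⟨g, rfl⟩
  have h1 : (r g : Matrix (Fin n) (Fin n) A) =
      (((χ g)⁻¹ : Aˣ) : A) • (twistRep r χ g : Matrix (Fin n) (Fin n) A) := by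
    rw [coe_twistRep, smul_smul, Units.inv_mul, one_smul]
  simp only [h1]
  exact Submodule.smul_mem _ _ (Submodule.subset_span ⟨g, rfl⟩)

variable {s r : AbsGal K →* GL (Fin n) (Loc p E)}

theorem IsFullRep.continuous_map (hr : IsFullRep r) (l : E →+* PadicAlgCl p) :
    Continuous fun g => (r g : Matrix (Fin n) (Fin n) (Loc p E)).map (locEmb p l) :=
  hr.continuous_coe.matrix_map (continuous_locEmb l)

theorem IsFullRep.span_range_eq_top (hr : IsFullRep r) :
    Submodule.span (Loc p E) (Set.range fun g => (r g : Matrix (Fin n) (Fin n) (Loc p E))) = ⊤ := by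
  refine span_eq_top_of_forall_locEmb fun l => ?_
  rw [← hr.span_eq_top ⊤ isOpen_univ l, ← Set.range_comp]
  simp [Set.image_univ, Function.comp_def]

theorem IsFullRep.span_range_conjRep (hr : IsFullRep r) (σ : E ≃ₐ[ℚ] E) :
    Submodule.span (Loc p E)
      (Set.range fun g => (conjRep σ r g : Matrix (Fin n) (Fin n) (Loc p E))) = ⊤ := by
  refine span_eq_top_of_forall_locEmb fun l => ?_
  rw [← hr.span_eq_top ⊤ isOpen_univ (l.comp (σ : E →+* E)), ← Set.range_comp]
  simp only [Function.comp_def, coe_conjRep, map_locMap_map_locEmb]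
  simp

variable {l l' : E →+* PadicAlgCl p} {χ : AbsGal K →* (PadicAlgCl p)ˣ}

theorem IsFullRep.continuous_twist [NeZero n] (hs : IsFullRep s) (hr : IsFullRep r)
    (h : RepIso (mapRep (locEmb p l : Loc p E →+* PadicAlgCl p) s)
      (twistRep (mapRep (locEmb p l' : Loc p E →+* PadicAlgCl p) r) χ)) :
    Continuous fun g => (χ g : PadicAlgCl p) := by
  obtain ⟨P, hP⟩ := h
  have h1 (g) : (χ g : PadicAlgCl p) = ((↑P⁻¹ : Matrix (Fin n) (Fin n) (PadicAlgCl p)) *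
      (s g : Matrix (Fin n) (Fin n) (Loc p E)).map (locEmb p l) *
      (P : Matrix (Fin n) (Fin n) (PadicAlgCl p)) *
      (r g⁻¹ : Matrix (Fin n) (Fin n) (Loc p E)).map (locEmb p l')) 0 0 := by
    have h2 : Matrix.GeneralLinearGroup.scalar (Fin n) (χ g) =
        P⁻¹ * mapRep (locEmb p l : Loc p E →+* PadicAlgCl p) s g * P *
          mapRep (locEmb p l' : Loc p E →+* PadicAlgCl p) r g⁻¹ := by
      have h3 : twistRep (mapRep (locEmb p l' : Loc p E →+* PadicAlgCl p) r) χ g =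
        Matrix.GeneralLinearGroup.scalar (Fin n) (χ g) *
          mapRep (locEmb p l' : Loc p E →+* PadicAlgCl p) r g := rfl
      rw [hP, map_inv, h3]
      generalize Matrix.GeneralLinearGroup.scalar (Fin n) (χ g) = x
      generalize mapRep (locEmb p l' : Loc p E →+* PadicAlgCl p) r g = y
      group
    have h3 := congrArg (fun x : GL (Fin n) (PadicAlgCl p) =>
      (x : Matrix (Fin n) (Fin n) (PadicAlgCl p)) 0 0) h2
    rw [Matrix.GeneralLinearGroup.coe_scalar, Matrix.scalar_apply, Matrix.diagonal_apply_eq] at h3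
    exact h3
  simp_rw [h1]
  exact ((((continuous_const.matrix_mul (hs.continuous_map l)).matrix_mul
    continuous_const).matrix_mul ((hr.continuous_map l').comp continuous_inv)).matrix_elem 0 0)

theorem IsFullRep.twist_pow_eq_one (hs : IsFullRep s) (hr : IsFullRep r)
    (h : RepIso (mapRep (locEmb p l : Loc p E →+* PadicAlgCl p) s)
      (twistRep (mapRep (locEmb p l' : Loc p E →+* PadicAlgCl p) r) χ)) (g : AbsGal K) :
    (χ g : PadicAlgCl p) ^ n = 1 := by
  obtain ⟨P, hP⟩ := h
  have h1 := congrArg (fun x : GL (Fin n) (PadicAlgCl p) =>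
    (x : Matrix (Fin n) (Fin n) (PadicAlgCl p)).det) (hP g)
  simp only [Units.val_mul, Matrix.det_units_conj, coe_twistRep, det_smul, coe_mapRep_locEmb,
    Fintype.card_fin] at h1
  have h2 (l : E →+* PadicAlgCl p) (M : Matrix (Fin n) (Fin n) (Loc p E)) (hM : M.det = 1) :
      (M.map (locEmb p l)).det = 1 := by
    rw [← map_one (locEmb p l), ← hM]
    exact ((locEmb p l).map_det M).symm
  rw [h2 _ _ (hs.det_eq_one g), h2 _ _ (hr.det_eq_one g), mul_one] at h1
  exact h1.symm

/-- The character has values in the finite set of `n`-th roots of unity, so its kernel is the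
preimage of the complement of a finite set. -/
theorem isOpen_ker_of_pow_eq_one {G k : Type*} [Group G] [TopologicalSpace G] [Field k]
    [TopologicalSpace k] [T1Space k] {n : ℕ} [NeZero n] {χ : G →* kˣ}
    (hχ : Continuous fun g => (χ g : k)) (h : ∀ g, (χ g : k) ^ n = 1) :
    IsOpen (χ.ker : Set G) := by
  classical
  have hfin : ((Polynomial.nthRootsFinset n (1 : k) : Set k) \ {1}).Finite :=
    (Finset.finite_toSet _).subset Set.sdiff_subset
  have h1 : (χ.ker : Set G) = (fun g => (χ g : k)) ⁻¹'
      ((Polynomial.nthRootsFinset n (1 : k) : Set k) \ {1})ᶜ := by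
    ext g
    have hg : (χ g : k) ∈ Polynomial.nthRootsFinset n (1 : k) :=
      (Polynomial.mem_nthRootsFinset (Nat.pos_of_ne_zero (NeZero.ne n)) _).2 (h g)
    rw [SetLike.mem_coe, MonoidHom.mem_ker, Set.mem_preimage, Set.mem_compl_iff, Set.mem_sdiff,
      Set.mem_singleton_iff, Units.ext_iff, Units.val_one]
    exact ⟨fun h1 h2 => h2.2 h1, fun h1 => by_contra fun h2 => h1 ⟨hg, h2⟩⟩
  rw [h1]
  exact hfin.isClosed.isOpen_compl.preimage hχ

theorem IsFullRep.isOpen_ker_twist [NeZero n] (hs : IsFullRep s) (hr : IsFullRep r)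
    (h : RepIso (mapRep (locEmb p l : Loc p E →+* PadicAlgCl p) s)
      (twistRep (mapRep (locEmb p l' : Loc p E →+* PadicAlgCl p) r) χ)) :
    IsOpen (χ.ker : Set (AbsGal K)) :=
  isOpen_ker_of_pow_eq_one (hs.continuous_twist hr h) (hs.twist_pow_eq_one hr h)

theorem trace_map_eq_of_repIso
    (h : RepIso (mapRep (locEmb p l : Loc p E →+* PadicAlgCl p) s)
      (twistRep (mapRep (locEmb p l' : Loc p E →+* PadicAlgCl p) r) χ)) (g : AbsGal K) :
    locEmb p l (s g : Matrix (Fin n) (Fin n) (Loc p E)).trace =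
      χ g * locEmb p l' (r g : Matrix (Fin n) (Fin n) (Loc p E)).trace := by
  obtain ⟨P, hP⟩ := h
  rw [← trace_map_locEmb, ← coe_mapRep_locEmb, hP g, Units.val_mul, Units.val_mul,
    Matrix.trace_units_conj, coe_twistRep, trace_smul, coe_mapRep_locEmb, trace_map_locEmb,
    smul_eq_mul]

/-- If all traces vanished on the coset `gU`, then `tr(r(g) x) = 0` for every matrix `x`, as `r(U)`
spans; the choice `x = r(g)⁻¹` gives `n = 0`. -/
theorem IsFullRep.exists_trace_ne_zero [NeZero n] (hr : IsFullRep r) {U : Subgroup (AbsGal K)}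
    (hU : IsOpen (U : Set (AbsGal K))) (l : E →+* PadicAlgCl p) (g : AbsGal K) :
    ∃ u ∈ U, locEmb p l (r (g * u) : Matrix (Fin n) (Fin n) (Loc p E)).trace ≠ 0 := by
  by_contra! hcon
  have h1 (x : Matrix (Fin n) (Fin n) (PadicAlgCl p)) :
      ((r g : Matrix (Fin n) (Fin n) (Loc p E)).map (locEmb p l) * x).trace = 0 := by
    have hx : x ∈ Submodule.span (PadicAlgCl p)
      ((fun g => (r g : Matrix (Fin n) (Fin n) (Loc p E)).map (locEmb p l)) '' U) :=
      hr.span_eq_top U hU l ▸ Submodule.mem_top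
    induction hx using Submodule.span_induction with
    | mem x hx =>
      obtain ⟨u, hu, rfl⟩ := hx
      rw [← Matrix.map_mul, trace_map_locEmb, ← Units.val_mul, ← map_mul]
      exact hcon u hu
    | zero => simp
    | add x y _ _ hx hy => rw [mul_add, trace_add, hx, hy, add_zero]
    | smul a x _ hx => rw [mul_smul_comm, trace_smul, hx, smul_zero]
  have h2 := h1 ((r g⁻¹ : Matrix (Fin n) (Fin n) (Loc p E)).map (locEmb p l))
  rw [← Matrix.map_mul, ← Units.val_mul, ← map_mul, mul_inv_cancel, map_one, Units.val_one,
    Matrix.map_one _ (map_zero _) (map_one _), trace_one, Fintype.card_fin] at h2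
  exact NeZero.ne n (Nat.cast_eq_zero.1 h2)

/-- The quotient of the traces of `s` and `r` at a power of a Frobenius element gives the value of
`χ` there, and these traces lie in `E`. It suffices to find such a power where `χ` takes the value
`χ(g)` and the trace of `r` does not vanish. -/
theorem IsFullRep.twist_mem_range [NumberField K] [NeZero n] (hs : IsFullRep s) (hr : IsFullRep r)
    {σ : E ≃ₐ[ℚ] E} (hσ : l = l'.comp (σ : E →+* E))
    (h : RepIso (mapRep (locEmb p l : Loc p E →+* PadicAlgCl p) s)
      (twistRep (mapRep (locEmb p l' : Loc p E →+* PadicAlgCl p) r) χ)) (g : AbsGal K) :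
    ∃ e : E, l' e = χ g := by
  classical
  obtain ⟨S, hS⟩ := hs.exists_places
  obtain ⟨S', hS'⟩ := hr.exists_places
  let V : Set (AbsGal K) := {a | χ a = χ g ∧
    locEmb p l' (r a : Matrix (Fin n) (Fin n) (Loc p E)).trace ≠ 0}
  have hV : IsOpen V := by
    refine IsOpen.inter ?_ ?_
    · have : {a | χ a = χ g} = (fun a => g⁻¹ * a) ⁻¹' (χ.ker : Set (AbsGal K)) := by
        ext a
        rw [Set.mem_preimage, SetLike.mem_coe, MonoidHom.mem_ker, map_mul, map_inv, inv_mul_eq_one,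
          eq_comm]
        rfl
      change IsOpen {a | χ a = χ g}
      rw [this]
      exact (hs.isOpen_ker_twist hr h).preimage (continuous_const_mul _)
    · exact isOpen_ne.preimage ((continuous_locEmb l').comp hr.continuous_coe.matrix_trace)
  -- The elements none of whose powers lie in the open set `V` form a closed set stable under
  -- powers. If it contained all Frobenius elements outside `S ∪ S'`, it would be all of `G_K` and
  -- `V` would be empty.
  have hZ : ∀ a : AbsGal K, a ∈ V → ∃ b : AbsGal K, (∃ i : ℕ, b ^ i ∈ V) ∧
      ∃ v ∉ S ∪ S', ∃ P : Ideal (IntBar K), P.IsPrime ∧ P.under (𝓞 K) = v.asIdeal ∧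
        IsArithFrobAt (𝓞 K) b P := by
    by_contra! hcon
    obtain ⟨a, ha, hcon⟩ := hcon
    have := mem_of_isClosed_of_frobenius (S ∪ S') (Z := {b | ∀ i : ℕ, b ^ i ∉ V}) ?_ ?_ ?_ a
    · exact this 1 (by rwa [pow_one])
    · simp only [Set.ofPred_forall]
      exact isClosed_iInter fun i => hV.isClosed_compl.preimage (continuous_pow i)
    · intro b hb i j
      rw [← pow_mul]
      exact hb _
    · intro v hv P hP hPv φ hφ i hi
      exact hcon φ ⟨i, hi⟩ v hv P hP hPv hφ
  obtain ⟨u, hu, hne⟩ := hr.exists_trace_ne_zero (hs.isOpen_ker_twist hr h) l' g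
  obtain ⟨b, ⟨i, hi, hi'⟩, v, hv, P, hP, hPv, hb⟩ := hZ (g * u) ⟨by
    rw [map_mul, (MonoidHom.mem_ker).1 hu, mul_one], hne⟩
  rw [Finset.notMem_union] at hv
  obtain ⟨e, he⟩ := hS v hv.1 P hP hPv b hb i
  obtain ⟨e', he'⟩ := hS' v hv.2 P hP hPv b hb i
  have h1 := trace_map_eq_of_repIso h (b ^ i)
  rw [he, he', locEmb_includeRight, locEmb_includeRight, hi, hσ] at h1
  rw [he', locEmb_includeRight] at hi'
  refine ⟨σ e / e', ?_⟩
  rw [map_div₀, div_eq_iff hi', ← h1]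
  rfl

theorem locMap_includeRight (σ : E →+* E) (e : E) :
    locMap p σ ((Algebra.TensorProduct.includeRight : E →ₐ[ℚ] Loc p E) e) =
      (Algebra.TensorProduct.includeRight : E →ₐ[ℚ] Loc p E) (σ e) := by
  simp [locMap]

/-- An isomorphism between `s_λ` and a twist of `r_λ'` comes from an isomorphism between a conjugate
of `s` and a twist of `r`. -/
theorem IsFullRep.exists_repIso_conjRep [NumberField K] [NeZero n] (hs : IsFullRep s) (hr : IsFullRep r)
    {σ : E ≃ₐ[ℚ] E} (hσ : l = l'.comp (σ : E →+* E))
    (h : RepIso (mapRep (locEmb p l : Loc p E →+* PadicAlgCl p) s)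
      (twistRep (mapRep (locEmb p l' : Loc p E →+* PadicAlgCl p) r) χ)) :
    ∃ θ : AbsGal K →ₜ* (Loc p E)ˣ, RepIso (conjRep σ s) (twistRep r θ.toMonoidHom) := by
  classical
  choose c hc using hs.twist_mem_range hr hσ h
  have hc1 : c 1 = 1 := l'.injective (by rw [hc, map_one, map_one, Units.val_one])
  have hcm (a b) : c (a * b) = c a * c b :=
    l'.injective (by rw [hc, map_mul, map_mul, hc, hc, Units.val_mul])
  let c' : AbsGal K →* E := ⟨⟨c, hc1⟩, hcm⟩
  let j := (Algebra.TensorProduct.includeRight : E →ₐ[ℚ] Loc p E)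
  let θ₀ : AbsGal K →* (Loc p E)ˣ := (Units.map (j : E →* Loc p E)).comp c'.toHomUnits
  have hθ₀ (g) : (θ₀ g : Loc p E) = j (c g) := rfl
  have hcont : Continuous θ₀ := by
    refine continuous_of_continuousAt_one θ₀ ?_
    rw [ContinuousAt, map_one]
    refine tendsto_const_nhds.congr' ?_
    filter_upwards [(hs.isOpen_ker_twist hr h).mem_nhds χ.ker.one_mem] with g hg
    have h1 : c g = 1 := l'.injective (by
      rw [hc, (MonoidHom.mem_ker).1 hg, map_one, Units.val_one])
    exact Units.ext (by rw [hθ₀, h1, map_one, Units.val_one])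
  refine ⟨⟨θ₀, hcont⟩, repIso_of_trace_eq (hs.span_range_conjRep σ)
    (span_range_twistRep hr.span_range_eq_top _) fun g => ?_⟩
  obtain ⟨S, hS⟩ := hs.exists_places
  obtain ⟨S', hS'⟩ := hr.exists_places
  have htr (g) : (conjRep σ s g : Matrix (Fin n) (Fin n) (Loc p E)).trace =
      locMap p (σ : E →+* E) (s g : Matrix (Fin n) (Fin n) (Loc p E)).trace :=
    (AddMonoidHom.map_trace (locMap p (σ : E →+* E) : Loc p E →+ Loc p E) _).symm
  have htr' (g) : (twistRep r θ₀ g : Matrix (Fin n) (Fin n) (Loc p E)).trace =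
      θ₀ g * (r g : Matrix (Fin n) (Fin n) (Loc p E)).trace := by
    rw [coe_twistRep, trace_smul, smul_eq_mul]
  -- The traces are compared at all powers at once, which makes the set stable under powers. At
  -- Frobenius elements both sides lie in `E` and can be compared through the injective `l'`.
  have := mem_of_isClosed_of_frobenius (S ∪ S')
    (Z := {b | ∀ i : ℕ, (conjRep σ s (b ^ i) : Matrix (Fin n) (Fin n) (Loc p E)).trace =
      (twistRep r θ₀ (b ^ i) : Matrix (Fin n) (Fin n) (Loc p E)).trace}) ?_ ?_ ?_ g
  · simpa using this 1
  · simp only [Set.ofPred_forall, htr, htr']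
    exact isClosed_iInter fun i => isClosed_eq
      ((continuous_locMap _).comp (hs.continuous_coe.matrix_trace.comp (continuous_pow i)))
      (((Units.continuous_val.comp hcont).mul hr.continuous_coe.matrix_trace).comp
        (continuous_pow i))
  · intro b hb i k
    rw [← pow_mul]
    exact hb _
  · intro v hv P hP hPv b hb i
    rw [Finset.notMem_union] at hv
    obtain ⟨e, he⟩ := hS v hv.1 P hP hPv b hb i
    obtain ⟨e', he'⟩ := hS' v hv.2 P hP hPv b hb i
    have h1 := trace_map_eq_of_repIso h (b ^ i)
    rw [he, he', locEmb_includeRight, locEmb_includeRight, ← hc, ← map_mul, hσ] at h1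
    have h2 : σ e = c (b ^ i) * e' := l'.injective h1
    rw [htr, htr', he, he', hθ₀, locMap_includeRight, ← map_mul, ← h2]
    rfl

end TwistsFromEmbeddings

/-! ### From the adjoint action to twists -/

section TwistsFromLie

variable {p : ℕ} [Fact p.Prime] {n : ℕ} {E : Type u} [Field E] [NumberField E] {K : Type v} [Field K]
  {ρ : AbsGal K →ₜ* GL (Fin n) (Loc p E)}

theorem conj_mem_padicLie {U : Subgroup (AbsGal K)} (hUn : U.Normal)
    {Z : Matrix (Fin n) (Fin n) (Loc p E)} (hZ : Z ∈ padicLie p (U.map ρ.toMonoidHom))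
    (g : AbsGal K) :
    (ρ g : Matrix (Fin n) (Fin n) (Loc p E)) * Z * (ρ g⁻¹ : Matrix (Fin n) (Fin n) (Loc p E)) ∈
      padicLie p (U.map ρ.toMonoidHom) := by
  rw [map_inv]
  refine units_conj_mem_lieSet hZ (ρ g) ?_
  rintro _ ⟨a, ha, rfl⟩
  refine ⟨g * a * g⁻¹, hUn.conj_mem a ha g, ?_⟩
  rw [map_mul, map_mul, map_inv]
  rfl

/-- A representation inducing the same adjoint action as `ρ_λ` on the Lie algebra is a twist of
`ρ_λ`. -/
theorem IsValid.exists_eq_twistRep [NumberField K] [NeZero n] (hρ : IsValid ρ) {U : Subgroup (AbsGal K)}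
    (hU : IsOpen (U : Set (AbsGal K))) (l : E →+* PadicAlgCl p)
    (r : AbsGal K →* GL (Fin n) (PadicAlgCl p))
    (hr : ∀ Z ∈ padicLie p (U.map ρ.toMonoidHom), ∀ g,
      (r g : Matrix (Fin n) (Fin n) (PadicAlgCl p)) * Z.map (locEmb p l) *
        (r g⁻¹ : Matrix (Fin n) (Fin n) (PadicAlgCl p)) =
      ((ρ g : Matrix (Fin n) (Fin n) (Loc p E)) * Z *
        (ρ g⁻¹ : Matrix (Fin n) (Fin n) (Loc p E))).map (locEmb p l)) :
    ∃ χ : AbsGal K →* (PadicAlgCl p)ˣ,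
      mapRep (locEmb p l : Loc p E →+* PadicAlgCl p) ρ.toMonoidHom = twistRep r χ := by
  classical
  set s := mapRep (locEmb p l : Loc p E →+* PadicAlgCl p) ρ.toMonoidHom with hs
  -- Equal adjoint actions make `r(g)⁻¹ s(g)` commute with the image of the Lie algebra, hence with
  -- `sl_n`; it is therefore a scalar, the value of the character.
  have hcomm (g) (y : Matrix (Fin n) (Fin n) (PadicAlgCl p)) (hy : y.trace = 0) :
      Commute y ((r g⁻¹ * s g : GL (Fin n) (PadicAlgCl p)) :
        Matrix (Fin n) (Fin n) (PadicAlgCl p)) := by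
    have hy' := hρ.mem_span_of_trace_eq_zero hU l hy
    clear hy
    induction hy' using Submodule.span_induction with
    | mem y hy =>
      obtain ⟨Z, hZ, rfl⟩ := hy
      have h1 := hr Z hZ g
      rw [Matrix.map_mul, Matrix.map_mul] at h1
      have h2 : (r g : Matrix (Fin n) (Fin n) (PadicAlgCl p)) * Z.map (locEmb p l) *
        (r g⁻¹ : Matrix (Fin n) (Fin n) (PadicAlgCl p)) =
        (s g : Matrix (Fin n) (Fin n) (PadicAlgCl p)) * Z.map (locEmb p l) *
        (s g⁻¹ : Matrix (Fin n) (Fin n) (PadicAlgCl p)) := h1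
      have h3 := congrArg (fun x => (r g⁻¹ : Matrix (Fin n) (Fin n) (PadicAlgCl p)) * x *
        (s g : Matrix (Fin n) (Fin n) (PadicAlgCl p))) h2
      simp only [map_inv, mul_assoc, Units.inv_mul_cancel_left, Units.inv_mul, mul_one] at h3
      rw [Commute, SemiconjBy, map_inv, Units.val_mul, mul_assoc, h3]
    | zero => exact Commute.zero_left _
    | add x y _ _ hx hy => exact hx.add_left hy
    | smul a x _ hx => exact hx.smul_left a
  have hscal (g) : ∃ c : PadicAlgCl p, ((r g⁻¹ * s g : GL (Fin n) (PadicAlgCl p)) :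
      Matrix (Fin n) (Fin n) (PadicAlgCl p)) = Matrix.scalar (Fin n) c := by
    have h1 := Matrix.mem_range_scalar_of_commute_single
      (M := ((r g⁻¹ * s g : GL (Fin n) (PadicAlgCl p)) :
        Matrix (Fin n) (Fin n) (PadicAlgCl p))) (fun i j hij =>
          hcomm g _ (Matrix.trace_single_eq_of_ne _ _ _ hij))
    obtain ⟨c, hc⟩ := h1
    exact ⟨c, hc.symm⟩
  choose c hc using hscal
  have hmul (g) : (s g : Matrix (Fin n) (Fin n) (PadicAlgCl p)) =
      c g • (r g : Matrix (Fin n) (Fin n) (PadicAlgCl p)) := by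
    have h1 : s g = r g * (r g⁻¹ * s g) := by rw [map_inv, mul_inv_cancel_left]
    rw [h1, Units.val_mul, hc, Matrix.scalar_apply, ← Matrix.smul_eq_mul_diagonal]
  have huniq (g) (a : PadicAlgCl p) (h : (s g : Matrix (Fin n) (Fin n) (PadicAlgCl p)) =
      a • (r g : Matrix (Fin n) (Fin n) (PadicAlgCl p))) : c g = a := by
    have h1 := congrArg (fun x => (x * (r g⁻¹ : Matrix (Fin n) (Fin n) (PadicAlgCl p))) 0 0)
      ((hmul g).symm.trans h)
    simp only [smul_mul_assoc, map_inv, Units.mul_inv, Matrix.smul_apply, Matrix.one_apply_eq,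
      smul_eq_mul, mul_one] at h1
    exact h1
  let c' : AbsGal K →* PadicAlgCl p := ⟨⟨c, huniq 1 1 (by simp)⟩, fun a b => huniq _ _ (by
    rw [map_mul, map_mul, Units.val_mul, Units.val_mul, hmul a, hmul b, smul_mul_smul_comm])⟩
  refine ⟨c'.toHomUnits, MonoidHom.ext fun g => Units.ext ?_⟩
  rw [hmul, coe_twistRep]
  rfl

/-- The conjugate of a representation by an invertible matrix. -/
def conjBy {A G : Type*} [CommRing A] [Group G] (P : GL (Fin n) A) (r : G →* GL (Fin n) A) :
    G →* GL (Fin n) A :=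
  (MulAut.conj P).toMonoidHom.comp r

theorem conjBy_apply {A G : Type*} [CommRing A] [Group G] (P : GL (Fin n) A)
    (r : G →* GL (Fin n) A) (g : G) : conjBy P r g = P * r g * P⁻¹ := rfl

theorem repIso_of_eq_twistRep_conjBy {A : Type u} {G : Type v} [CommRing A] [Group G]
    {P : GL (Fin n) A} {r s : G →* GL (Fin n) A} {χ : G →* Aˣ}
    (h : s = twistRep (conjBy P r) χ) : RepIso s (twistRep r χ) := by
  rw [h]
  exact RepIso.twist χ ⟨P, fun g => rfl⟩

variable [NumberField K] [NeZero n] (hρ : IsValid ρ) {U : Subgroup (AbsGal K)}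
  (hU : IsOpen (U : Set (AbsGal K))) (hUn : U.Normal) {l l' : E →+* PadicAlgCl p}
  {σ : E ≃ₐ[ℚ] E} (hσ : l = l'.comp (σ : E →+* E)) (P : GL (Fin n) (PadicAlgCl p))

include hρ hU hUn hσ

/-- As `U` is normal, the Lie algebra is stable under `ρ(g)`. The relation between its components at
`l` and `l'` then forces `Pρ_{l'}P⁻¹` and `ρ_l` to act on it in the same way. -/
theorem IsValid.exists_isInnerTwist (h : ∀ Z ∈ padicLie p (U.map ρ.toMonoidHom),
      Z.map (locEmb p l) = (P : Matrix (Fin n) (Fin n) (PadicAlgCl p)) * Z.map (locEmb p l') *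
        (↑P⁻¹ : Matrix (Fin n) (Fin n) (PadicAlgCl p))) :
    ∃ θ, IsInnerTwist ρ.toMonoidHom σ θ := by
  obtain ⟨χ, hχ⟩ := hρ.exists_eq_twistRep hU l
    (conjBy P (mapRep (locEmb p l' : Loc p E →+* PadicAlgCl p) ρ.toMonoidHom)) (by
      intro Z hZ g
      rw [h _ (conj_mem_padicLie hUn hZ g), h Z hZ, conjBy_apply, conjBy_apply, Matrix.map_mul,
        Matrix.map_mul]
      simp only [Units.val_mul, mul_assoc, Units.inv_mul_cancel_left]
      rfl)
  exact hρ.isFullRep.exists_repIso_conjRep hρ.isFullRep hσ (repIso_of_eq_twistRep_conjBy hχ)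

theorem IsValid.exists_isOuterTwist (h : ∀ Z ∈ padicLie p (U.map ρ.toMonoidHom),
      Z.map (locEmb p l) = -((P : Matrix (Fin n) (Fin n) (PadicAlgCl p)) * (Z.map (locEmb p l'))ᵀ *
        (↑P⁻¹ : Matrix (Fin n) (Fin n) (PadicAlgCl p)))) :
    ∃ θ, IsOuterTwist ρ.toMonoidHom σ θ := by
  obtain ⟨χ, hχ⟩ := hρ.exists_eq_twistRep hU l
    (conjBy P (mapRep (locEmb p l' : Loc p E →+* PadicAlgCl p) (dualRep ρ.toMonoidHom))) (by
      intro Z hZ g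
      have h1 (g) : (mapRep (locEmb p l' : Loc p E →+* PadicAlgCl p) (dualRep ρ.toMonoidHom) g :
          Matrix (Fin n) (Fin n) (PadicAlgCl p)) =
          ((ρ g⁻¹ : Matrix (Fin n) (Fin n) (Loc p E)).map (locEmb p l'))ᵀ := by
        rw [coe_mapRep_locEmb, coe_dualRep]
        rfl
      rw [h _ (conj_mem_padicLie hUn hZ g), h Z hZ, conjBy_apply, conjBy_apply, Matrix.map_mul,
        Matrix.map_mul, transpose_mul, transpose_mul]
      simp only [Units.val_mul, mul_assoc, Units.inv_mul_cancel_left, mul_neg, neg_mul, h1, inv_inv])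
  exact hρ.isFullRep.exists_repIso_conjRep hρ.isFullRep_dualRep hσ
    (repIso_of_eq_twistRep_conjBy hχ)

end TwistsFromLie

/-! ### Elements of determinant one have logarithm of trace zero -/

section DetExp

open NormedSpace Filter

/-- The expansion of the determinant is applied over the ring of continuous functions of `(t, Y)`,
so the remainder is automatically continuous. -/
theorem exists_continuous_det_one_add_smul {A : Type*} [CommRing A] [TopologicalSpace A]
    [IsTopologicalRing A] (n : ℕ) : ∃ q : A × Matrix (Fin n) (Fin n) A → A, Continuous q ∧
      ∀ t Y, (1 + t • Y : Matrix (Fin n) (Fin n) A).det = 1 + Y.trace * t + q (t, Y) * t ^ 2 := by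
  let R := C(A × Matrix (Fin n) (Fin n) A, A)
  let M : Matrix (Fin n) (Fin n) R := of fun i j =>
    ⟨fun x => x.2 i j, continuous_snd.matrix_elem i j⟩
  let T : R := ⟨fun x => x.1, continuous_fst⟩
  refine ⟨((1 + (Polynomial.X : Polynomial R) • M.map Polynomial.C).det.divX.divX.eval T : R),
    ContinuousMap.continuous _, fun t Y => ?_⟩
  let ev : R →+* A := (Pi.evalRingHom _ (t, Y)).comp ContinuousMap.coeFnRingHom
  have h := congrArg ev (Matrix.det_one_add_smul T M)
  have hM : M.map ev = Y := rfl
  rw [map_add, map_add, map_mul, map_mul, map_pow, map_one, RingHom.map_det] at h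
  have h1 : ev.mapMatrix (1 + T • M) = 1 + t • Y := by
    rw [map_add, map_one]
    rfl
  have h2 : ev M.trace = Y.trace := AddMonoidHom.map_trace (ev : R →+ A) M
  rw [h1, h2] at h
  exact h

variable {p : ℕ} [Fact p.Prime] {n : ℕ} {E : Type u} [Field E] [NumberField E]

/-- With `t = p^k` and `Y_k = (exp(tX) - 1)/t`, the matrix `1 + tY_k = exp(X)^(p^k)` has determinant
one. Dividing the expansion of its determinant by `t` and letting `k` tend to infinity gives `tr X =
0`. -/
theorem trace_eq_zero_of_det_exp_eq_one {X : Matrix (Fin n) (Fin n) (Loc p E)}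
    (hm : ∀ m : ℕ, exp ((m : ℚ_[p]) • X) = exp X ^ m) (hdet : (exp X).det = 1) : X.trace = 0 := by
  obtain ⟨q, hq, hdq⟩ := exists_continuous_det_one_add_smul (A := Loc p E) n
  let t (k : ℕ) : ℚ_[p] := ((p ^ k : ℕ) : ℚ_[p])
  have ht0 (k) : t k ≠ 0 := Nat.cast_ne_zero.2 (pow_ne_zero k (Fact.out : p.Prime).ne_zero)
  have ht : Tendsto t atTop (𝓝 0) := by
    have h1 : ‖(p : ℚ_[p])‖ < 1 := Padic.norm_p_lt_one
    simpa [t] using tendsto_pow_atTop_nhds_zero_of_norm_lt_one h1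
  let Y (k : ℕ) := (t k)⁻¹ • (exp (t k • X) - 1)
  have hY : Tendsto Y atTop (𝓝 X) :=
    (tendsto_inv_smul_exp_sub_one p X).comp
      (tendsto_nhdsWithin_iff.2 ⟨ht, Eventually.of_forall ht0⟩)
  let τ (k : ℕ) : Loc p E := algebraMap ℚ_[p] _ (t k)
  have hτ : Tendsto τ atTop (𝓝 0) := by
    have h1 : Continuous (algebraMap ℚ_[p] (Loc p E)) :=
      IsModuleTopology.continuous_of_linearMap (Algebra.linearMap ℚ_[p] (Loc p E))
    have h2 := (h1.tendsto 0).comp ht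
    rw [map_zero] at h2
    exact h2
  have hk (k) : (Y k).trace + q (τ k, Y k) * τ k = 0 := by
    have h1 : (1 + τ k • Y k : Matrix (Fin n) (Fin n) (Loc p E)) = exp X ^ (p ^ k) := by
      rw [← hm]
      change 1 + algebraMap ℚ_[p] (Loc p E) (t k) • Y k = exp (t k • X)
      rw [algebraMap_smul, smul_smul, mul_inv_cancel₀ (ht0 k), one_smul, add_sub_cancel]
    have h2 := hdq (τ k) (Y k)
    rw [h1, det_pow, hdet, one_pow, add_assoc, left_eq_add] at h2
    have hu : IsUnit (τ k) := (isUnit_iff_ne_zero.2 (ht0 k)).map (algebraMap ℚ_[p] (Loc p E))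
    refine hu.mul_left_cancel ?_
    rw [mul_zero, ← h2]
    ring
  have hlim : Tendsto (fun k => (Y k).trace + q (τ k, Y k) * τ k) atTop
      (𝓝 (X.trace + q (0, X) * 0)) :=
    (((continuous_id.matrix_trace).tendsto X).comp hY).add
      (((hq.tendsto (0, X)).comp (hτ.prodMk_nhds hY)).mul hτ)
  simp only [hk, mul_zero, add_zero] at hlim
  exact (tendsto_nhds_unique hlim tendsto_const_nhds)

end DetExp

/-! ### Points `1 + eX` of `SL_n` with `e² = 0` -/

section InfinitesimalPoints

variable {n : ℕ} {A : Type u} [CommRing A] {R : Type u} [CommRing R] [Algebra A R] {e : R}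

theorem det_one_add_smul_map (he : e * e = 0) (X : Matrix (Fin n) (Fin n) A) :
    (1 + e • X.map (algebraMap A R)).det = 1 + algebraMap A R X.trace * e := by
  have htr : (X.map (algebraMap A R)).trace = algebraMap A R X.trace :=
    (AddMonoidHom.map_trace (algebraMap A R) X).symm
  rw [det_one_add_smul, pow_two, he, mul_zero, add_zero, htr]

/-- The element `1 + eX` of `SL_n(R)`, for `e² = 0`. -/
def epsSL (he : e * e = 0) (X : Matrix (Fin n) (Fin n) A) (hX : X.trace = 0) :
    SpecialLinearGroup (Fin n) R :=
  ⟨1 + e • X.map (algebraMap A R), by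
    rw [det_one_add_smul_map he, hX, map_zero, zero_mul, add_zero]⟩

variable (he : e * e = 0) {X : Matrix (Fin n) (Fin n) A} (hX : X.trace = 0)

theorem epsSL_inj (hinj : ∀ x : A, algebraMap A R x * e = 0 → x = 0)
    {Y : Matrix (Fin n) (Fin n) A} (hY : Y.trace = 0) :
    epsSL he X hX = epsSL he Y hY ↔ X = Y := by
  refine ⟨fun h => ?_, fun h => by subst h; rfl⟩
  ext i j
  rw [← sub_eq_zero]
  refine hinj _ ?_
  have h1 : (1 + e • X.map (algebraMap A R)) i j = (1 + e • Y.map (algebraMap A R)) i j :=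
    congrArg (fun z : SpecialLinearGroup (Fin n) R => z.1 i j) h
  simp only [Matrix.add_apply, add_right_inj, Matrix.smul_apply, Matrix.map_apply,
    smul_eq_mul] at h1
  rw [map_sub, sub_mul, mul_comm, h1, mul_comm, sub_self]

theorem map_epsSL {φ : R →+* R} {σ : A →+* A} (hφ : φ e = e)
    (hσ : ∀ x, φ (algebraMap A R x) = algebraMap A R (σ x)) :
    SpecialLinearGroup.map φ (epsSL he X hX) =
      epsSL he (X.map σ) (by
        rw [← map_zero σ, ← hX]; exact (AddMonoidHom.map_trace σ X).symm) := by
  apply Subtype.ext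
  change φ.mapMatrix (1 + e • X.map (algebraMap A R)) = 1 + e • (X.map σ).map (algebraMap A R)
  rw [map_add, map_one]
  congr 1
  ext i j
  simp [hφ, hσ]

theorem ad_app_epsSL (a : GL (Fin n) A) :
    (SLAut.ad a).app R (epsSL he X hX) =
      epsSL he ((a : Matrix (Fin n) (Fin n) A) * X * (↑a⁻¹ : Matrix (Fin n) (Fin n) A))
        (by rw [Matrix.trace_units_conj, hX]) := by
  apply Subtype.ext
  change (a : Matrix (Fin n) (Fin n) A).map (algebraMap A R) * (1 + e • X.map (algebraMap A R)) *
    (↑a⁻¹ : Matrix (Fin n) (Fin n) A).map (algebraMap A R) = 1 + e • Matrix.map _ (algebraMap A R)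
  rw [mul_add, add_mul, mul_one, mul_smul_comm, smul_mul_assoc, Matrix.map_mul, Matrix.map_mul,
    ← Matrix.map_mul, Units.mul_inv, Matrix.map_one _ (map_zero _) (map_one _)]

theorem invTranspose_app_epsSL :
    (SLAut.invTranspose n A).app R (epsSL he X hX) =
      epsSL he (-Xᵀ) (by rw [trace_neg, trace_transpose, hX, neg_zero]) := by
  have h1 : (epsSL he X hX)⁻¹ = epsSL he (-X) (by rw [trace_neg, hX, neg_zero]) := by
    rw [inv_eq_iff_mul_eq_one]
    apply Subtype.ext
    change (1 + e • X.map (algebraMap A R)) * (1 + e • (-X).map (algebraMap A R)) = 1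
    have h2 : (-X).map (algebraMap A R) = -X.map (algebraMap A R) := by ext; simp
    rw [mul_add, add_mul, add_mul, smul_mul_smul_comm, he, h2]
    simp
  change (epsSL he X hX)⁻¹.transpose = _
  rw [h1]
  apply Subtype.ext
  change (1 + e • (-X).map (algebraMap A R))ᵀ = 1 + e • (-Xᵀ).map (algebraMap A R)
  rw [transpose_add, transpose_one, transpose_smul]
  rfl

section

variable {φ : R →+* R} {σ : A →+* A} (hφ : φ e = e)
    (hσ : ∀ x, φ (algebraMap A R x) = algebraMap A R (σ x))
    (hinj : ∀ x : A, algebraMap A R x * e = 0 → x = 0) (a : GL (Fin n) A)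

include hφ hσ hinj

theorem ad_app_map_epsSL_eq_iff :
    (SLAut.ad a).app R (SpecialLinearGroup.map φ (epsSL he X hX)) = epsSL he X hX ↔
      (a : Matrix (Fin n) (Fin n) A) * X.map σ * (↑a⁻¹ : Matrix (Fin n) (Fin n) A) = X := by
  rw [map_epsSL he hX hφ hσ, ad_app_epsSL, epsSL_inj he _ hinj]

theorem ad_comp_invTranspose_app_map_epsSL_eq_iff :
    ((SLAut.ad a).comp (SLAut.invTranspose n A)).app R
      (SpecialLinearGroup.map φ (epsSL he X hX)) = epsSL he X hX ↔
      (a : Matrix (Fin n) (Fin n) A) * -(X.map σ)ᵀ * (↑a⁻¹ : Matrix (Fin n) (Fin n) A) = X := by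
  change (SLAut.ad a).app R ((SLAut.invTranspose n A).app R _) = _ ↔ _
  rw [map_epsSL he hX hφ hσ, invTranspose_app_epsSL, ad_app_epsSL, epsSL_inj he _ hinj]

end

end InfinitesimalPoints

/-! ### The points and the Lie algebra of the twisted form in coordinates -/

section TwistedFormDescription

variable (p : ℕ) [Fact p.Prime] {n : ℕ} {F E : Type u} [Field F] [CharZero F] [Field E] [CharZero E]
  [Algebra F E]

attribute [local instance] locAlgebra

theorem resGal_includeLeft (σ : E ≃ₐ[F] E) (R : Type u) [CommRing R] [Algebra (Loc p F) R]
    (x : Loc p E) : resGal p σ R (x ⊗ₜ[Loc p F] 1) = locMap p (σ : E →+* E) x ⊗ₜ[Loc p F] 1 := by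
  simp [resGal]
  rfl

/-- Naturality of `f σ` along the injective map `E_p → E_p ⊗ F_p` removes the tensor product from
the definition. -/
theorem mem_twistedFormPoints_iff (f : (E ≃ₐ[F] E) → SLAut n (Loc p E))
    (g : GL (Fin n) (Loc p E)) : g ∈ twistedFormPoints p f ↔
      ∃ x : SpecialLinearGroup (Fin n) (Loc p E), SpecialLinearGroup.toGL x = g ∧
        ∀ σ, (f σ).app (Loc p E) (SpecialLinearGroup.map
          (locMap p (σ : E →+* E) : Loc p E →+* Loc p E) x) = x := by
  let j : Loc p E →ₐ[Loc p E] Loc p E ⊗[Loc p F] Loc p F := Algebra.TensorProduct.includeLeft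
  have hj : Function.Injective j := by
    intro x y h
    have := congrArg (TensorProduct.rid (Loc p F) (Loc p E)) h
    simpa [j] using this
  have hinj : Function.Injective (SpecialLinearGroup.map (n := Fin n)
      (j : Loc p E →+* Loc p E ⊗[Loc p F] Loc p F)) := by
    intro x y h
    ext a b
    exact hj (congrArg (fun z : SpecialLinearGroup (Fin n) _ => z.1 a b) h)
  have key (x : SpecialLinearGroup (Fin n) (Loc p E)) (σ : E ≃ₐ[F] E) :
      (f σ).app (Loc p E ⊗[Loc p F] Loc p F)
        (SpecialLinearGroup.map (resGal p σ (Loc p F) : _ →+* Loc p E ⊗[Loc p F] Loc p F)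
          (SpecialLinearGroup.map (j : Loc p E →+* Loc p E ⊗[Loc p F] Loc p F) x)) =
        SpecialLinearGroup.map (j : Loc p E →+* Loc p E ⊗[Loc p F] Loc p F) x ↔
      (f σ).app (Loc p E) (SpecialLinearGroup.map
          (locMap p (σ : E →+* E) : Loc p E →+* Loc p E) x) = x := by
    have h1 : SpecialLinearGroup.map (resGal p σ (Loc p F) : _ →+* Loc p E ⊗[Loc p F] Loc p F)
          (SpecialLinearGroup.map (j : Loc p E →+* Loc p E ⊗[Loc p F] Loc p F) x) =
        SpecialLinearGroup.map (j : Loc p E →+* Loc p E ⊗[Loc p F] Loc p F)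
          (SpecialLinearGroup.map (locMap p (σ : E →+* E) : Loc p E →+* Loc p E) x) := by
      ext a b
      exact resGal_includeLeft p σ (Loc p F) (x.1 a b)
    rw [h1, ← (f σ).naturality, hinj.eq_iff]
  constructor
  · rintro ⟨x, hx, rfl⟩
    exact ⟨x, rfl, fun σ => (key x σ).1 (hx σ)⟩
  · rintro ⟨x, rfl, hx⟩
    exact ⟨x, fun σ => (key x σ).2 (hx σ), rfl⟩

variable {p}

/-- The map `c` on matrices is `X ↦ a σ(X) a⁻¹` if `α = ad(a)`, and `X ↦ -a σ(X)ᵀ a⁻¹` if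
`α = ad(a) ∘ (·)^{-T}`. -/
def IsLieTwist (α : SLAut n (Loc p E)) (σ : E →+* E)
    (c : Matrix (Fin n) (Fin n) (Loc p E) → Matrix (Fin n) (Fin n) (Loc p E)) : Prop :=
  ∃ a : GL (Fin n) (Loc p E), (α = SLAut.ad a ∧ c = fun X =>
    (a : Matrix (Fin n) (Fin n) (Loc p E)) * X.map (locMap p σ) *
      (↑a⁻¹ : Matrix (Fin n) (Fin n) (Loc p E))) ∨
    (α = (SLAut.ad a).comp (SLAut.invTranspose n (Loc p E)) ∧ c = fun X =>
    (a : Matrix (Fin n) (Fin n) (Loc p E)) * -(X.map (locMap p σ))ᵀ *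
      (↑a⁻¹ : Matrix (Fin n) (Fin n) (Loc p E)))

theorem tmul_left_injective {D : Type u} [CommRing D] [Algebra (Loc p F) D] {ε : D}
    {s : D →ₗ[Loc p F] Loc p F} (hs : s ε = 1) :
    Function.Injective fun x : Loc p E => x ⊗ₜ[Loc p F] ε := by
  intro x y h
  have h1 := congrArg (TensorProduct.rid (Loc p F) (Loc p E) ∘
    TensorProduct.map (LinearMap.id (R := Loc p F) (M := Loc p E)) s) h
  simpa [hs] using h1

/-- For `1 + eX` the determinant condition is `tr X = 0`, and `f_σ` acts on `X` by its differential
`c σ`. The linear form `s` splits off the coefficient of `ε`, so that `X` can be recovered. -/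
theorem exists_mem_twistedForm_iff {f : (E ≃ₐ[F] E) → SLAut n (Loc p E)}
    {c : (E ≃ₐ[F] E) → Matrix (Fin n) (Fin n) (Loc p E) → Matrix (Fin n) (Fin n) (Loc p E)}
    (hc : ∀ σ : E ≃ₐ[F] E, IsLieTwist (f σ) (σ : E →+* E) (c σ))
    {D : Type u} [CommRing D] [Algebra (Loc p F) D] {ε : D} (hε : ε * ε = 0)
    {s : D →ₗ[Loc p F] Loc p F} (hs : s ε = 1) (X : Matrix (Fin n) (Fin n) (Loc p E)) :
    (∃ g ∈ twistedForm p f D, (g : Matrix (Fin n) (Fin n) (Loc p E ⊗[Loc p F] D)) =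
      1 + X.map fun x => x ⊗ₜ[Loc p F] ε) ↔ X.trace = 0 ∧ ∀ σ, c σ X = X := by
  set e : Loc p E ⊗[Loc p F] D := 1 ⊗ₜ[Loc p F] ε with he_def
  have he : e * e = 0 := by
    rw [he_def, Algebra.TensorProduct.tmul_mul_tmul, hε, TensorProduct.tmul_zero]
  have hmul (x : Loc p E) : algebraMap (Loc p E) (Loc p E ⊗[Loc p F] D) x * e =
      x ⊗ₜ[Loc p F] ε := by
    rw [Algebra.TensorProduct.algebraMap_apply, he_def, Algebra.TensorProduct.tmul_mul_tmul,
      mul_one, one_mul]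
    rfl
  have hinj (x : Loc p E) (h : algebraMap (Loc p E) (Loc p E ⊗[Loc p F] D) x * e = 0) : x = 0 :=
    tmul_left_injective (E := E) hs (((hmul x).symm.trans h).trans
      (TensorProduct.zero_tmul _ _).symm)
  have hmap : (X.map fun x => x ⊗ₜ[Loc p F] ε) =
      e • X.map (algebraMap (Loc p E) (Loc p E ⊗[Loc p F] D)) := by
    ext i j
    exact (hmul _).symm.trans (mul_comm _ _)
  rw [hmap]
  have key (hX : X.trace = 0) (σ : E ≃ₐ[F] E) :
      (f σ).app (Loc p E ⊗[Loc p F] D) (SpecialLinearGroup.map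
        (resGal p σ D : Loc p E ⊗[Loc p F] D →+* Loc p E ⊗[Loc p F] D) (epsSL he X hX)) =
          epsSL he X hX ↔ c σ X = X := by
    have hφ : (resGal p σ D : Loc p E ⊗[Loc p F] D →+* Loc p E ⊗[Loc p F] D) e = e := by
      simp [he_def, resGal]
    obtain ⟨a, ⟨h1, h2⟩ | ⟨h1, h2⟩⟩ := hc σ
    · rw [h1, h2]
      exact ad_app_map_epsSL_eq_iff he hX hφ
        (σ := (locMap p (σ : E →+* E) : Loc p E →+* Loc p E)) (resGal_includeLeft p σ D) hinj a
    · rw [h1, h2]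
      exact ad_comp_invTranspose_app_map_epsSL_eq_iff he hX hφ
        (σ := (locMap p (σ : E →+* E) : Loc p E →+* Loc p E)) (resGal_includeLeft p σ D) hinj a
  constructor
  · rintro ⟨g, hg, h⟩
    have h2 := g.2
    rw [h, det_one_add_smul_map he, add_eq_left] at h2
    have hX : X.trace = 0 := hinj _ h2
    have h3 : g = epsSL he X hX := Subtype.ext h
    exact ⟨hX, fun σ => (key hX σ).1 (h3 ▸ hg σ)⟩
  · rintro ⟨hX, hg⟩
    exact ⟨epsSL he X hX, fun σ => (key hX σ).2 (hg σ), rfl⟩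

theorem mem_twistedFormLie_iff {f : (E ≃ₐ[F] E) → SLAut n (Loc p E)}
    {c : (E ≃ₐ[F] E) → Matrix (Fin n) (Fin n) (Loc p E) → Matrix (Fin n) (Fin n) (Loc p E)}
    (hc : ∀ σ : E ≃ₐ[F] E, IsLieTwist (f σ) (σ : E →+* E) (c σ))
    (X : Matrix (Fin n) (Fin n) (Loc p E)) :
    X ∈ twistedFormLie p f ↔ X.trace = 0 ∧ ∀ σ, c σ X = X :=
  exists_mem_twistedForm_iff hc (D := DualNumber (Loc p F)) (ε := DualNumber.eps) DualNumber.eps_mul_eps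
    (s := TrivSqZeroExt.sndHom (Loc p F) (Loc p F)) (TrivSqZeroExt.snd_inr (Loc p F) (1 : Loc p F)) X

end TwistedFormDescription

/-! ### The subgroup `G_L` is open and normal -/

section TwistKernel

variable {p : ℕ} [Fact p.Prime] {n : ℕ} {E : Type u} [Field E] [NumberField E] {K : Type v} [Field K]

/-- Unlike in `mapRep_twistRep`, the two rings may live in different universes, as `E_p` and `ℚ̄_p`
do. -/
theorem mapRep_twistRep_eq {A B G : Type*} [CommRing A] [CommRing B] [Group G] (φ : A →+* B)
    (r : G →* GL (Fin n) A) (χ : G →* Aˣ) :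
    mapRep φ (twistRep r χ) = twistRep (mapRep φ r) ((Units.map (φ : A →* B)).comp χ) := by
  ext1 g
  change Matrix.GeneralLinearGroup.map φ (_ * _) = _ * _
  rw [map_mul, Matrix.GeneralLinearGroup.map_scalar]
  rfl

theorem RepIso.mapRep {A B G : Type*} [CommRing A] [CommRing B] [Group G]
    {r s : G →* GL (Fin n) A} (φ : A →+* B) (h : RepIso r s) :
    RepIso (mapRep φ r) (mapRep φ s) := by
  obtain ⟨P, hP⟩ := h
  refine ⟨Matrix.GeneralLinearGroup.map φ P, fun g => ?_⟩
  change Matrix.GeneralLinearGroup.map φ (r g) = _ * Matrix.GeneralLinearGroup.map φ (s g) * _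
  rw [hP g, map_mul, map_mul, map_inv]

theorem twistKernel_normal (r : AbsGal K →* GL (Fin n) (Loc p E)) : (twistKernel r).Normal := by
  refine ⟨fun a ha g => ?_⟩
  simp only [twistKernel, Subgroup.mem_iInf, MonoidHom.mem_ker] at ha ⊢
  intro σ χ h
  rw [map_mul, map_mul, ha σ χ h, mul_one, map_inv, mul_inv_cancel]

theorem eq_one_of_mem_twistKernel {r : AbsGal K →* GL (Fin n) (Loc p E)} {σ : E ≃ₐ[ℚ] E}
    {χ : AbsGal K →ₜ* (Loc p E)ˣ} (h : IsExtraTwist r σ χ) {g : AbsGal K}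
    (hg : g ∈ twistKernel r) : χ g = 1 := by
  simp only [twistKernel, Subgroup.mem_iInf] at hg
  exact hg σ χ h

variable {ρ : AbsGal K →ₜ* GL (Fin n) (Loc p E)}

/-- If the characters differed, some embedding `λ` would distinguish them and make `ρ_λ` isomorphic
to a non-trivial twist of itself. -/
theorem IsValid.eq_of_repIso_twistRep (hρ : IsValid ρ) {χ θ : AbsGal K →ₜ* (Loc p E)ˣ}
    (h : RepIso (twistRep ρ.toMonoidHom χ.toMonoidHom) (twistRep ρ.toMonoidHom θ.toMonoidHom)) :
    χ = θ := by
  have h1 := h.twist χ.toMonoidHom⁻¹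
  have hχ : χ.toMonoidHom * χ.toMonoidHom⁻¹ = 1 := by
    ext1 g; exact mul_inv_cancel (χ g)
  rw [twistRep_twistRep, twistRep_twistRep, hχ, twistRep_one] at h1
  ext g : 1
  rw [← inv_mul_eq_one]
  refine Units.ext (eq_of_forall_locEmb_eq fun l => ?_)
  by_contra hne
  let η : AbsGal K →ₜ* (PadicAlgCl p)ˣ :=
    ⟨(Units.map ((locEmb p l : Loc p E →+* PadicAlgCl p) : Loc p E →* PadicAlgCl p)).comp
      (θ.toMonoidHom * χ.toMonoidHom⁻¹),
      (Continuous.units_map _ (continuous_locEmb l)).comp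
        (θ.continuous_toFun.mul χ.continuous_toFun.inv)⟩
  refine hρ.not_selfTwist l ⟨η, ⟨g, fun h2 => hne ?_⟩, ?_⟩
  · have h3 : locEmb p l ((θ g * (χ g)⁻¹ : (Loc p E)ˣ) : Loc p E) = 1 := congrArg Units.val h2
    rw [Units.val_one, map_one, mul_comm, ← h3]
  · have h4 := h1.mapRep (locEmb p l : Loc p E →+* PadicAlgCl p)
    rw [mapRep_twistRep_eq] at h4
    exact h4

theorem IsValid.isInnerTwist_unique (hρ : IsValid ρ) {σ : E ≃ₐ[ℚ] E}
    {χ θ : AbsGal K →ₜ* (Loc p E)ˣ} (h : IsInnerTwist ρ.toMonoidHom σ χ)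
    (h' : IsInnerTwist ρ.toMonoidHom σ θ) : χ = θ :=
  hρ.eq_of_repIso_twistRep (RepIso.trans (RepIso.symm h) h')

theorem IsValid.isOuterTwist_unique (hρ : IsValid ρ) {σ : E ≃ₐ[ℚ] E}
    {χ θ : AbsGal K →ₜ* (Loc p E)ˣ} (h : IsOuterTwist ρ.toMonoidHom σ χ)
    (h' : IsOuterTwist ρ.toMonoidHom σ θ) : χ = θ := by
  have h1 := (RepIso.trans (RepIso.symm h) h').dual
  rw [dualRep_twistRep, dualRep_twistRep, dualRep_dualRep] at h1
  exact inv_injective (hρ.eq_of_repIso_twistRep (χ := χ⁻¹) (θ := θ⁻¹) h1)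

theorem mapRep_conjRep (l : E →+* PadicAlgCl p) (σ : E ≃ₐ[ℚ] E)
    (r : AbsGal K →* GL (Fin n) (Loc p E)) :
    mapRep (locEmb p l : Loc p E →+* PadicAlgCl p) (conjRep σ r) =
      mapRep (locEmb p (l.comp (σ : E →+* E)) : Loc p E →+* PadicAlgCl p) r :=
  MonoidHom.ext fun _ => Units.ext (map_locMap_map_locEmb l _ _)

theorem IsFullRep.isOpen_ker [NeZero n] {s r : AbsGal K →* GL (Fin n) (Loc p E)}
    (hs : IsFullRep s) (hr : IsFullRep r) {σ : E ≃ₐ[ℚ] E} {χ : AbsGal K →* (Loc p E)ˣ}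
    (h : RepIso (conjRep σ s) (twistRep r χ)) : IsOpen (χ.ker : Set (AbsGal K)) := by
  let χl (l : E →+* PadicAlgCl p) : AbsGal K →* (PadicAlgCl p)ˣ :=
    (Units.map ((locEmb p l : Loc p E →+* PadicAlgCl p) : Loc p E →* PadicAlgCl p)).comp χ
  have h1 : (χ.ker : Set (AbsGal K)) = ⋂ l, ((χl l).ker : Set (AbsGal K)) := by
    ext g
    rw [Set.mem_iInter]
    constructor
    · intro hg l
      have hg' : χ g = 1 := hg
      refine (congrArg (Units.map _) hg').trans (map_one _)
    · intro hg
      refine Units.ext (eq_of_forall_locEmb_eq fun l => ?_)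
      rw [Units.val_one, map_one]
      exact congrArg Units.val (hg l : χl l g = 1)
  rw [h1]
  refine isOpen_iInter_of_finite fun l => hs.isOpen_ker_twist hr (l := l.comp (σ : E →+* E))
    (l' := l) ?_
  have h2 := h.mapRep (locEmb p l : Loc p E →+* PadicAlgCl p)
  rw [mapRep_conjRep, mapRep_twistRep_eq] at h2
  exact h2

/-- Each `σ` occurs in at most one inner and one outer twist, and `Aut(E)` is finite, so `G_L` is a
finite intersection of open kernels. -/
theorem IsValid.isOpen_twistKernel [NumberField K] [NeZero n] (hρ : IsValid ρ) :
    IsOpen (twistKernel ρ.toMonoidHom : Set (AbsGal K)) := by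
  let T : Set (AbsGal K →ₜ* (Loc p E)ˣ) := {χ | ∃ σ, IsExtraTwist ρ.toMonoidHom σ χ}
  have hT : T.Finite := by
    have h1 : T ⊆ ⋃ σ : E ≃ₐ[ℚ] E, ({χ | IsInnerTwist ρ.toMonoidHom σ χ} ∪
        {χ | IsOuterTwist ρ.toMonoidHom σ χ}) := by
      rintro χ ⟨σ, h⟩
      exact Set.mem_iUnion.2 ⟨σ, h⟩
    refine (Set.finite_iUnion fun σ => Set.Finite.union ?_ ?_).subset h1
    · exact Set.Subsingleton.finite fun χ h θ h' => hρ.isInnerTwist_unique h h'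
    · exact Set.Subsingleton.finite fun χ h θ h' => hρ.isOuterTwist_unique h h'
  have h2 : (twistKernel ρ.toMonoidHom : Set (AbsGal K)) =
      ⋂ χ ∈ T, (χ.toMonoidHom.ker : Set (AbsGal K)) := by
    ext g
    simp only [twistKernel, SetLike.mem_coe, Subgroup.mem_iInf, Set.mem_iInter, T]
    exact ⟨fun h χ ⟨σ, hσ⟩ => h σ χ hσ, fun h σ χ hσ => h χ ⟨σ, hσ⟩⟩
  rw [h2]
  refine hT.isOpen_biInter ?_
  rintro χ ⟨σ, h | h⟩
  · exact hρ.isFullRep.isOpen_ker hρ.isFullRep h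
  · exact hρ.isFullRep.isOpen_ker hρ.isFullRep_dualRep h

end TwistKernel

/-! ### The twisted action on matrices -/

section LieTwist

open NormedSpace Filter

variable {p : ℕ} [Fact p.Prime] {n : ℕ} {E : Type u} [Field E] [NumberField E]
  {α : SLAut n (Loc p E)} {σ : E →+* E}
  {c : Matrix (Fin n) (Fin n) (Loc p E) → Matrix (Fin n) (Fin n) (Loc p E)}

theorem map_locMap_smul (t : ℚ_[p]) (X : Matrix (Fin n) (Fin n) (Loc p E)) :
    (t • X).map (locMap p σ) = t • X.map (locMap p σ) := by
  ext i j
  simp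

theorem IsLieTwist.map_smul (h : IsLieTwist α σ c) (t : ℚ_[p])
    (X : Matrix (Fin n) (Fin n) (Loc p E)) : c (t • X) = t • c X := by
  obtain ⟨a, ⟨-, rfl⟩ | ⟨-, rfl⟩⟩ := h
  · simp only [map_locMap_smul, mul_smul_comm, smul_mul_assoc]
  · simp only [map_locMap_smul, transpose_smul, ← smul_neg, mul_smul_comm, smul_mul_assoc]

/-- For a fixed point of the twisted action, the component at `l ∘ σ` is a linear function of the
one at `l`, and this function does not depend on the fixed point. -/
theorem IsLieTwist.exists_linearMap (h : IsLieTwist α σ c) (l : E →+* PadicAlgCl p) :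
    ∃ T : Matrix (Fin n) (Fin n) (PadicAlgCl p) →ₗ[PadicAlgCl p]
      Matrix (Fin n) (Fin n) (PadicAlgCl p),
      ∀ X, c X = X → X.map (locEmb p (l.comp σ)) = T (X.map (locEmb p l)) := by
  obtain ⟨a, h⟩ := h
  let b : GL (Fin n) (PadicAlgCl p) :=
    Matrix.GeneralLinearGroup.map (locEmb p l : Loc p E →+* PadicAlgCl p) a
  let B : Matrix (Fin n) (Fin n) (PadicAlgCl p) := b
  let B' : Matrix (Fin n) (Fin n) (PadicAlgCl p) := (↑b⁻¹ : Matrix (Fin n) (Fin n) (PadicAlgCl p))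
  have hBB' : B' * B = 1 := Units.inv_mul b
  have hB : (a : Matrix (Fin n) (Fin n) (Loc p E)).map (locEmb p l) = B := rfl
  have hB' : (↑a⁻¹ : Matrix (Fin n) (Fin n) (Loc p E)).map (locEmb p l) = B' := rfl
  let T := (LinearMap.mulLeft (PadicAlgCl p) B').comp (LinearMap.mulRight (PadicAlgCl p) B)
  have hT (Y) : T (B * Y * B') = Y := by
    change B' * (B * Y * B' * B) = Y
    rw [mul_assoc _ B', hBB', mul_one, ← mul_assoc, hBB', one_mul]
  obtain ⟨-, rfl⟩ | ⟨-, rfl⟩ := h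
  · refine ⟨T, fun X hX => ?_⟩
    have h1 := congrArg (fun Y : Matrix (Fin n) (Fin n) (Loc p E) => Y.map (locEmb p l)) hX
    simp only [Matrix.map_mul, map_locMap_map_locEmb, hB, hB'] at h1
    rw [← h1, hT]
  · refine ⟨-(Matrix.transposeLinearEquiv (Fin n) (Fin n) (PadicAlgCl p)
      (PadicAlgCl p)).toLinearMap.comp T, fun X hX => ?_⟩
    have h1 := congrArg (fun Y : Matrix (Fin n) (Fin n) (Loc p E) => Y.map (locEmb p l)) hX
    have h2 : (-(X.map (locMap p σ))ᵀ).map (locEmb p l) = -(X.map (locEmb p (l.comp σ)))ᵀ := by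
      rw [← map_locMap_map_locEmb]
      ext i j
      simp
    simp only [Matrix.map_mul, h2, hB, hB'] at h1
    rw [LinearMap.neg_apply, LinearMap.comp_apply, ← h1, hT]
    change _ = -(-(X.map (locEmb p (l.comp σ)))ᵀ)ᵀ
    simp

/-- An element `exp X` fixed by the twisted action has a fixed logarithm `X`. -/
theorem IsLieTwist.eventually_eq (h : IsLieTwist α σ c) :
    ∀ᶠ X in 𝓝 (0 : Matrix (Fin n) (Fin n) (Loc p E)),
      ∀ x : SpecialLinearGroup (Fin n) (Loc p E), x.1 = exp X →
        α.app (Loc p E) (SpecialLinearGroup.map (locMap p σ : Loc p E →+* Loc p E) x) = x →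
          c X = X := by
  obtain ⟨U, hU, hinj, -, hneg, hmap⟩ := exists_exp_nhds p (Matrix (Fin n) (Fin n) (Loc p E))
  let τ : Matrix (Fin n) (Fin n) (Loc p E) →ₐ[ℚ_[p]] Matrix (Fin n) (Fin n) (Loc p E) :=
    (locMap p σ).mapMatrix
  have hτ : Continuous τ := IsModuleTopology.continuous_of_linearMap τ.toLinearMap
  obtain ⟨a, h⟩ := h
  let A : Matrix (Fin n) (Fin n) (Loc p E) := a
  let A' : Matrix (Fin n) (Fin n) (Loc p E) := (↑a⁻¹ : Matrix (Fin n) (Fin n) (Loc p E))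
  let d : Matrix (Fin n) (Fin n) (Loc p E) →ₐ[ℚ_[p]] Matrix (Fin n) (Fin n) (Loc p E) :=
    AlgHom.ofLinearMap ((LinearMap.mulRight ℚ_[p] A').comp (LinearMap.mulLeft ℚ_[p] A))
      (by simp [A, A']) (fun x y => by
        have : A' * A = 1 := Units.inv_mul a
        change A * (x * y) * A' = A * x * A' * (A * y * A')
        calc A * (x * y) * A' = A * x * 1 * y * A' := by simp only [mul_one, mul_assoc]
          _ = _ := by rw [← this]; simp only [mul_assoc])
  have hd : Continuous d := IsModuleTopology.continuous_of_linearMap d.toLinearMap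
  have h0 {F : Matrix (Fin n) (Fin n) (Loc p E) → Matrix (Fin n) (Fin n) (Loc p E)}
      (hF : Continuous F) (hF0 : F 0 = 0) : ∀ᶠ X in 𝓝 0, F X ∈ U :=
    hF.tendsto' 0 0 hF0 hU
  obtain ⟨rfl, rfl⟩ | ⟨rfl, rfl⟩ := h
  -- For small `X` the exponential commutes with `τ` and with conjugation, so `exp (c X) = exp X`,
  -- and small logarithms are unique. The outer case also uses that inversion and transposition pass
  -- through the exponential.
  · filter_upwards [hU, h0 hτ (map_zero τ), h0 (hd.comp hτ) (by simp)] with X hX hX1 hX2 x hx hxx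
    refine hinj hX2 hX ?_
    have h1 : d (τ (exp X)) = exp X := by
      rw [← hx]; exact congrArg Subtype.val hxx
    rw [Function.comp_apply, ← hmap _ hX1 d hd, ← hmap X hX τ hτ, h1]
  · have hN : Continuous fun X : Matrix (Fin n) (Fin n) (Loc p E) => -X := continuous_neg
    have hT : Continuous fun X => (-(τ X)ᵀ : Matrix (Fin n) (Fin n) (Loc p E)) :=
      (hτ.matrix_transpose).neg
    filter_upwards [hU, h0 hN neg_zero, h0 hT (by simp), h0 (hd.comp hT) (by simp)] with
      X hX hX1 hX2 hX3 x hx hxx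
    refine hinj hX3 hX ?_
    have hinv : ((x⁻¹ : SpecialLinearGroup (Fin n) (Loc p E)) :
        Matrix (Fin n) (Fin n) (Loc p E)) = exp (-X) := by
      have h1 : ((x⁻¹ : SpecialLinearGroup (Fin n) (Loc p E)) :
        Matrix (Fin n) (Fin n) (Loc p E)) * x.1 = 1 :=
        congrArg Subtype.val (inv_mul_cancel x)
      have h2 : exp (-X) * x.1 = 1 := by rw [hx]; exact hneg X hX
      have h3 : x.1 * ((x⁻¹ : SpecialLinearGroup (Fin n) (Loc p E)) :
        Matrix (Fin n) (Fin n) (Loc p E)) = 1 :=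
        congrArg Subtype.val (mul_inv_cancel x)
      calc _ = exp (-X) * x.1 * ((x⁻¹ : SpecialLinearGroup (Fin n) (Loc p E)) :
            Matrix (Fin n) (Fin n) (Loc p E)) := by rw [h2, one_mul]
        _ = _ := by rw [mul_assoc, h3, mul_one]
    have h1 : d (τ (exp (-X)))ᵀ = exp X := by
      rw [← hx, ← hinv]
      have h4 : SpecialLinearGroup.map (locMap p σ : Loc p E →+* Loc p E) x⁻¹ =
        (SpecialLinearGroup.map (locMap p σ : Loc p E →+* Loc p E) x)⁻¹ := map_inv _ _
      have h5 := congrArg Subtype.val hxx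
      refine Eq.trans ?_ h5
      change A * ((SpecialLinearGroup.map (locMap p σ : Loc p E →+* Loc p E) x⁻¹).1)ᵀ * A' = _
      rw [h4]
      rfl
    rw [Function.comp_apply, ← hmap _ hX2 d hd, ← transpose_neg, ← map_neg, Matrix.exp_transpose,
      ← hmap _ hX1 τ hτ, h1]

end LieTwist

/-! ### Comparison of the two Lie algebras -/

section LieAlgebraOfImage

open NormedSpace Filter

variable {p : ℕ} [Fact p.Prime] {n : ℕ} {E : Type u} [Field E] [NumberField E] {K : Type v} [Field K]

/-- The action of the cocycle `f` on matrices, at a given `σ`. -/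
theorem IsTwistCocycle.exists_isLieTwist {r : AbsGal K →* GL (Fin n) (Loc p E)}
    {f : (E ≃ₐ[twistField r] E) → SLAut n (Loc p E)} (hf : IsTwistCocycle r f)
    (σ : E ≃ₐ[twistField r] E) : ∃ c, IsLieTwist (f σ) (σ : E →+* E) c := by
  obtain ⟨-, a, h, -⟩ | ⟨-, a, h, -⟩ := hf σ
  · exact ⟨_, a, Or.inl ⟨h, rfl⟩⟩
  · exact ⟨_, a, Or.inr ⟨h, rfl⟩⟩

theorem IsTwistCocycle.app_eq {r : AbsGal K →* GL (Fin n) (Loc p E)}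
    {f : (E ≃ₐ[twistField r] E) → SLAut n (Loc p E)} (hf : IsTwistCocycle r f)
    (σ : E ≃ₐ[twistField r] E) {g : AbsGal K} (hg : g ∈ twistKernel r)
    {x : SpecialLinearGroup (Fin n) (Loc p E)} (hx : x.1 = r g) :
    (f σ).app (Loc p E) (SpecialLinearGroup.map
      (locMap p (σ : E →+* E) : Loc p E →+* Loc p E) x) = x := by
  obtain ⟨-, a, h, h'⟩ | ⟨-, a, h, h'⟩ := hf σ
  · rw [h]
    apply Subtype.ext
    rw [hx, h' g hg]
    change (a : Matrix (Fin n) (Fin n) (Loc p E)) * x.1.map (locMap p (σ : E →+* E)) * _ = _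
    rw [hx]
    rfl
  · rw [h]
    apply Subtype.ext
    rw [hx, h' g hg]
    have h1 : SpecialLinearGroup.toGL x = r g := Units.ext hx
    have h2 : ((x⁻¹ : SpecialLinearGroup (Fin n) (Loc p E)) : Matrix (Fin n) (Fin n) (Loc p E)) =
        r g⁻¹ := by
      rw [map_inv, ← h1, ← map_inv]
      rfl
    have h3 : SpecialLinearGroup.map (locMap p (σ : E →+* E) : Loc p E →+* Loc p E) x⁻¹ =
        (SpecialLinearGroup.map (locMap p (σ : E →+* E) : Loc p E →+* Loc p E) x)⁻¹ := map_inv _ _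
    change (a : Matrix (Fin n) (Fin n) (Loc p E)) *
      ((SpecialLinearGroup.map (locMap p (σ : E →+* E) : Loc p E →+* Loc p E) x)⁻¹).1ᵀ * _ = _
    rw [← h3, Units.val_mul, Units.val_mul, coe_dualRep, coe_conjRep, ← h2]
    rfl

/-- An element of the group of extra-twists, as an automorphism over its fixed field. -/
theorem exists_restrictScalars_eq {r : AbsGal K →* GL (Fin n) (Loc p E)} {σ : E ≃ₐ[ℚ] E}
    (hσ : σ ∈ extraTwists r) : ∃ τ : E ≃ₐ[twistField r] E, τ.restrictScalars ℚ = σ := by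
  refine ⟨AlgEquiv.ofRingEquiv (f := σ.toRingEquiv) fun x => ?_, rfl⟩
  exact (IntermediateField.mem_fixedField_iff _ _).1 x.2 σ hσ

variable {ρ : AbsGal K →ₜ* GL (Fin n) (Loc p E)}

/-- For small `t ≠ 0`, `exp(tX)` lies in `ρ(G_L)` and is fixed by the twisted action, hence so is
its logarithm `tX`; then `t` is divided out. -/
theorem IsValid.padicLie_subset (hρ : IsValid ρ)
    {f : (E ≃ₐ[twistField ρ.toMonoidHom] E) → SLAut n (Loc p E)}
    (hf : IsTwistCocycle ρ.toMonoidHom f) {σ : E ≃ₐ[twistField ρ.toMonoidHom] E}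
    {c : Matrix (Fin n) (Fin n) (Loc p E) → Matrix (Fin n) (Fin n) (Loc p E)}
    (hc : IsLieTwist (f σ) (σ : E →+* E) c) {X : Matrix (Fin n) (Fin n) (Loc p E)}
    (hX : X ∈ padicLie p ((twistKernel ρ.toMonoidHom).map ρ.toMonoidHom)) : c X = X := by
  have ht : Tendsto (fun t : ℚ_[p] => t • X) (𝓝 0) (𝓝 0) := by
    have h1 : Continuous fun t : ℚ_[p] => t • X :=
      IsModuleTopology.continuous_of_linearMap (LinearMap.toSpanSingleton ℚ_[p] _ X)
    exact h1.tendsto' 0 0 (zero_smul _ _)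
  have h2 : ∀ᶠ t in 𝓝[≠] (0 : ℚ_[p]), t ≠ 0 ∧ c (t • X) = t • X := by
    filter_upwards [self_mem_nhdsWithin, nhdsWithin_le_nhds hX,
      nhdsWithin_le_nhds (ht.eventually hc.eventually_eq)] with t ht0 htX htc
    obtain ⟨_, ⟨g, hg, rfl⟩, hgt⟩ := htX
    refine ⟨ht0, htc ⟨_, hρ.det_eq_one g⟩ hgt (hf.app_eq σ hg rfl)⟩
  obtain ⟨t, ht0, h3⟩ := h2.exists
  rw [hc.map_smul] at h3
  exact smul_right_injective _ ht0 h3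

section Span

variable (ρ) in
/-- The span over `ℚ̄_p` of the Lie algebra of `ρ(G_L)`, in the product over all embeddings. -/
noncomputable def lieSpan : Submodule (PadicAlgCl p)
    ((E →+* PadicAlgCl p) → Matrix (Fin n) (Fin n) (PadicAlgCl p)) :=
  Submodule.span (PadicAlgCl p)
    ((fun Z : Matrix (Fin n) (Fin n) (Loc p E) =>
        fun l : E →+* PadicAlgCl p => Z.map (locEmb p l)) ''
      padicLie p ((twistKernel ρ.toMonoidHom).map ρ.toMonoidHom))

variable (hρ : IsValid ρ)

include hρ

theorem IsValid.trace_eq_zero_of_mem_lieSpan :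
    ∀ m ∈ lieSpan ρ, ∀ l, (m l).trace = 0 := by
  intro m hm l
  induction hm using Submodule.span_induction with
  | mem m hm =>
    obtain ⟨Z, hZ, rfl⟩ := hm
    change (Z.map (locEmb p l)).trace = 0
    rw [trace_map_locEmb, hρ.trace_eq_zero_of_mem hZ, map_zero]
  | zero => simp
  | add x y _ _ hx hy => rw [Pi.add_apply, trace_add, hx, hy, add_zero]
  | smul a x _ hx => rw [Pi.smul_apply, trace_smul, hx, smul_zero]

variable [NumberField K] [NeZero n]

theorem IsValid.isClosed_image : IsClosed (Units.val ''
    ((twistKernel ρ.toMonoidHom).map ρ.toMonoidHom : Set (GL (Fin n) (Loc p E)))) :=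
  isClosed_coe_image ρ _ (Subgroup.isClosed_of_isOpen _ hρ.isOpen_twistKernel)

theorem IsValid.bracket_mem_lieSpan :
    ∀ m ∈ lieSpan ρ, ∀ m' ∈ lieSpan ρ, m * m' - m' * m ∈ lieSpan ρ := by
  intro m hm m' hm'
  induction hm, hm' using Submodule.span_induction₂ with
  | mem_mem x y hx hy =>
    obtain ⟨Z, hZ, rfl⟩ := hx
    obtain ⟨Z', hZ', rfl⟩ := hy
    refine Submodule.subset_span ⟨Z * Z' - Z' * Z,
      mul_sub_mul_mem_lieSet hρ.isClosed_image hZ hZ', funext fun l => ?_⟩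
    let F := (locEmb p l).mapMatrix (m := Fin n)
    change F (Z * Z' - Z' * Z) = F Z * F Z' - F Z' * F Z
    rw [map_sub, map_mul, map_mul]
  | zero_left y hy => simp
  | zero_right y hy => simp
  | add_left x y z _ _ _ hx hy =>
    convert (lieSpan ρ).add_mem hx hy using 1
    rw [add_mul, mul_add]; abel
  | add_right x y z _ _ _ hx hy =>
    convert (lieSpan ρ).add_mem hx hy using 1
    rw [add_mul, mul_add]; abel
  | smul_left r x y _ _ h =>
    convert (lieSpan ρ).smul_mem r h using 1
    rw [smul_mul_assoc, mul_smul_comm, smul_sub]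
  | smul_right r x y _ _ h =>
    convert (lieSpan ρ).smul_mem r h using 1
    rw [smul_mul_assoc, mul_smul_comm, smul_sub]

theorem IsValid.exists_mem_lieSpan (l : E →+* PadicAlgCl p)
    (y : Matrix (Fin n) (Fin n) (PadicAlgCl p)) (hy : y.trace = 0) :
    ∃ m ∈ lieSpan ρ, m l = y := by
  have h1 := hρ.mem_span_of_trace_eq_zero hρ.isOpen_twistKernel l hy
  have h2 : Submodule.span (PadicAlgCl p)
      ((fun X : Matrix (Fin n) (Fin n) (Loc p E) => X.map (locEmb p l)) ''
        padicLie p ((twistKernel ρ.toMonoidHom).map ρ.toMonoidHom)) ≤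
      (lieSpan ρ).map (LinearMap.proj l) := by
    rw [lieSpan, Submodule.map_span, ← Set.image_comp]
    exact le_rfl
  exact h2 h1

/-- Two embeddings whose components of the Lie algebra are not independent differ by an
extra-twist. -/
theorem IsValid.exists_extraTwist_of_graph [IsGalois ℚ E] {l l' : E →+* PadicAlgCl p}
    {φ : Matrix (Fin n) (Fin n) (PadicAlgCl p) →ₗ[PadicAlgCl p]
      Matrix (Fin n) (Fin n) (PadicAlgCl p)} (htr : ∀ x, (φ x).trace = 0)
    (hbr : ∀ x y, φ (x * y - y * x) = φ x * φ y - φ y * φ x)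
    (hsurj : ∀ y, y.trace = 0 → ∃ x, φ x = y) (hinj : ∀ x, x.trace = 0 → φ x = 0 → x = 0)
    (hφ : ∀ m ∈ lieSpan ρ, m l = φ (m l')) :
    ∃ σ ∈ extraTwists ρ.toMonoidHom, l = l'.comp (σ : E →+* E) := by
  obtain ⟨σ, hσ⟩ := exists_comp_eq l l'
  have hφ' (Z) (hZ : Z ∈ padicLie p ((twistKernel ρ.toMonoidHom).map ρ.toMonoidHom)) :
      Z.map (locEmb p l) = φ (Z.map (locEmb p l')) := hφ _ (Submodule.subset_span ⟨Z, hZ, rfl⟩)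
  have htrZ (Z) (hZ : Z ∈ padicLie p ((twistKernel ρ.toMonoidHom).map ρ.toMonoidHom)) :
      (Z.map (locEmb p l')).trace = 0 := by
    rw [trace_map_locEmb, hρ.trace_eq_zero_of_mem hZ, map_zero]
  refine ⟨σ, ?_, hσ⟩
  obtain ⟨P, Q, hPQ, h⟩ | ⟨P, Q, hPQ, h⟩ := exists_conj_or_conj_transpose φ htr hbr hsurj hinj
  · obtain ⟨θ, hθ⟩ := hρ.exists_isInnerTwist hρ.isOpen_twistKernel (twistKernel_normal _) hσ
      ⟨P, Q, hPQ, mul_eq_one_comm.1 hPQ⟩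
      (fun Z hZ => (hφ' Z hZ).trans (h _ (htrZ Z hZ)))
    exact ⟨θ, Or.inl hθ⟩
  · obtain ⟨θ, hθ⟩ := hρ.exists_isOuterTwist hρ.isOpen_twistKernel (twistKernel_normal _) hσ
      ⟨P, Q, hPQ, mul_eq_one_comm.1 hPQ⟩
      (fun Z hZ => (hφ' Z hZ).trans (h _ (htrZ Z hZ)))
    exact ⟨θ, Or.inr hθ⟩

end Span

variable [NumberField K] [IsGalois ℚ E] {f : (E ≃ₐ[twistField ρ.toMonoidHom] E) → SLAut n (Loc p E)}
  {c : (E ≃ₐ[twistField ρ.toMonoidHom] E) → Matrix (Fin n) (Fin n) (Loc p E) →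
    Matrix (Fin n) (Fin n) (Loc p E)}

/-- By Goursat it is enough to match the components of `X` at two embeddings. If these are dependent
on `lieSpan`, an extra-twist `τ` relates the embeddings, and `X` satisfies the same relation `T` as
`lieSpan`, because both are fixed by `c τ`. -/
theorem IsValid.mem_padicLie [NeZero n] (hρ : IsValid ρ) (hf : IsTwistCocycle ρ.toMonoidHom f)
    (hc : ∀ σ, IsLieTwist (f σ) (σ : E →+* E) (c σ)) {X : Matrix (Fin n) (Fin n) (Loc p E)}
    (hX0 : X.trace = 0) (hX : ∀ σ, c σ X = X) :
    X ∈ padicLie p ((twistKernel ρ.toMonoidHom).map ρ.toMonoidHom) := by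
  have hspan := coe_span_lieSet (p := p) hρ.isClosed_image
  have key : (fun l => X.map (locEmb p l)) ∈ lieSpan ρ := by
    have hX0' (l : E →+* PadicAlgCl p) : (X.map (locEmb p l)).trace = 0 := by
      rw [trace_map_locEmb, hX0, map_zero]
    refine mem_of_forall_pair hρ.trace_eq_zero_of_mem_lieSpan hρ.bracket_mem_lieSpan
      hρ.exists_mem_lieSpan fun l l' => ?_
    obtain h | ⟨φ, htr, hbr, hsurj, hinj, hφ⟩ := surjective_or_graph
      hρ.trace_eq_zero_of_mem_lieSpan hρ.bracket_mem_lieSpan hρ.exists_mem_lieSpan l l'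
    · exact h _ _ (hX0' l) (hX0' l')
    · obtain ⟨σ, hσ, rfl⟩ := hρ.exists_extraTwist_of_graph htr hbr hsurj hinj hφ
      obtain ⟨τ, rfl⟩ := exists_restrictScalars_eq hσ
      obtain ⟨T, hT⟩ := (hc τ).exists_linearMap l'
      have hT' (m) (hm : m ∈ lieSpan ρ) : m (l'.comp (τ : E →+* E)) = T (m l') := by
        induction hm using Submodule.span_induction with
        | mem m hm =>
          obtain ⟨Z, hZ, rfl⟩ := hm
          exact hT Z (hρ.padicLie_subset hf (hc τ) hZ)
        | zero => simp
        | add x y _ _ hx hy => rw [Pi.add_apply, Pi.add_apply, map_add, hx, hy]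
        | smul a x _ hx => rw [Pi.smul_apply, Pi.smul_apply, map_smul, hx]
      obtain ⟨m, hm, hml⟩ := hρ.exists_mem_lieSpan l' _ (hX0' l')
      exact ⟨m, hm, (hT' m hm).trans (hml ▸ (hT X (hX τ)).symm), hml⟩
  have h1 : X ∈ Submodule.span ℚ_[p]
      (padicLie p ((twistKernel ρ.toMonoidHom).map ρ.toMonoidHom)) := by
    refine mem_of_mem_span_locEmb (Submodule.span_mono (Set.image_mono ?_) key)
    exact Submodule.subset_span
  exact hspan.subset h1

end LieAlgebraOfImage

/-! ### Existence of the cocycle, equality of Lie algebras and openness -/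

section Conclusion

open NormedSpace Filter

variable {p : ℕ} [Fact p.Prime] {n : ℕ} {E : Type u} [Field E] [NumberField E] {K : Type v} [Field K]

/-- The character of an extra-twist is trivial on `G_L`, so the inverse of the matrix of the
isomorphism, or of its inverse transpose in the outer case, serves as `α_σ`. -/
theorem exists_isTwistCocycle (r : AbsGal K →* GL (Fin n) (Loc p E)) :
    ∃ f, IsTwistCocycle r f := by
  have h (σ : E ≃ₐ[twistField r] E) : ∃ α : SLAut n (Loc p E),
    ((∃ χ, IsInnerTwist r (σ.restrictScalars ℚ) χ) ∧
      ∃ a : GL (Fin n) (Loc p E), α = SLAut.ad a ∧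
        ∀ g ∈ twistKernel r, r g = a * conjRep (σ.restrictScalars ℚ) r g * a⁻¹) ∨
    ((∃ χ, IsOuterTwist r (σ.restrictScalars ℚ) χ) ∧
      ∃ a : GL (Fin n) (Loc p E), α = (SLAut.ad a).comp (SLAut.invTranspose n (Loc p E)) ∧
        ∀ g ∈ twistKernel r, r g = a * dualRep (conjRep (σ.restrictScalars ℚ) r) g * a⁻¹) := by
    have hσ : σ.restrictScalars ℚ ∈ extraTwists r := by
      -- By the Galois correspondence, an automorphism of `E` fixing `E^Γ` belongs to `Γ`.
      rw [← IntermediateField.fixingSubgroup_fixedField (extraTwists r)]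
      rw [IntermediateField.mem_fixingSubgroup_iff]
      intro x hx
      exact σ.commutes ⟨x, hx⟩
    have htw (s : AbsGal K →* GL (Fin n) (Loc p E)) {χ : AbsGal K →ₜ* (Loc p E)ˣ}
        (hχ : IsExtraTwist r (σ.restrictScalars ℚ) χ) {g} (hg : g ∈ twistKernel r) :
        twistRep s χ.toMonoidHom g = s g := by
      apply Units.ext
      rw [coe_twistRep]
      change ((χ g : (Loc p E)ˣ) : Loc p E) • _ = _
      rw [eq_one_of_mem_twistKernel hχ hg, Units.val_one, one_smul]
    obtain ⟨χ, hχ⟩ := hσ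
    rcases id hχ with h | h
    · obtain ⟨P, hP⟩ := id h
      refine ⟨_, Or.inl ⟨⟨χ, h⟩, P⁻¹, rfl, fun g hg => ?_⟩⟩
      rw [hP g, htw _ hχ hg]
      group
    · obtain ⟨P, hP⟩ := id h
      refine ⟨_, Or.inr ⟨⟨χ, h⟩, (glInvTranspose n (Loc p E) P)⁻¹, rfl, fun g hg => ?_⟩⟩
      change _ = _ * glInvTranspose n (Loc p E) (conjRep (σ.restrictScalars ℚ) r g) * _
      rw [hP g, htw _ hχ hg, map_mul, map_mul, map_inv]
      have h1 : glInvTranspose n (Loc p E) (dualRep r g) = r g := glInvTranspose_invol (r g)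
      rw [h1]
      group
  choose f hf using h
  exact ⟨f, hf⟩

variable {ρ : AbsGal K →ₜ* GL (Fin n) (Loc p E)}
  {f : (E ≃ₐ[twistField ρ.toMonoidHom] E) → SLAut n (Loc p E)}

theorem IsValid.map_twistKernel_le (hρ : IsValid ρ) (hf : IsTwistCocycle ρ.toMonoidHom f) :
    (twistKernel ρ.toMonoidHom).map ρ.toMonoidHom ≤ twistedFormPoints p f := by
  rintro _ ⟨g, hg, rfl⟩
  rw [mem_twistedFormPoints_iff]
  exact ⟨⟨_, hρ.det_eq_one g⟩, Units.ext rfl, fun σ => hf.app_eq σ hg rfl⟩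

variable [NumberField K] [IsGalois ℚ E]

theorem IsValid.padicLie_eq_twistedFormLie [NeZero n] (hρ : IsValid ρ)
    (hf : IsTwistCocycle ρ.toMonoidHom f) :
    padicLie p ((twistKernel ρ.toMonoidHom).map ρ.toMonoidHom) = twistedFormLie p f := by
  choose c hc using hf.exists_isLieTwist
  ext X
  rw [mem_twistedFormLie_iff hc]
  exact ⟨fun hX => ⟨hρ.trace_eq_zero_of_mem hX, fun σ => hρ.padicLie_subset hf (hc σ) hX⟩,
    fun hX => hρ.mem_padicLie hf hc hX.1 hX.2⟩

/-- A point of `H(F_p)` close to `1` is `exp X` with `X` small. Determinant one gives trace zero,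
invariance of the point gives invariance of `X`, so `X` lies in the Lie algebra of `ρ(G_L)` and is
small enough for `exp X` to lie in `ρ(G_L)`. -/
theorem IsValid.isOpen_subgroupOf [NeZero n] (hρ : IsValid ρ)
    (hf : IsTwistCocycle ρ.toMonoidHom f) :
    IsOpen ((((twistKernel ρ.toMonoidHom).map ρ.toMonoidHom).subgroupOf
        (twistedFormPoints p f) : Subgroup (twistedFormPoints p f)) :
        Set (twistedFormPoints p f)) := by
  choose c hc using hf.exists_isLieTwist
  obtain ⟨U, hU, -, hpow, -⟩ := exists_exp_nhds p (Matrix (Fin n) (Fin n) (Loc p E))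
  obtain ⟨W, hW, hWexp⟩ := eventually_exp_mem_of_mem_span (p := p) hρ.isClosed_image
  have hV : ∀ᶠ X in 𝓝 (0 : Matrix (Fin n) (Fin n) (Loc p E)), (X ∈ U ∧ X ∈ W) ∧
      ∀ σ, ∀ x : SpecialLinearGroup (Fin n) (Loc p E), x.1 = exp X →
        (f σ).app (Loc p E) (SpecialLinearGroup.map
          (locMap p (σ : E →+* E) : Loc p E →+* Loc p E) x) = x → c σ X = X :=
    Eventually.and (inter_mem hU hW) (eventually_all.2 fun σ => (hc σ).eventually_eq)
  have h1 : ∀ᶠ Y in 𝓝 (1 : Matrix (Fin n) (Fin n) (Loc p E)),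
      ∀ h ∈ twistedFormPoints p f, (h : Matrix (Fin n) (Fin n) (Loc p E)) = Y →
        h ∈ (twistKernel ρ.toMonoidHom).map ρ.toMonoidHom := by
    rw [← map_exp_nhds p, eventually_map]
    filter_upwards [hV] with X hX h hh hhX
    obtain ⟨⟨hXU, hXW⟩, hXσ⟩ := hX
    obtain ⟨x, rfl, hx⟩ := (mem_twistedFormPoints_iff p f h).1 hh
    have hxX : x.1 = exp X := hhX
    have htr : X.trace = 0 := trace_eq_zero_of_det_exp_eq_one (hpow X hXU) (hxX ▸ x.2)
    obtain ⟨g, hg, hgX⟩ := hWexp X hXW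
      (hρ.mem_padicLie hf hc htr fun σ => hXσ σ x hxX (hx σ))
    have h2 : SpecialLinearGroup.toGL x = g := Units.ext (hxX.trans hgX.symm)
    rw [h2]
    exact hg
  refine Subgroup.isOpen_of_mem_nhds _ (g := 1) ?_
  have hcont : Continuous fun h : twistedFormPoints p f =>
      ((h : GL (Fin n) (Loc p E)) : Matrix (Fin n) (Fin n) (Loc p E)) :=
    Units.continuous_val.comp continuous_subtype_val
  filter_upwards [(hcont.tendsto' 1 1 rfl).eventually h1] with h hh
  exact hh h h.2 rfl

end Conclusion

theorem mainTheorem2 {K : Type v} [Field K] [NumberField K] {E : Type u} [Field E] [NumberField E]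
    [IsGalois ℚ E] {p : ℕ} [Fact p.Prime] {n : ℕ} (ρ : AbsGal K →ₜ* GL (Fin n) (Loc p E))
    (hρ : IsValid ρ) :
    (∃ f, IsTwistCocycle ρ.toMonoidHom f) ∧
    ∀ f, IsTwistCocycle ρ.toMonoidHom f →
      padicLie p ((twistKernel ρ.toMonoidHom).map ρ.toMonoidHom) = twistedFormLie p f ∧
      (twistKernel ρ.toMonoidHom).map ρ.toMonoidHom ≤ twistedFormPoints p f ∧
      IsOpen ((((twistKernel ρ.toMonoidHom).map ρ.toMonoidHom).subgroupOf
        (twistedFormPoints p f) : Subgroup (twistedFormPoints p f)) :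
        Set (twistedFormPoints p f)) := by
  refine ⟨exists_isTwistCocycle _, fun f hf => ?_⟩
  -- For `n = 0` all matrices coincide and everything is trivial; the arguments above divide by `n`
  -- or use an index.
  rcases Nat.eq_zero_or_pos n with rfl | hn
  · refine ⟨?_, hρ.map_twistKernel_le hf, ?_⟩
    · choose c hc using hf.exists_isLieTwist
      ext X
      rw [mem_twistedFormLie_iff hc]
      refine ⟨fun _ => ⟨by simp [Matrix.trace], fun σ => Subsingleton.elim _ _⟩, fun _ => ?_⟩
      exact Filter.Eventually.of_forall fun t => ⟨1, one_mem _, Subsingleton.elim _ _⟩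
    · convert isOpen_univ
      rw [Set.eq_univ_iff_forall]
      intro x
      have : x = 1 := Subtype.ext (Units.ext (Subsingleton.elim _ _))
      rw [this]
      exact one_mem _
  · have : NeZero n := ⟨hn.ne'⟩
    exact ⟨hρ.padicLie_eq_twistedFormLie hf, hρ.map_twistKernel_le hf, hρ.isOpen_subgroupOf hf⟩
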